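/- **Setting.** Minkowski space is $\mathbb R^3$ with Cartesian coordinates $x=(x^0,x^1,x^2)$ and metric $\eta=\mathrm{diag}(1,-1,-1)$; $m\in\mathbb R\setminus\{0\}$, $s\in\{1,-1\}$, $\gamma^0=\sigma_3$, $\gamma^1=is\sigma_1$, $\gamma^2=i\sigma_2$. For a smooth real potential $A=(A_0,A_1,A_2)$ put $\mathcal P_\nu=i\partial_\nu-A_\nu$ and $H=\gamma^\nu\mathcal P_\nu-m$, acting on two-component spinors. A symmetry operator on an open set $U$ is $X=\xi^\nu\mathcal P_\nu+\chi$, with smooth real functions $\xi^\nu$ and a smooth $2\times2$ matrix function $\chi$ on $U$, such that $[X,H]=\Psi H$ on smooth spinor fields for some $\Psi=\Psi^\nu\mathcal P_\nu+\Psi_0$ with smooth matrix coefficients. A complete set on $U$ is a pair $\{X_1,X_2\}$ of symmetry operators with $[X_1,X_2]=0$ whose vector fields $\xi_1,\xi_2$ are linearly independent over $\mathbb R$. Write $p_\nu$ for the vector field $\partial_\nu$ and $l_{\alpha\nu}=x_\alpha p_\nu-x_\nu p_\alpha$ ($x_\alpha=\eta_{\alpha\beta}x^\beta$). For a vector field $\xi$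 put $\varphi_\alpha[\xi]=-\frac s4\,\eta^{\sigma\rho}(\partial_\rho\xi^\mu)\,\epsilon_{\mu\sigma\alpha}$, $\epsilon_{012}=1$. Consider the following pairs $\{\eta_1,\eta_2\}$ and coordinates $u(x)$ with a distinguished coordinate $\tau$; call the other two, in the order $\eta_1,\eta_2$, $v_1,v_2$. Let $N(u)$ be the matrix given, and let $G_0,G_1,G_2,Z$ be the matrix functions of $\tau$ given ($Z=0$ and $N=1$ if not listed). 1. $\{p_0,p_1\}$: $u=x$; $\tau=x^2$; $v=(x^0,x^1)$; $G=(\gamma^2,\gamma^0,\gamma^1)$. 2. $\{p_1,p_2\}$: $u=x$; $\tau=x^0$; $v=(x^1,x^2)$; $G=(\gamma^0,\gamma^1,\gamma^2)$. 3. $\{p_0,l_{21}\}$: $u=(x^0,r,\varphi)$ polar, $x^1=r\cos\varphi$, $x^2=r\sin\varphi$, $r>0$, $-\pi<\varphi<\pi$; $\tau=r$; $v=(x^0,\varphi)$; $N=\exp(-\frac{is}2\varphi\gamma^0)$; $G=(\gamma^1,\gamma^0,\frac1r\gamma^2)$; $Z=\frac s{2r}\gamma^2\gamma^0$. 4. $\{p_1,l_{02}\}$,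 for $\varepsilon=\pm1$, in both cases $\tau=u_0>0$, $v=(u_1,u_2)$, $N=u_0^{-1/2}\exp(-\frac{is}2u_2\gamma^1)$: (a) on $\varepsilon x^0>|x^2|$: $x^0=\varepsilon u_0\cosh u_2$, $x^1=u_1$, $x^2=\varepsilon u_0\sinh u_2$; $G=(\varepsilon\gamma^0,\gamma^1,\frac{\varepsilon}{u_0}\gamma^2)$; (b) on $\varepsilon x^2>|x^0|$: $x^0=\varepsilon u_0\sinh u_2$, $x^1=u_1$, $x^2=\varepsilon u_0\cosh u_2$; $G=(\varepsilon\gamma^2,\gamma^1,\frac{\varepsilon}{u_0}\gamma^0)$. 5. $\{p_1,\frac12(p_0+p_2)\}$: $u=(x^0-x^2,\;x^1,\;x^0+x^2)$; $\tau=u_0$; $v=(u_1,u_2)$; $G=(\gamma^0-\gamma^2,\gamma^1,\gamma^0+\gamma^2)$. 6. $\{\frac12(p_0+p_2),\,l_{21}+l_{01}+a(p_0-p_2)\}$, $a\in\mathbb R$; $\tau=u_0$, $v=(u_1,u_2)$, $N=\exp(-\frac{is}2u_2(\gamma^0-\gamma^2))$: (a) $a\ne0$: $u_0=\frac12(x^0-x^2)^2-2ax^1$,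 $u_1=x^0+x^2+\frac1a(x^0-x^2)\big[\frac{(x^0-x^2)^2}{6a}-x^1\big]$, $u_2=\frac{x^0-x^2}{2a}$; $G=\big(-2a\gamma^1,\;\gamma^0+\gamma^2+\frac{u_0}{2a^2}(\gamma^0-\gamma^2),\;\frac1{2a}(\gamma^0-\gamma^2)\big)$; (b) $a=0$: on $x^0\neq x^2$, $u_0=x^0-x^2$, $u_1=x^0+x^2-\frac{(x^1)^2}{x^0-x^2}$, $u_2=\frac{x^1}{x^0-x^2}$; $G=\big(\gamma^0-\gamma^2,\;\gamma^0+\gamma^2,\;\frac1{u_0}\gamma^1\big)$; $Z=\frac{i}{2u_0}(\gamma^0-\gamma^2)$. **Theorem 5.1.** (I) For each of these pairs the coordinate domains listed have dense union, each $u$ is a smooth diffeomorphism of an open set onto an open set, and $\eta_1=\partial_{v_1}$, $\eta_2=\partial_{v_2}$ there. Let $V$ be the region described by a nonempty open coordinate box, let $J$ be its interval of values of $\tau$, and let $A_0,A_1,A_2$ be arbitrary smooth real functions on $J$. Take the potential $A=\sum_\nu A_\nu(\tau)\,du_\nu$, and let $X_j=\eta_j^\nu\mathcal P_\nu+A_{v_j}(\tau)+\varphi_\alpha[\eta_j]\gamma^\alpha$,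 where $A_{v_j}$ (and $A_\tau$) denotes the component belonging to the coordinate $v_j$ (respectively $\tau$). Then $\{X_1,X_2\}$ is a complete set on $V$. Moreover, for all $\lambda_1,\lambda_2\in\mathbb C$ and $1\le n\le\infty$, a $C^n$ spinor field $\psi$ on $V$ satisfies $$X_1\psi=\lambda_1\psi,\qquad X_2\psi=\lambda_2\psi,\qquad H\psi=0$$ if and only if $\psi=e^{-i\lambda_1v_1-i\lambda_2v_2}N(u)\,\tilde\psi(\tau)$ for a two-component $C^n$ function $\tilde\psi$ on $J$ satisfying the system of ordinary differential equations $$\Big\{G_0\big(i\tfrac{d}{d\tau}-A_\tau\big)+G_1(\lambda_1-A_{v_1})+G_2(\lambda_2-A_{v_2})+Z-m\Big\}\tilde\psi=0 .$$ (II) Let $A$ be any smooth potential on a connected open set $U$ and $\{X_1,X_2\}$ any complete set on $U$. Then there are a pair $\{\eta_1,\eta_2\}$ of the list, a Poincaré transformation $g:x\mapsto x'=\Lambda x+b$ with $\Lambda\in SO(1,2)$, an invertible matrix $S$ with $S^{-1}\Lambda^\nu{}_\alpha\gamma^\alpha S=\gamma^\nu$, an invertible real matrix $(c_{jk})$ and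 $d_1,d_2\in\mathbb C$ such that the operators $\tilde X_j=\sum_kc_{jk}S^{-1}X_kS+d_j$, written in the coordinates $x'$, have vector fields $\eta_1,\eta_2$ on $g(U)$. Moreover, for every coordinate box (as in (I)) whose region $V$ lies in $g(U)$ there are smooth real functions $A_\nu$ of $\tau$ on $J$ and a smooth real $f$ on $V$ such that on $V$ the transformed potential $A'_\nu(x')=(\Lambda^{-1})^\alpha{}_\nu A_\alpha(g^{-1}x')$ equals the potential of (I) plus $\partial_\nu f$, and the zeroth-order coefficients of $\tilde X_j$ are those of the operators of (I). For all $\mu_1,\mu_2\in\mathbb C$ and $1\le n\le\infty$, a $C^n$ spinor field $\psi$ on $g^{-1}(V)$ satisfies $X_1\psi=\mu_1\psi$, $X_2\psi=\mu_2\psi$, $H\psi=0$ if and only if $$\psi(x)=e^{-if(x')}\,S\,\big[e^{-i\lambda_1v_1-i\lambda_2v_2}N(u)\tilde\psi(\tau)\big](x'),\qquad x'=gx,\quad\lambda_j=\sum_kc_{jk}\mu_k+d_j,$$ with $\tilde\psi$ a $C^n$ solution on $J$ of the system of ordinary differential equations in (I). -/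

import Mathlib

open scoped ContDiff Matrix

noncomputable section

namespace DiracSep

/-- Cartesian coordinates `(x⁰, x¹, x²)`; also used for triples of curvilinear coordinates. -/
abbrev Spacetime := Fin 3 → ℝ

/-- Two-component spinors. -/
abbrev Spinor := Fin 2 → ℂ

/-- `2 × 2` complex matrices. -/
abbrev Mat2 := Matrix (Fin 2) (Fin 2) ℂ

/-- The diagonal entries of the Minkowski metric `diag(1, -1, -1)`. -/
def etaDiag : Fin 3 → ℝ := ![1, -1, -1]

/-- The Minkowski metric. -/
def eta : Matrix (Fin 3) (Fin 3) ℝ := Matrix.diagonal etaDiag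

/-- The totally antisymmetric symbol on `{0, 1, 2}` with value `1` at `(0, 1, 2)`. -/
def levi (i j k : Fin 3) : ℝ :=
  (((j : ℕ) : ℝ) - ((i : ℕ) : ℝ)) * (((k : ℕ) : ℝ) - ((i : ℕ) : ℝ)) *
    (((k : ℕ) : ℝ) - ((j : ℕ) : ℝ)) / 2

/-- The Dirac matrices `γ⁰ = σ₃`, `γ¹ = i s σ₁`, `γ² = i σ₂`. -/
def gam (s : ℝ) : Fin 3 → Mat2 :=
  ![!![1, 0; 0, -1],
    !![0, Complex.I * (s : ℂ); Complex.I * (s : ℂ), 0],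
    !![0, 1; -1, 0]]

/-- The partial derivative `∂_ν` of a function of three real variables. -/
def pd {E : Type*} [NormedAddCommGroup E] [NormedSpace ℝ E]
    (ν : Fin 3) (f : Spacetime → E) (x : Spacetime) : E :=
  fderiv ℝ f x (Pi.single ν (1 : ℝ))

/-- The generalized momentum `𝒫_ν = i ∂_ν - A_ν`. -/
def mom (A : Spacetime → Fin 3 → ℝ) (ν : Fin 3) (ψ : Spacetime → Spinor) (x : Spacetime) :
    Spinor :=
  Complex.I • pd ν ψ x - (A x ν : ℂ) • ψ x

/-- The Dirac operator `H = γ^ν 𝒫_ν - m` in Cartesian coordinates. -/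
def dirac (s m : ℝ) (A : Spacetime → Fin 3 → ℝ) (ψ : Spacetime → Spinor) (x : Spacetime) :
    Spinor :=
  (∑ ν, gam s ν *ᵥ mom A ν ψ x) - (m : ℂ) • ψ x

/-- Coefficients of a first-order operator `X = ξ^ν 𝒫_ν + χ`, with real scalar functions `ξ^ν`
and a matrix function `χ`. -/
structure FirstOrder where
  xi : Spacetime → Fin 3 → ℝ
  chi : Spacetime → Mat2

/-- The action of `X = ξ^ν 𝒫_ν + χ` on spinor fields. -/
def FirstOrder.act (A : Spacetime → Fin 3 → ℝ) (X : FirstOrder) (ψ : Spacetime → Spinor)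
    (x : Spacetime) : Spinor :=
  (∑ ν, (X.xi x ν : ℂ) • mom A ν ψ x) + X.chi x *ᵥ ψ x

/-- `X` is a symmetry operator on `U`: its coefficients are smooth and `[X, H] = Ψ H` on smooth
spinor fields, with a multiplier `Ψ = Ψ^ν 𝒫_ν + Ψ₀`. -/
def IsSymmetry (s m : ℝ) (A : Spacetime → Fin 3 → ℝ) (U : Set Spacetime) (X : FirstOrder) :
    Prop :=
  ContDiffOn ℝ ∞ X.xi U ∧
  (∀ i j, ContDiffOn ℝ ∞ (fun x => X.chi x i j) U) ∧
  ∃ (Psi : Fin 3 → Spacetime → Mat2) (Psi0 : Spacetime → Mat2),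
    (∀ ν i j, ContDiffOn ℝ ∞ (fun x => Psi ν x i j) U) ∧
    (∀ i j, ContDiffOn ℝ ∞ (fun x => Psi0 x i j) U) ∧
    ∀ ψ : Spacetime → Spinor, ContDiffOn ℝ ∞ ψ U → ∀ x ∈ U,
      X.act A (dirac s m A ψ) x - dirac s m A (X.act A ψ) x =
        (∑ ν, Psi ν x *ᵥ mom A ν (dirac s m A ψ) x) + Psi0 x *ᵥ dirac s m A ψ x

/-- A complete set on `U`: two commuting symmetry operators whose vector fields `ξ₁`, `ξ₂`
are linearly independent over `ℝ` (so the operators are independent modulo constants). -/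
def IsCompleteSet (s m : ℝ) (A : Spacetime → Fin 3 → ℝ) (U : Set Spacetime)
    (X : Fin 2 → FirstOrder) : Prop :=
  (∀ j, IsSymmetry s m A U (X j)) ∧
  (∀ ψ : Spacetime → Spinor, ContDiffOn ℝ ∞ ψ U → ∀ x ∈ U,
    (X 0).act A ((X 1).act A ψ) x = (X 1).act A ((X 0).act A ψ) x) ∧
  (∀ c : Fin 2 → ℝ, (∀ x ∈ U, ∑ j, c j • (X j).xi x = 0) → ∀ j, c j = 0)

/-- The joint system `X₁ψ = λ₁ψ`, `X₂ψ = λ₂ψ`, `Hψ = 0` on a set `V`. -/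
def JointSystem (s m : ℝ) (A : Spacetime → Fin 3 → ℝ) (X : Fin 2 → FirstOrder)
    (lam : Fin 2 → ℂ) (V : Set Spacetime) (ψ : Spacetime → Spinor) : Prop :=
  ∀ x ∈ V, (∀ j, (X j).act A ψ x = lam j • ψ x) ∧ dirac s m A ψ x = 0

/-! ### The table of complete sets -/

/-- The vector field of `p_ν`. -/
def pVec (ν : Fin 3) (_ : Spacetime) : Fin 3 → ℝ := Pi.single ν 1

/-- The vector field of `l_{αν} = x_α p_ν - x_ν p_α`, with lowered coordinates `x_α`. -/
def lVec (α ν : Fin 3) (x : Spacetime) : Fin 3 → ℝ :=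
  (etaDiag α * x α) • pVec ν x - (etaDiag ν * x ν) • pVec α x

/-- The rows of the table of pairs of commuting elements of the Poincaré algebra. -/
inductive SetKind where
  /-- `{p₀, p₁}` -/
  | p0p1
  /-- `{p₁, p₂}` -/
  | p1p2
  /-- `{p₀, l₂₁}` -/
  | p0l21
  /-- `{p₁, l₀₂}` -/
  | p1l02
  /-- `{p₁, (p₀ + p₂)/2}` -/
  | p1null
  /-- `{(p₀ + p₂)/2, l₂₁ + l₀₁ + a (p₀ - p₂)}` -/
  | nullRot (a : ℝ)

/-- The two vector fields of each row. -/
def SetKind.killing : SetKind → Fin 2 → Spacetime → Fin 3 → ℝ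
  | .p0p1 => ![pVec 0, pVec 1]
  | .p1p2 => ![pVec 1, pVec 2]
  | .p0l21 => ![pVec 0, lVec 2 1]
  | .p1l02 => ![pVec 1, lVec 0 2]
  | .p1null => ![pVec 1, (1 / 2 : ℝ) • (pVec 0 + pVec 2)]
  | .nullRot a =>
      ![(1 / 2 : ℝ) • (pVec 0 + pVec 2), lVec 2 1 + lVec 0 1 + a • (pVec 0 - pVec 2)]

/-- The spin coefficients `φ_α = -(s/4) ξ^{μ;σ} e_{μσα}` of a vector field in Cartesian
coordinates. -/
def spinCoeff (s : ℝ) (xi : Spacetime → Fin 3 → ℝ) (α : Fin 3) (x : Spacetime) : ℝ :=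
  -(s / 4) * ∑ μ, ∑ σ, etaDiag σ * pd σ (fun y => xi y μ) x * levi μ σ α

/-- The operator `ξ^ν 𝒫_ν + φ + φ_α γ^α` attached to a vector field `ξ` and a function `φ`. -/
def symOp (s : ℝ) (xi : Spacetime → Fin 3 → ℝ) (phi : Spacetime → ℝ) : FirstOrder where
  xi := xi
  chi := fun x => (phi x : ℂ) • (1 : Mat2) + ∑ α, (spinCoeff s xi α x : ℂ) • gam s α

/-! ### Separable coordinate systems -/

/-- Explicit data of a separable coordinate system: the map `x ↦ u(x)` on `source`, its inverse
`u ↦ x(u)` on `target`, the index `sep` of the coordinate the potentials depend on, the indices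
`ign` of the two remaining coordinates, the matrix `frame u` in the separated form of the spinor,
and the matrices of the separated equation. -/
structure SepChart where
  source : Set Spacetime
  target : Set Spacetime
  coord : Spacetime → Spacetime
  inv : Spacetime → Spacetime
  sep : Fin 3
  ign : Fin 2 → Fin 3
  frame : Spacetime → Mat2
  gSep : ℝ → Mat2
  gIgn : Fin 2 → ℝ → Mat2
  gZero : ℝ → Mat2

/-- Cartesian coordinates for `{p₀, p₁}`. -/
def chartP0P1 (s : ℝ) : SepChart where
  source := Set.univ
  target := Set.univ
  coord := fun x => x
  inv := fun u => u
  sep := 2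
  ign := ![0, 1]
  frame := fun _ => 1
  gSep := fun _ => gam s 2
  gIgn := ![fun _ => gam s 0, fun _ => gam s 1]
  gZero := fun _ => 0

/-- Cartesian coordinates for `{p₁, p₂}`. -/
def chartP1P2 (s : ℝ) : SepChart where
  source := Set.univ
  target := Set.univ
  coord := fun x => x
  inv := fun u => u
  sep := 0
  ign := ![1, 2]
  frame := fun _ => 1
  gSep := fun _ => gam s 0
  gIgn := ![fun _ => gam s 1, fun _ => gam s 2]
  gZero := fun _ => 0

/-- Polar coordinates `u = (x⁰, r, φ)` for `{p₀, l₂₁}`, with `-π < φ < π`. -/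
def chartPolar (s : ℝ) : SepChart where
  source := {x | 0 < x 1 ∨ x 2 ≠ 0}
  target := {u | 0 < u 1 ∧ -Real.pi < u 2 ∧ u 2 < Real.pi}
  coord := fun x => ![x 0, Real.sqrt (x 1 ^ 2 + x 2 ^ 2), Complex.arg ⟨x 1, x 2⟩]
  inv := fun u => ![u 0, u 1 * Real.cos (u 2), u 1 * Real.sin (u 2)]
  sep := 1
  ign := ![0, 2]
  frame := fun u => NormedSpace.exp ((-Complex.I * (s : ℂ) * (u 2 : ℂ) / 2) • gam s 0)
  gSep := fun _ => gam s 1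
  gIgn := ![fun _ => gam s 0, fun r => ((1 / r : ℝ) : ℂ) • gam s 2]
  gZero := fun r => ((s / (2 * r) : ℝ) : ℂ) • (gam s 2 * gam s 0)

/-- Hyperbolic coordinates for `{p₁, l₀₂}` on the part `ε x⁰ > |x²|` of `|x⁰| > |x²|`. -/
def chartHypTime (s ε : ℝ) : SepChart where
  source := {x | |x 2| < ε * x 0}
  target := {u | 0 < u 0}
  coord := fun x => ![Real.sqrt (x 0 ^ 2 - x 2 ^ 2), x 1,
    1 / 2 * Real.log ((x 0 + x 2) / (x 0 - x 2))]
  inv := fun u => ![ε * u 0 * Real.cosh (u 2), u 1, ε * u 0 * Real.sinh (u 2)]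
  sep := 0
  ign := ![1, 2]
  frame := fun u => ((1 / Real.sqrt (u 0) : ℝ) : ℂ) •
    NormedSpace.exp ((-Complex.I * (s : ℂ) / 2 * (u 2 : ℂ)) • gam s 1)
  gSep := fun _ => (ε : ℂ) • gam s 0
  gIgn := ![fun _ => gam s 1, fun t => ((ε / t : ℝ) : ℂ) • gam s 2]
  gZero := fun _ => 0

/-- Hyperbolic coordinates for `{p₁, l₀₂}` on the part `ε x² > |x⁰|` of `|x⁰| < |x²|`. -/
def chartHypSpace (s ε : ℝ) : SepChart where
  source := {x | |x 0| < ε * x 2}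
  target := {u | 0 < u 0}
  coord := fun x => ![Real.sqrt (x 2 ^ 2 - x 0 ^ 2), x 1,
    1 / 2 * Real.log ((x 2 + x 0) / (x 2 - x 0))]
  inv := fun u => ![ε * u 0 * Real.sinh (u 2), u 1, ε * u 0 * Real.cosh (u 2)]
  sep := 0
  ign := ![1, 2]
  frame := fun u => ((1 / Real.sqrt (u 0) : ℝ) : ℂ) •
    NormedSpace.exp ((-Complex.I * (s : ℂ) / 2 * (u 2 : ℂ)) • gam s 1)
  gSep := fun _ => (ε : ℂ) • gam s 2
  gIgn := ![fun _ => gam s 1, fun t => ((ε / t : ℝ) : ℂ) • gam s 0]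
  gZero := fun _ => 0

/-- Null coordinates for `{p₁, (p₀ + p₂)/2}`. -/
def chartNull (s : ℝ) : SepChart where
  source := Set.univ
  target := Set.univ
  coord := fun x => ![x 0 - x 2, x 1, x 0 + x 2]
  inv := fun u => ![(u 0 + u 2) / 2, u 1, (u 2 - u 0) / 2]
  sep := 0
  ign := ![1, 2]
  frame := fun _ => 1
  gSep := fun _ => gam s 0 - gam s 2
  gIgn := ![fun _ => gam s 1, fun _ => gam s 0 + gam s 2]
  gZero := fun _ => 0

/-- Coordinates for `{(p₀ + p₂)/2, l₂₁ + l₀₁ + a (p₀ - p₂)}` with `a ≠ 0`. -/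
def chartNullRot (s a : ℝ) : SepChart where
  source := Set.univ
  target := Set.univ
  coord := fun x => ![1 / 2 * (x 0 - x 2) ^ 2 - 2 * a * x 1,
    x 0 + x 2 + 1 / a * (x 0 - x 2) * ((x 0 - x 2) ^ 2 / (6 * a) - x 1),
    1 / (2 * a) * (x 0 - x 2)]
  inv := fun u => ![1 / 2 * u 1 - 1 / (2 * a) * u 0 * u 2 + a / 3 * u 2 ^ 3 + a * u 2,
    a * u 2 ^ 2 - 1 / (2 * a) * u 0,
    1 / 2 * u 1 - 1 / (2 * a) * u 0 * u 2 + a / 3 * u 2 ^ 3 - a * u 2]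
  sep := 0
  ign := ![1, 2]
  frame := fun u =>
    NormedSpace.exp ((-Complex.I * (s : ℂ) / 2 * (u 2 : ℂ)) • (gam s 0 - gam s 2))
  gSep := fun _ => ((-2 * a : ℝ) : ℂ) • gam s 1
  gIgn := ![fun t => gam s 0 + gam s 2 + ((t / (2 * a ^ 2) : ℝ) : ℂ) • (gam s 0 - gam s 2),
    fun _ => ((1 / (2 * a) : ℝ) : ℂ) • (gam s 0 - gam s 2)]
  gZero := fun _ => 0

/-- Coordinates for `{(p₀ + p₂)/2, l₂₁ + l₀₁}`. -/
def chartNullRotZero (s : ℝ) : SepChart where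
  source := {x | x 0 - x 2 ≠ 0}
  target := {u | u 0 ≠ 0}
  coord := fun x => ![x 0 - x 2, x 0 + x 2 - x 1 ^ 2 / (x 0 - x 2), x 1 / (x 0 - x 2)]
  inv := fun u => ![1 / 2 * (u 0 + u 1 + u 0 * u 2 ^ 2), u 0 * u 2,
    1 / 2 * (-u 0 + u 1 + u 0 * u 2 ^ 2)]
  sep := 0
  ign := ![1, 2]
  frame := fun u =>
    NormedSpace.exp ((-Complex.I * (s : ℂ) / 2 * (u 2 : ℂ)) • (gam s 0 - gam s 2))
  gSep := fun _ => gam s 0 - gam s 2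
  gIgn := ![fun _ => gam s 0 + gam s 2, fun t => ((1 / t : ℝ) : ℂ) • gam s 1]
  gZero := fun t => (Complex.I * ((1 / (2 * t) : ℝ) : ℂ)) • (gam s 0 - gam s 2)

/-- The separable coordinate systems belonging to each row of the table. -/
def SetKind.charts (s : ℝ) : SetKind → Set SepChart
  | .p0p1 => {chartP0P1 s}
  | .p1p2 => {chartP1P2 s}
  | .p0l21 => {chartPolar s}
  | .p1l02 => {chartHypTime s 1, chartHypTime s (-1), chartHypSpace s 1, chartHypSpace s (-1)}
  | .p1null => {chartNull s}
  | .nullRot a => {C | (a ≠ 0 ∧ C = chartNullRot s a) ∨ (a = 0 ∧ C = chartNullRotZero s)}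

namespace SepChart

/-- `C` is a smooth coordinate system in which the two vector fields of the row `κ` are the
coordinate fields of the two coordinates other than `u_sep`. -/
def IsAdapted (C : SepChart) (κ : SetKind) : Prop :=
  IsOpen C.source ∧ IsOpen C.target ∧
  (∀ x ∈ C.source, C.coord x ∈ C.target ∧ C.inv (C.coord x) = x) ∧
  (∀ u ∈ C.target, C.inv u ∈ C.source ∧ C.coord (C.inv u) = u) ∧
  ContDiffOn ℝ ∞ C.coord C.source ∧ ContDiffOn ℝ ∞ C.inv C.target ∧
  (∀ ν : Fin 3, ν = C.sep ∨ ν = C.ign 0 ∨ ν = C.ign 1) ∧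
  (∀ x ∈ C.source, ∀ j ν,
    ∑ μ, κ.killing j x μ * pd μ (fun y => C.coord y ν) x = if ν = C.ign j then 1 else 0)

/-- A nonempty open coordinate box `I₀ × I₁ × I₂` (with possibly unbounded intervals)
contained in the range of the coordinates. -/
def IsBox (C : SepChart) (I : Fin 3 → Set ℝ) : Prop :=
  (∀ ν, IsOpen (I ν) ∧ (I ν).OrdConnected ∧ (I ν).Nonempty) ∧
  ∀ u : Spacetime, (∀ ν, u ν ∈ I ν) → u ∈ C.target

/-- The region of Minkowski space described by a coordinate box. -/
def region (C : SepChart) (I : Fin 3 → Set ℝ) : Set Spacetime :=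
  {x | x ∈ C.source ∧ ∀ ν, C.coord x ν ∈ I ν}

/-- The Cartesian components `A_α = ∑_ν (∂_α u_ν) a_ν(u_sep)` of the potential whose components
in the coordinates `u` are the functions `a_ν` of the single variable `u_sep`. -/
def potential (C : SepChart) (a : Fin 3 → ℝ → ℝ) (x : Spacetime) (α : Fin 3) : ℝ :=
  ∑ ν, pd α (fun y => C.coord y ν) x * a ν (C.coord x C.sep)

/-- The two symmetry operators of the row `κ` for the potential `C.potential a`; the function
`φ` of the `j`-th one is the component of the potential along the `j`-th ignorable coordinate. -/
def operators (C : SepChart) (s : ℝ) (κ : SetKind) (a : Fin 3 → ℝ → ℝ) (j : Fin 2) :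
    FirstOrder :=
  symOp s (κ.killing j) (fun x => a (C.ign j) (C.coord x C.sep))

/-- The spinor `exp(-i λ₁ u_{ign 0} - i λ₂ u_{ign 1}) • frame(u) χ(u_sep)`. -/
def separated (C : SepChart) (lam : Fin 2 → ℂ) (χ : ℝ → Spinor) (x : Spacetime) : Spinor :=
  Complex.exp (-Complex.I * ∑ j, lam j * (C.coord x (C.ign j) : ℂ)) •
    (C.frame (C.coord x) *ᵥ χ (C.coord x C.sep))

/-- The separated system of ordinary differential equations for two functions of `u_sep`. -/
def SeparatedODE (C : SepChart) (m : ℝ) (a : Fin 3 → ℝ → ℝ) (lam : Fin 2 → ℂ) (J : Set ℝ)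
    (χ : ℝ → Spinor) : Prop :=
  ∀ t ∈ J,
    C.gSep t *ᵥ (Complex.I • deriv χ t - (a C.sep t : ℂ) • χ t) +
      (∑ j, (lam j - (a (C.ign j) t : ℂ)) • (C.gIgn j t *ᵥ χ t)) +
      C.gZero t *ᵥ χ t - (m : ℂ) • χ t = 0

end SepChart

/-! ### Equivalence -/

/-- An element `x ↦ Λ x + b` of the Poincaré group with `Λ ∈ SO(1,2)`, together with a matrix
`S` implementing it on spinors. -/
structure Poincare (s : ℝ) where
  L : Matrix (Fin 3) (Fin 3) ℝ
  b : Fin 3 → ℝ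
  S : Mat2
  lorentz : Lᵀ * eta * L = eta
  det_one : L.det = 1
  unit_S : IsUnit S
  spin : ∀ ν, S⁻¹ * (∑ α, (L ν α : ℂ) • gam s α) * S = gam s ν

namespace Poincare

variable {s : ℝ}

/-- The action on spacetime. -/
def act (g : Poincare s) (x : Spacetime) : Spacetime := g.L *ᵥ x + g.b

/-- The inverse transformation of spacetime. -/
def invAct (g : Poincare s) (x : Spacetime) : Spacetime := g.L⁻¹ *ᵥ (x - g.b)

/-- The transformed potential. -/
def potential (g : Poincare s) (A : Spacetime → Fin 3 → ℝ) (x : Spacetime) (ν : Fin 3) : ℝ :=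
  ∑ α, g.L⁻¹ α ν * A (g.invAct x) α

/-- The transformed operator `S⁻¹ X S` in the new coordinates. -/
def conj (g : Poincare s) (X : FirstOrder) : FirstOrder where
  xi := fun x => g.L *ᵥ X.xi (g.invAct x)
  chi := fun x => g.S⁻¹ * X.chi (g.invAct x) * g.S

end Poincare

/-- The operators `∑_k c_{jk} X_k + d_j`. -/
def combine (c : Matrix (Fin 2) (Fin 2) ℝ) (d : Fin 2 → ℂ) (X : Fin 2 → FirstOrder) (j : Fin 2) :
    FirstOrder where
  xi := fun x => ∑ k, c j k • (X k).xi x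
  chi := fun x => (∑ k, (c j k : ℂ) • (X k).chi x) + d j • (1 : Mat2)

end DiracSep

end

open scoped ContDiff Matrix

noncomputable section

namespace DiracSep

/-! ### Rules for partial derivatives -/

section PartialDerivatives

variable {E : Type*} [NormedAddCommGroup E] [NormedSpace ℝ E]

/-! A matrix operator of order two in the momenta vanishes on all smooth spinors exactly when its
symmetrized coefficients do, up to a correction by the field strength F, because the antisymmetric
part of P_ν P_μ is multiplication by F (`secondOrder_eq_zero_iff`). Applied to [X, H] - ΨH this
gives algebraic equations at each point (`commutator_iff`). Order two kills the derivative part of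
the multiplier; order one says that ξ is conformally Killing and fixes χ up to a scalar φ; the trace
of order zero gives mρ = 0 for the conformal factor ρ. So X consists of a Killing field, its spin
matrix and a scalar part with ∂_μ φ = F_μν ξ^ν (`IsSymmetry.exists_isSpinSymmetry`). Two such
operators commute exactly when their fields commute, F(ξ₁, ξ₂) = 0 and their matrix parts commute
(`commute_iff`).

Part (I). In coordinates with η_j = ∂_{v_j}, the potential A_ν(τ) du_ν has field strength A_ν' dτ ∧
du_ν, so A_{v_j}(τ) is a scalar part for η_j and F(η₁, η₂) = 0. The frame N solves ∂_{v_j} N = i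
(φ_α γ^α) N and conjugates each γ^α ∂_α u_ν into a matrix G_ν of τ alone (`SepChart.IsFrame`). Every
ψ is a phase times Nχ, as N is invertible; the eigenvalue equations then say that χ depends on τ
only, and Hψ = 0 becomes the ordinary differential system (`SepChart.IsFrame.jointSystem_iff`).

Part (II). On a connected open set a Killing field is x ↦ θ × x + w with the Lorentzian cross
product. For a commuting pair θ₁ and θ₂ are parallel; either both vanish, or the span contains a
nonzero translation along the common axis. The causal character of the normal to the plane of
translations, or of the axis, selects the row of the table, and half-turns supply the Lorentz maps
together with their spinor matrices (`exists_poincare_of_killing`). The scalar parts depend on τ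
only, because their derivative along η_k is F(η_k, η_j) = 0. Take them as components of a separable
potential: the difference of the two field strengths contracts to zero with two independent vectors,
hence vanishes in dimension three, and the Poincaré lemma gives the gauge function f
(`SepChart.IsAdapted.exists_gauge`). Transport, recombination and gauge change preserve the joint
system, which reduces (II) to (I). -/

theorem pd_congr {f g : Spacetime → E} {U : Set Spacetime} (hU : IsOpen U)
    (h : ∀ y ∈ U, f y = g y) {x : Spacetime} (hx : x ∈ U) (ν : Fin 3) : pd ν f x = pd ν g x := by
  unfold pd
  rw [Filter.EventuallyEq.fderiv_eq (Filter.eventually_of_mem (hU.mem_nhds hx) h)]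

theorem pd_eq_of_hasFDerivAt {f : Spacetime → E} {f' : Spacetime →L[ℝ] E} {x : Spacetime}
    (h : HasFDerivAt f f' x) (ν : Fin 3) : pd ν f x = f' (Pi.single ν 1) := by
  rw [pd, h.fderiv]

theorem fderiv_eq_sum_pd (f : Spacetime → E) (x v : Spacetime) :
    fderiv ℝ f x v = ∑ ν, v ν • pd ν f x := by
  conv_lhs => rw [← Finset.univ_sum_single v]
  rw [map_sum]
  refine Finset.sum_congr rfl fun ν _ => ?_
  rw [pd, ← map_smul, ← Pi.single_smul]
  simp

theorem pd_add {f g : Spacetime → E} {x : Spacetime} (hf : DifferentiableAt ℝ f x)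
    (hg : DifferentiableAt ℝ g x) (ν : Fin 3) :
    pd ν (fun y => f y + g y) x = pd ν f x + pd ν g x := by
  rw [pd, fderiv_fun_add hf hg]; rfl

theorem pd_sub {f g : Spacetime → E} {x : Spacetime} (hf : DifferentiableAt ℝ f x)
    (hg : DifferentiableAt ℝ g x) (ν : Fin 3) :
    pd ν (fun y => f y - g y) x = pd ν f x - pd ν g x := by
  rw [pd, fderiv_fun_sub hf hg]; rfl

theorem pd_sum {ι : Type*} {t : Finset ι} {f : ι → Spacetime → E} {x : Spacetime}
    (hf : ∀ i ∈ t, DifferentiableAt ℝ (f i) x) (ν : Fin 3) :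
    pd ν (fun y => ∑ i ∈ t, f i y) x = ∑ i ∈ t, pd ν (f i) x := by
  rw [pd, fderiv_fun_sum hf]; simp [pd]

@[simp] theorem pd_const (c : E) (ν : Fin 3) (x : Spacetime) : pd ν (fun _ => c) x = 0 := by
  simp [pd]

theorem pd_mul {f g : Spacetime → ℝ} {x : Spacetime} (hf : DifferentiableAt ℝ f x)
    (hg : DifferentiableAt ℝ g x) (ν : Fin 3) :
    pd ν (fun y => f y * g y) x = pd ν f x * g x + f x * pd ν g x := by
  rw [pd, fderiv_fun_mul hf hg]; simp [pd]; ring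

theorem pd_mul_complex {f g : Spacetime → ℂ} {x : Spacetime} (hf : DifferentiableAt ℝ f x)
    (hg : DifferentiableAt ℝ g x) (ν : Fin 3) :
    pd ν (fun y => f y * g y) x = pd ν f x * g x + f x * pd ν g x := by
  rw [pd, fderiv_fun_mul hf hg]; simp [pd]; ring

theorem pd_ofReal {f : Spacetime → ℝ} {x : Spacetime} (hf : DifferentiableAt ℝ f x) (ν : Fin 3) :
    pd ν (fun y => (f y : ℂ)) x = ((pd ν f x : ℝ) : ℂ) := by
  have h := (Complex.ofRealCLM.hasFDerivAt (x := f x)).comp x hf.hasFDerivAt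
  exact (pd_eq_of_hasFDerivAt (f := fun y => (f y : ℂ)) h ν).trans rfl

theorem pd_smul {V : Type*} [NormedAddCommGroup V] [NormedSpace ℂ V] [NormedSpace ℝ V]
    [IsScalarTower ℝ ℂ V] {f : Spacetime → ℂ} {g : Spacetime → V}
    {x : Spacetime} (hf : DifferentiableAt ℝ f x)
    (hg : DifferentiableAt ℝ g x) (ν : Fin 3) :
    pd ν (fun y => f y • g y) x = pd ν f x • g x + f x • pd ν g x := by
  rw [pd, fderiv_fun_smul hf hg]; simp [pd]; rw [add_comm]

theorem pd_const_smul {V : Type*} [NormedAddCommGroup V] [NormedSpace ℂ V] [NormedSpace ℝ V]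
    [IsScalarTower ℝ ℂ V] (c : ℂ) {g : Spacetime → V}
    {x : Spacetime} (hg : DifferentiableAt ℝ g x) (ν : Fin 3) :
    pd ν (fun y => c • g y) x = c • pd ν g x := by
  rw [pd_smul (differentiableAt_const c) hg]; simp

theorem pd_const_mul (c : ℝ) {g : Spacetime → ℝ}
    {x : Spacetime} (hg : DifferentiableAt ℝ g x) (ν : Fin 3) :
    pd ν (fun y => c * g y) x = c * pd ν g x := by
  rw [pd_mul (differentiableAt_const c) hg]; simp

theorem pd_apply {ι : Type*} [Fintype ι] {F : ι → Type*} [∀ i, NormedAddCommGroup (F i)]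
    [∀ i, NormedSpace ℝ (F i)] {f : Spacetime → ∀ i, F i} {x : Spacetime}
    (hf : DifferentiableAt ℝ f x) (ν : Fin 3) (i : ι) :
    pd ν f x i = pd ν (fun y => f y i) x := by
  rw [pd, pd, fderiv_pi (fun j => differentiableAt_pi.1 hf j)]; rfl

theorem pd_coord (μ ν : Fin 3) (x : Spacetime) :
    pd ν (fun y : Spacetime => y μ) x = if ν = μ then 1 else 0 := by
  rw [pd_eq_of_hasFDerivAt (hasFDerivAt_apply μ x) ν]
  simp [Pi.single_apply, eq_comm]

theorem pd_comm {f : Spacetime → E} {x : Spacetime} (hf : ContDiffAt ℝ 2 f x) (μ ν : Fin 3) :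
    pd μ (pd ν f) x = pd ν (pd μ f) x := by
  have hs : IsSymmSndFDerivAt ℝ f x := hf.isSymmSndFDerivAt (by simp)
  have hd : DifferentiableAt ℝ (fderiv ℝ f) x :=
    (hf.fderiv_right (m := 1) (by norm_num)).differentiableAt (by norm_num)
  have h : ∀ v : Spacetime, ∀ κ, pd κ (fun y => fderiv ℝ f y v) x =
      fderiv ℝ (fderiv ℝ f) x (Pi.single κ 1) v := by
    intro v κ
    rw [pd, fderiv_clm_apply hd (differentiableAt_const v)]
    simp
  have h1 := h (Pi.single ν 1) μ
  have h2 := h (Pi.single μ 1) ν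
  change pd μ (fun y => fderiv ℝ f y (Pi.single ν 1)) x = pd ν (fun y => fderiv ℝ f y (Pi.single μ 1)) x
  rw [h1, h2]
  exact hs _ _

theorem contDiffAt_pd {f : Spacetime → E} {x : Spacetime} {n m : WithTop ℕ∞}
    (hf : ContDiffAt ℝ n f x) (h : m + 1 ≤ n) (ν : Fin 3) : ContDiffAt ℝ m (pd ν f) x :=
  (hf.fderiv_right h).clm_apply contDiffAt_const

theorem contDiffOn_pd {f : Spacetime → E} {U : Set Spacetime} (hU : IsOpen U)
    (hf : ContDiffOn ℝ ∞ f U) (ν : Fin 3) : ContDiffOn ℝ ∞ (pd ν f) U := fun x hx =>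
  (contDiffAt_pd (m := ∞) (hf.contDiffAt (hU.mem_nhds hx)) (by simp) ν).contDiffWithinAt

end PartialDerivatives

/-! ### Matrix-valued functions -/

/-- Entrywise partial derivative of a matrix-valued function. -/
def mpd (ν : Fin 3) (M : Spacetime → Mat2) (x : Spacetime) : Mat2 :=
  Matrix.of fun i j => pd ν (fun y => M y i j) x

/-- Entrywise differentiability of a matrix-valued function. -/
def MDiff (M : Spacetime → Mat2) (x : Spacetime) : Prop :=
  ∀ i j, DifferentiableAt ℝ (fun y => M y i j) x

@[simp] theorem mpd_apply (ν : Fin 3) (M : Spacetime → Mat2) (x : Spacetime) (i j : Fin 2) :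
    mpd ν M x i j = pd ν (fun y => M y i j) x := rfl

@[simp] theorem mpd_const (ν : Fin 3) (M : Mat2) (x : Spacetime) : mpd ν (fun _ => M) x = 0 := by
  ext i j; simp

theorem mdiff_const (M : Mat2) (x : Spacetime) : MDiff (fun _ => M) x :=
  fun _ _ => differentiableAt_const _

theorem mpd_congr {M N : Spacetime → Mat2} {U : Set Spacetime} (hU : IsOpen U)
    (h : ∀ y ∈ U, M y = N y) {x : Spacetime} (hx : x ∈ U) (ν : Fin 3) : mpd ν M x = mpd ν N x := by
  ext i j
  exact pd_congr hU (fun y hy => by rw [h y hy]) hx ν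

theorem MDiff.smul_const {f : Spacetime → ℂ} {x : Spacetime} (hf : DifferentiableAt ℝ f x)
    (M : Mat2) : MDiff (fun y => f y • M) x := fun i j => by
  simpa using hf.fun_mul (differentiableAt_const (M i j))

theorem mpd_smul_const {f : Spacetime → ℂ} {x : Spacetime} (hf : DifferentiableAt ℝ f x)
    (M : Mat2) (ν : Fin 3) : mpd ν (fun y => f y • M) x = pd ν f x • M := by
  ext i j
  simp only [mpd_apply, Matrix.smul_apply, smul_eq_mul]
  rw [pd_mul_complex hf (differentiableAt_const _)]
  simp

theorem MDiff.add {M N : Spacetime → Mat2} {x : Spacetime} (hM : MDiff M x) (hN : MDiff N x) :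
    MDiff (fun y => M y + N y) x := fun i j => (hM i j).add (hN i j)

theorem mpd_add {M N : Spacetime → Mat2} {x : Spacetime} (hM : MDiff M x) (hN : MDiff N x)
    (ν : Fin 3) : mpd ν (fun y => M y + N y) x = mpd ν M x + mpd ν N x := by
  ext i j; exact pd_add (hM i j) (hN i j) ν

theorem differentiableAt_mulVec {M : Spacetime → Mat2} {ψ : Spacetime → Spinor} {x : Spacetime}
    (hM : MDiff M x) (hψ : DifferentiableAt ℝ ψ x) :
    DifferentiableAt ℝ (fun y => M y *ᵥ ψ y) x := by
  refine differentiableAt_pi.2 fun i => ?_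
  simp only [Matrix.mulVec, dotProduct]
  exact DifferentiableAt.fun_sum fun j _ => (hM i j).fun_mul (differentiableAt_pi.1 hψ j)

theorem pd_mulVec {M : Spacetime → Mat2} {ψ : Spacetime → Spinor} {x : Spacetime}
    (hM : MDiff M x) (hψ : DifferentiableAt ℝ ψ x) (ν : Fin 3) :
    pd ν (fun y => M y *ᵥ ψ y) x = mpd ν M x *ᵥ ψ x + M x *ᵥ pd ν ψ x := by
  ext i
  rw [pd_apply (differentiableAt_mulVec hM hψ)]
  have h := fun j => differentiableAt_pi.1 hψ j
  simp only [Matrix.mulVec, dotProduct, Pi.add_apply]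
  rw [pd_sum (fun j _ => (hM i j).fun_mul (h j)), ← Finset.sum_add_distrib]
  refine Finset.sum_congr rfl fun j _ => ?_
  rw [pd_mul_complex (hM i j) (h j), pd_apply hψ]
  rfl

theorem contDiffOn_mulVec {M : Spacetime → Mat2} {ψ : Spacetime → Spinor} {U : Set Spacetime}
    {n : WithTop ℕ∞} (hM : ∀ i j, ContDiffOn ℝ n (fun y => M y i j) U) (hψ : ContDiffOn ℝ n ψ U) :
    ContDiffOn ℝ n (fun y => M y *ᵥ ψ y) U := by
  refine contDiffOn_pi.2 fun i => ?_
  simp only [Matrix.mulVec, dotProduct]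
  exact ContDiffOn.sum fun j _ => (hM i j).mul (contDiffOn_pi.1 hψ j)

/-! ### First-order matrix operators -/

/-- The electromagnetic field strength `F_{νμ} = ∂_ν A_μ - ∂_μ A_ν`. -/
def fieldStrength (A : Spacetime → Fin 3 → ℝ) (ν μ : Fin 3) (x : Spacetime) : ℝ :=
  pd ν (fun y => A y μ) x - pd μ (fun y => A y ν) x

/-- The first-order matrix operator `M^ν 𝒫_ν + N`. -/
def matOp (A : Spacetime → Fin 3 → ℝ) (M : Fin 3 → Spacetime → Mat2) (N : Spacetime → Mat2)
    (ψ : Spacetime → Spinor) (x : Spacetime) : Spinor :=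
  (∑ ν, M ν x *ᵥ mom A ν ψ x) + N x *ᵥ ψ x

theorem dirac_eq_matOp (s m : ℝ) (A : Spacetime → Fin 3 → ℝ) :
    dirac s m A = matOp A (fun ν _ => gam s ν) (fun _ => -(m : ℂ) • (1 : Mat2)) := by
  funext ψ x
  rw [dirac, matOp, Matrix.smul_mulVec, Matrix.one_mulVec, neg_smul, sub_eq_add_neg]

theorem act_eq_matOp (A : Spacetime → Fin 3 → ℝ) (X : FirstOrder) :
    X.act A = matOp A (fun ν y => (X.xi y ν : ℂ) • (1 : Mat2)) X.chi := by
  funext ψ x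
  simp [FirstOrder.act, matOp, Matrix.smul_mulVec]

/-! ### Commutators of the momenta and coefficients of second-order operators. -/

section Momenta

variable {A : Spacetime → Fin 3 → ℝ} {x : Spacetime}

theorem mom_congr {f g : Spacetime → Spinor} {U : Set Spacetime} (hU : IsOpen U)
    (h : ∀ y ∈ U, f y = g y) (hx : x ∈ U) (ν : Fin 3) : mom A ν f x = mom A ν g x := by
  rw [mom, mom, pd_congr hU h hx, h x hx]

theorem mom_add {f g : Spacetime → Spinor} (hf : DifferentiableAt ℝ f x)
    (hg : DifferentiableAt ℝ g x) (ν : Fin 3) :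
    mom A ν (fun y => f y + g y) x = mom A ν f x + mom A ν g x := by
  rw [mom, pd_add hf hg, mom, mom]; module

theorem mom_sum {ι : Type*} {t : Finset ι} {f : ι → Spacetime → Spinor}
    (hf : ∀ i ∈ t, DifferentiableAt ℝ (f i) x) (ν : Fin 3) :
    mom A ν (fun y => ∑ i ∈ t, f i y) x = ∑ i ∈ t, mom A ν (f i) x := by
  simp only [mom]
  rw [pd_sum hf, Finset.smul_sum, Finset.smul_sum, Finset.sum_sub_distrib]

theorem mom_smul {f : Spacetime → ℂ} {ψ : Spacetime → Spinor} (hf : DifferentiableAt ℝ f x)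
    (hψ : DifferentiableAt ℝ ψ x) (ν : Fin 3) :
    mom A ν (fun y => f y • ψ y) x = (Complex.I * pd ν f x) • ψ x + f x • mom A ν ψ x := by
  rw [mom, mom, pd_smul hf hψ]; module

theorem mom_mulVec {M : Spacetime → Mat2} {ψ : Spacetime → Spinor} (hM : MDiff M x)
    (hψ : DifferentiableAt ℝ ψ x) (ν : Fin 3) :
    mom A ν (fun y => M y *ᵥ ψ y) x =
      Complex.I • (mpd ν M x *ᵥ ψ x) + M x *ᵥ mom A ν ψ x := by
  rw [mom, mom, pd_mulVec hM hψ, Matrix.mulVec_sub, Matrix.mulVec_smul, Matrix.mulVec_smul]; module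

theorem contDiffAt_mom {n m : WithTop ℕ∞} (h : m + 1 ≤ n) (hA : ContDiffAt ℝ n A x)
    {ψ : Spacetime → Spinor} (hψ : ContDiffAt ℝ n ψ x) (ν : Fin 3) :
    ContDiffAt ℝ m (mom A ν ψ) x := by
  have hm : m ≤ n := le_trans le_self_add h
  have h1 : ContDiffAt ℝ m (fun y => (A y ν : ℂ)) x :=
    Complex.ofRealCLM.contDiff.contDiffAt.comp x ((contDiffAt_pi.1 (hA.of_le hm)) ν)
  exact ((contDiffAt_pd hψ h ν).const_smul Complex.I).sub (h1.smul (hψ.of_le hm))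

/-- The generalized momenta commute up to the field strength. -/
theorem mom_comm (hA : ContDiffAt ℝ 2 A x) {ψ : Spacetime → Spinor} (hψ : ContDiffAt ℝ 2 ψ x)
    (ν μ : Fin 3) :
    mom A ν (mom A μ ψ) x =
      mom A μ (mom A ν ψ) x - (Complex.I * fieldStrength A ν μ x) • ψ x := by
  have hAd : ∀ κ, DifferentiableAt ℝ (fun y => A y κ) x := fun κ =>
    (contDiffAt_pi.1 hA κ).differentiableAt (by norm_num)
  have hAc : ∀ κ, DifferentiableAt ℝ (fun y => (A y κ : ℂ)) x := fun κ =>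
    Complex.ofRealCLM.differentiableAt.comp x (hAd κ)
  have hψd : DifferentiableAt ℝ ψ x := hψ.differentiableAt (by norm_num)
  have hp : ∀ κ, DifferentiableAt ℝ (pd κ ψ) x := fun κ =>
    (contDiffAt_pd (m := 1) hψ (by norm_num) κ).differentiableAt (by norm_num)
  -- Once mixed partials commute, the term with ∂_α A_β is the only one not symmetric in α and β, so
  -- the commutator sees only the curl of A.
  have key : ∀ α β, mom A α (mom A β ψ) x = -pd α (pd β ψ) x
      - (Complex.I * (pd α (fun y => A y β) x : ℝ)) • ψ x
      - (Complex.I * A x β) • pd α ψ x - (Complex.I * A x α) • pd β ψ x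
      + ((A x α : ℂ) * A x β) • ψ x := by
    intro α β
    have : pd α (mom A β ψ) x = Complex.I • pd α (pd β ψ) x -
        ((pd α (fun y => A y β) x : ℂ) • ψ x + (A x β : ℂ) • pd α ψ x) := by
      have e : mom A β ψ = fun y => Complex.I • pd β ψ y - (A y β : ℂ) • ψ y := rfl
      rw [e, pd_sub ((hp β).fun_const_smul Complex.I) ((hAc β).fun_smul hψd), pd_const_smul _ (hp β),
        pd_smul (hAc β) hψd]
    rw [mom, this, mom, pd_ofReal (hAd β)]
    have hI : Complex.I * Complex.I = -1 := Complex.I_mul_I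
    simp only [smul_sub, smul_add, smul_smul, hI]
    module
  rw [key, key, pd_comm hψ ν μ, fieldStrength]
  push_cast
  module

theorem mom_matOp (hA : ContDiffAt ℝ 2 A x) {ψ : Spacetime → Spinor} (hψ : ContDiffAt ℝ 2 ψ x)
    {M : Fin 3 → Spacetime → Mat2} {N : Spacetime → Mat2} (hM : ∀ ν, MDiff (M ν) x)
    (hN : MDiff N x) (μ : Fin 3) :
    mom A μ (matOp A M N ψ) x =
      (∑ ν, (Complex.I • (mpd μ (M ν) x *ᵥ mom A ν ψ x) + M ν x *ᵥ mom A μ (mom A ν ψ) x)) +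
        (Complex.I • (mpd μ N x *ᵥ ψ x) + N x *ᵥ mom A μ ψ x) := by
  have hψd : DifferentiableAt ℝ ψ x := hψ.differentiableAt (by norm_num)
  have hm : ∀ ν, DifferentiableAt ℝ (mom A ν ψ) x := fun ν =>
    (contDiffAt_mom (m := 1) (by norm_num) hA hψ ν).differentiableAt (by norm_num)
  have e : matOp A M N ψ = fun y => (∑ ν, M ν y *ᵥ mom A ν ψ y) + N y *ᵥ ψ y := rfl
  rw [e, mom_add (DifferentiableAt.fun_sum fun ν _ => differentiableAt_mulVec (hM ν) (hm ν))
    (differentiableAt_mulVec hN hψd), mom_sum fun ν _ => differentiableAt_mulVec (hM ν) (hm ν),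
    mom_mulVec hN hψd]
  congr 1
  exact Finset.sum_congr rfl fun ν _ => mom_mulVec (hM ν) (hm ν) μ

/-- A second-order matrix operator with frozen coefficients, evaluated at a point. -/
def secondOrder (A : Spacetime → Fin 3 → ℝ) (K : Fin 3 → Fin 3 → Mat2) (L : Fin 3 → Mat2)
    (N : Mat2) (ψ : Spacetime → Spinor) (x : Spacetime) : Spinor :=
  (∑ ν, ∑ μ, K ν μ *ᵥ mom A ν (mom A μ ψ) x) + (∑ μ, L μ *ᵥ mom A μ ψ x) + N *ᵥ ψ x

/-- This is the Leibniz rule: a momentum passing a coefficient M' leaves i ∂M' behind. With the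
coefficients frozen at the point, identities between operators become identities between matrices.
-/
theorem matOp_matOp (hA : ContDiffAt ℝ 2 A x) {ψ : Spacetime → Spinor} (hψ : ContDiffAt ℝ 2 ψ x)
    (M : Fin 3 → Spacetime → Mat2) (N : Spacetime → Mat2)
    {M' : Fin 3 → Spacetime → Mat2} {N' : Spacetime → Mat2} (hM : ∀ ν, MDiff (M' ν) x)
    (hN : MDiff N' x) :
    matOp A M N (matOp A M' N' ψ) x =
      secondOrder A (fun ν μ => M ν x * M' μ x)
        (fun μ => (∑ ν, Complex.I • (M ν x * mpd ν (M' μ) x)) + M μ x * N' x + N x * M' μ x)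
        ((∑ ν, Complex.I • (M ν x * mpd ν N' x)) + N x * N' x) ψ x := by
  rw [matOp]
  simp only [mom_matOp hA hψ hM hN]
  rw [matOp, secondOrder]
  simp only [Fin.sum_univ_three, Matrix.mulVec_add, Matrix.add_mulVec, Matrix.mulVec_smul,
    Matrix.smul_mulVec, Matrix.mulVec_mulVec]
  module

theorem secondOrder_sub (K K' : Fin 3 → Fin 3 → Mat2) (L L' : Fin 3 → Mat2)
    (N N' : Mat2) (ψ : Spacetime → Spinor) :
    secondOrder A K L N ψ x - secondOrder A K' L' N' ψ x =
      secondOrder A (K - K') (L - L') (N - N') ψ x := by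
  simp only [secondOrder, Fin.sum_univ_three, Pi.sub_apply, Matrix.sub_mulVec]
  module

/-- Antisymmetric coefficients see only the commutators of the momenta, which equal -iF; the factor
1/2 compensates for counting each pair of indices twice. -/
theorem secondOrder_of_antisymm (hA : ContDiffAt ℝ 2 A x) {K : Fin 3 → Fin 3 → Mat2}
    (hK : ∀ ν μ, K ν μ + K μ ν = 0) (L : Fin 3 → Mat2) (N : Mat2) {ψ : Spacetime → Spinor}
    (hψ : ContDiffAt ℝ 2 ψ x) :
    secondOrder A K L N ψ x = (∑ μ, L μ *ᵥ mom A μ ψ x) +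
      (N - ∑ ν, ∑ μ, (Complex.I / 2 * fieldStrength A ν μ x) • K ν μ) *ᵥ ψ x := by
  have hd : ∀ ν, K ν ν = 0 := fun ν => by
    have := hK ν ν
    rw [← two_smul ℂ] at this
    simpa using this
  have h10 : K 1 0 = -K 0 1 := by rw [eq_neg_iff_add_eq_zero]; exact hK 1 0
  have h20 : K 2 0 = -K 0 2 := by rw [eq_neg_iff_add_eq_zero]; exact hK 2 0
  have h21 : K 2 1 = -K 1 2 := by rw [eq_neg_iff_add_eq_zero]; exact hK 2 1
  have f : ∀ ν μ, fieldStrength A μ ν x = -fieldStrength A ν μ x := fun ν μ => by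
    simp [fieldStrength]
  simp only [secondOrder, Fin.sum_univ_three, hd, h10, h20, h21, mom_comm hA hψ 0 1,
    mom_comm hA hψ 0 2, mom_comm hA hψ 1 2, f 0 1, f 0 2, f 1 2, Matrix.zero_mulVec,
    Matrix.neg_mulVec, Matrix.mulVec_sub, Matrix.sub_mulVec, Matrix.add_mulVec, Matrix.mulVec_smul,
    Matrix.smul_mulVec, smul_zero, smul_neg]
  push_cast
  module

theorem two_le_infty : (2 : WithTop ℕ∞) ≤ ∞ :=
  WithTop.coe_le_coe.2 (OrderTop.le_top (2 : ℕ∞))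

/-- Where p vanishes together with its gradient, the potential and all lower-order terms drop out,
and i · i = -1 is the only trace of the momenta. -/
theorem mom_mom_smul_const (hA : ContDiffAt ℝ 2 A x) {p : Spacetime → ℂ} (hp : ContDiff ℝ ∞ p)
    (w : Spinor) (ν μ : Fin 3) (h0 : p x = 0) (h1 : ∀ κ, pd κ p x = 0) :
    mom A ν (mom A μ fun y => p y • w) x = -pd ν (pd μ p) x • w := by
  have hpd : Differentiable ℝ p := hp.differentiable (by simp)
  have e : (mom A μ fun y => p y • w) =
      fun y => (Complex.I * pd μ p y) • w + p y • mom A μ (fun _ => w) y := by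
    funext y
    exact mom_smul hpd.differentiableAt (differentiableAt_const w) μ
  have hpp : DifferentiableAt ℝ (pd μ p) x :=
    (contDiffAt_pd (m := 1) hp.contDiffAt (by rw [one_add_one_eq_two]; exact two_le_infty) μ).differentiableAt (by simp)
  have hmw : DifferentiableAt ℝ (mom A μ fun _ => w) x :=
    (contDiffAt_mom (m := 1) (by norm_num) hA contDiffAt_const μ).differentiableAt (by simp)
  have hIp : DifferentiableAt ℝ (fun y => Complex.I * pd μ p y) x := hpp.const_mul _
  rw [e, mom_add (hIp.fun_smul (differentiableAt_const w)) (hpd.differentiableAt.fun_smul hmw),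
    mom_smul hIp (differentiableAt_const w), mom_smul hpd.differentiableAt hmw,
    pd_mul_complex (differentiableAt_const _) hpp]
  simp [h0, h1, ← mul_assoc, Complex.I_mul_I]

theorem matrix_eq_zero_of_mulVec {M : Mat2} (h : ∀ w : Spinor, M *ᵥ w = 0) : M = 0 := by
  ext i j
  have := congrFun (h (Pi.single j 1)) i
  simpa using this

/-- A second-order operator vanishes on all smooth spinor fields at a point if and only if its
symmetrized coefficients do. -/
theorem secondOrder_eq_zero_iff {U : Set Spacetime} (hA : ContDiffAt ℝ 2 A x)
    (hU : IsOpen U) (hx : x ∈ U) (K : Fin 3 → Fin 3 → Mat2) (L : Fin 3 → Mat2) (N : Mat2) :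
    (∀ ψ : Spacetime → Spinor, ContDiffOn ℝ ∞ ψ U → secondOrder A K L N ψ x = 0) ↔
      (∀ ν μ, K ν μ + K μ ν = 0) ∧ (∀ μ, L μ = 0) ∧
        N = ∑ ν, ∑ μ, (Complex.I / 2 * fieldStrength A ν μ x) • K ν μ := by
  constructor
  · intro h
    have lin : ∀ ν, ContDiff ℝ ∞ fun y : Spacetime => ((y ν - x ν : ℝ) : ℂ) := fun ν =>
      Complex.ofRealCLM.contDiff.comp ((contDiff_apply ℝ ℝ ν).sub contDiff_const)
    have dlin : ∀ ν κ, pd κ (fun y : Spacetime => ((y ν - x ν : ℝ) : ℂ)) =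
        fun _ => if κ = ν then 1 else 0 := by
      intro ν κ
      funext y
      rw [pd_ofReal (f := fun y => y ν - x ν) (by fun_prop), pd_sub (f := fun y => y ν) (differentiableAt_apply ν y)
        (differentiableAt_const _), pd_coord]
      split_ifs <;> simp
    have hK : ∀ ν μ, K ν μ + K μ ν = 0 := by
      intro a b
      refine matrix_eq_zero_of_mulVec fun w => ?_
      -- This quadratic test function vanishes to first order at x, and its Hessian picks out
      -- exactly the pair of indices a, b, so the operator returns -(K^{ab} + K^{ba}) w.
      set p : Spacetime → ℂ := fun y => ((y a - x a : ℝ) : ℂ) * ((y b - x b : ℝ) : ℂ) with hp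
      have hps : ContDiff ℝ ∞ p := (lin a).mul (lin b)
      have la := (lin a).differentiable (by simp)
      have lb := (lin b).differentiable (by simp)
      have dp : ∀ κ, pd κ p = fun y => (if κ = a then 1 else 0) * ((y b - x b : ℝ) : ℂ)
          + ((y a - x a : ℝ) : ℂ) * (if κ = b then 1 else 0) := by
        intro κ
        funext y
        rw [hp, pd_mul_complex la.differentiableAt lb.differentiableAt, dlin, dlin]
      have h0 : p x = 0 := by simp [hp]
      have h1 : ∀ κ, pd κ p x = 0 := fun κ => by simp [dp]
      have h2 : ∀ ν μ, pd ν (pd μ p) x = (if μ = a then 1 else 0) * (if ν = b then 1 else 0)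
          + (if ν = a then 1 else 0) * (if μ = b then 1 else 0) := by
        intro ν μ
        rw [dp, pd_add ((lb.const_mul _).differentiableAt) ((la.mul_const _).differentiableAt),
          pd_mul_complex (differentiableAt_const _) lb.differentiableAt,
          pd_mul_complex la.differentiableAt (differentiableAt_const _), dlin, dlin]
        simp
      have h3 : ∀ μ, mom A μ (fun y => p y • w) x = 0 := fun μ => by
        rw [mom_smul (hps.differentiable (by simp)).differentiableAt (differentiableAt_const w)]
        simp [h0, h1]
      have := h (fun y => p y • w) (hps.smul contDiff_const).contDiffOn
      simp only [secondOrder, mom_mom_smul_const hA hps w _ _ h0 h1, h2, h3, h0] at this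
      simp only [Matrix.mulVec_zero, Finset.sum_const_zero, add_zero, zero_smul] at this
      have e : ∀ ν μ, K ν μ *ᵥ (-((if μ = a then (1 : ℂ) else 0) * (if ν = b then 1 else 0)
          + (if ν = a then 1 else 0) * (if μ = b then 1 else 0)) • w) =
          (if μ = a then (if ν = b then -(K ν μ *ᵥ w) else 0) else 0) +
          (if μ = b then (if ν = a then -(K ν μ *ᵥ w) else 0) else 0) := by
        intro ν μ
        rw [Matrix.mulVec_smul, neg_smul, add_smul, neg_add]
        split_ifs <;> simp
      simp only [e, Finset.sum_add_distrib, Finset.sum_ite_eq', Finset.mem_univ, if_true] at this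
      rw [Matrix.add_mulVec, ← neg_eq_zero, neg_add_rev]
      exact this
    -- With the symmetric part gone the operator has order one, so linear and constant test fields
    -- read off L and N.
    have hred := fun (ψ : Spacetime → Spinor) (hψ : ContDiffOn ℝ ∞ ψ U) =>
      (secondOrder_of_antisymm hA hK L N
        ((hψ.contDiffAt (hU.mem_nhds hx)).of_le two_le_infty)).symm.trans (h ψ hψ)
    have hL : ∀ μ, L μ = 0 := by
      intro a
      refine matrix_eq_zero_of_mulVec fun w => ?_
      have h3 : ∀ μ, mom A μ (fun y => ((y a - x a : ℝ) : ℂ) • w) x =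
          if μ = a then Complex.I • w else 0 := fun μ => by
        rw [mom_smul ((lin a).differentiable (by simp)).differentiableAt
          (differentiableAt_const w), dlin]
        split_ifs <;> simp
      have := hred (fun y => ((y a - x a : ℝ) : ℂ) • w) ((lin a).smul contDiff_const).contDiffOn
      simp only [h3] at this
      have e : ∀ μ, L μ *ᵥ (if μ = a then Complex.I • w else 0) =
          if μ = a then Complex.I • (L μ *ᵥ w) else 0 := fun μ => by
        split_ifs <;> simp [Matrix.mulVec_smul]
      simp only [e, Finset.sum_ite_eq', Finset.mem_univ, if_true, sub_self, Complex.ofReal_zero,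
        zero_smul, Matrix.mulVec_zero, add_zero, smul_eq_zero, Complex.I_ne_zero,
        false_or] at this
      exact this
    refine ⟨hK, hL, ?_⟩
    rw [← sub_eq_zero]
    refine matrix_eq_zero_of_mulVec fun w => ?_
    have := hred (fun _ => w) contDiff_const.contDiffOn
    simpa [hL] using this
  · rintro ⟨hK, hL, hN⟩ ψ hψ
    rw [secondOrder_of_antisymm hA hK L N ((hψ.contDiffAt (hU.mem_nhds hx)).of_le two_le_infty), hN]
    simp [hL]

end Momenta

/-! ### Algebra of the Dirac matrices -/

/-- The spin coefficients of a gradient `D μ ν = ∂_μ ξ^ν`. -/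
def spinGrad (s : ℝ) (D : Fin 3 → Fin 3 → ℝ) (α : Fin 3) : ℝ :=
  -(s / 4) * ∑ μ, ∑ σ, etaDiag σ * D σ μ * levi μ σ α

theorem spinCoeff_eq_spinGrad (s : ℝ) (xi : Spacetime → Fin 3 → ℝ) (α : Fin 3) (x : Spacetime) :
    spinCoeff s xi α x = spinGrad s (fun σ μ => pd σ (fun y => xi y μ) x) α := rfl

theorem spinGrad_zero (s : ℝ) (D : Fin 3 → Fin 3 → ℝ) :
    spinGrad s D 0 = -(s / 4) * (D 1 2 - D 2 1) := by
  have h : ∑ μ, ∑ σ, etaDiag σ * D σ μ * levi μ σ 0 = (D 1 2 - D 2 1) := by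
    simp [levi, etaDiag, Fin.sum_univ_three]; ring
  rw [spinGrad, h]

theorem spinGrad_one (s : ℝ) (D : Fin 3 → Fin 3 → ℝ) :
    spinGrad s D 1 = -(s / 4) * (D 2 0 + D 0 2) := by
  have h : ∑ μ, ∑ σ, etaDiag σ * D σ μ * levi μ σ 1 = (D 2 0 + D 0 2) := by
    simp [levi, etaDiag, Fin.sum_univ_three]; ring
  rw [spinGrad, h]

theorem spinGrad_two (s : ℝ) (D : Fin 3 → Fin 3 → ℝ) :
    spinGrad s D 2 = s / 4 * (D 0 1 + D 1 0) := by
  have h : ∑ μ, ∑ σ, etaDiag σ * D σ μ * levi μ σ 2 = -(D 0 1 + D 1 0) := by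
    simp [levi, etaDiag, Fin.sum_univ_three]; ring
  rw [spinGrad, h]; ring

/-- Commutation with χ can only rotate the γ^ν infinitesimally, so the symmetric part of D must be a
pure scaling, and this scaling is what Ψ absorbs. Concretely, the three matrix equations have twelve
complex entries, linear in the unknowns, and their real and imaginary parts determine everything. -/
theorem symbol_algebra {s : ℝ} (hs : s = 1 ∨ s = -1) {χ Ψ : Mat2} {D : Fin 3 → Fin 3 → ℝ}
    (h : ∀ ν, χ * gam s ν - gam s ν * χ - Complex.I • ∑ μ, (D μ ν : ℂ) • gam s μ = Ψ * gam s ν) :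
    ∃ ρ : ℝ, Ψ = (-Complex.I * ρ) • (1 : Mat2) ∧
      (∀ μ ν, etaDiag μ * D μ ν + etaDiag ν * D ν μ = if μ = ν then 2 * ρ * etaDiag μ else 0) ∧
      χ = ((χ 0 0 + χ 1 1) / 2) • (1 : Mat2) + ∑ α, (spinGrad s D α : ℂ) • gam s α := by
  have e : ∀ ν i j, (χ * gam s ν - gam s ν * χ -
      Complex.I • ∑ μ, (D μ ν : ℂ) • gam s μ) i j = (Ψ * gam s ν) i j := fun ν i j => by rw [h ν]
  obtain ⟨e0, e1, e2⟩ := And.intro (e 0) (And.intro (e 1) (e 2))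
  have a1 := e0 0 0; have a2 := e0 0 1; have a3 := e0 1 0; have a4 := e0 1 1
  have b1 := e1 0 0; have b2 := e1 0 1; have b3 := e1 1 0; have b4 := e1 1 1
  have c1 := e2 0 0; have c2 := e2 0 1; have c3 := e2 1 0; have c4 := e2 1 1
  clear e e0 e1 e2 h
  rcases hs with rfl | rfl
  all_goals
    simp only [Matrix.sub_apply, Matrix.smul_apply, Matrix.mul_apply,
      Fin.sum_univ_two, Fin.sum_univ_three] at a1 a2 a3 a4 b1 b2 b3 b4 c1 c2 c3 c4
    simp [gam, Complex.ext_iff] at a1 a2 a3 a4 b1 b2 b3 b4 c1 c2 c3 c4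
    -- The case μ = ν = 0 of the conformal Killing equation reads 2 D₀₀ = 2ρ, which forces this
    -- value.
    refine ⟨D 0 0, ?_, ?_, ?_⟩
    · ext i j
      fin_cases i <;> fin_cases j <;> simp [Complex.ext_iff] <;> constructor <;> linarith
    · intro μ ν
      fin_cases μ <;> fin_cases ν <;> simp [etaDiag] <;> linarith
    · ext i j
      simp only [Fin.sum_univ_three, spinGrad_zero, spinGrad_one, spinGrad_two]
      fin_cases i <;> fin_cases j <;> simp [gam, Complex.ext_iff] <;> constructor <;> linarith

/-- The spin coefficients are those for which commutation with φ_α γ^α rotates the Dirac matrices by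
the infinitesimal Lorentz transformation D. The Killing equation leaves three free entries of D, and
the rest is a check of matrix entries. -/
theorem symbol_algebra_of_killing {s : ℝ} (hs : s = 1 ∨ s = -1) {D : Fin 3 → Fin 3 → ℝ}
    (hD : ∀ μ ν, etaDiag μ * D μ ν + etaDiag ν * D ν μ = 0) (φ : ℂ) (ν : Fin 3) :
    (φ • (1 : Mat2) + ∑ α, (spinGrad s D α : ℂ) • gam s α) * gam s ν
      - gam s ν * (φ • (1 : Mat2) + ∑ α, (spinGrad s D α : ℂ) • gam s α)
      - Complex.I • ∑ μ, (D μ ν : ℂ) • gam s μ = 0 := by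
  have h00 : D 0 0 = 0 := by have := hD 0 0; simp [etaDiag] at this; linarith
  have h11 : D 1 1 = 0 := by have := hD 1 1; simp [etaDiag] at this; linarith
  have h22 : D 2 2 = 0 := by have := hD 2 2; simp [etaDiag] at this; linarith
  have h10 : D 1 0 = D 0 1 := by have := hD 1 0; simp [etaDiag] at this; linarith
  have h20 : D 2 0 = D 0 2 := by have := hD 2 0; simp [etaDiag] at this; linarith
  have h21 : D 2 1 = -D 1 2 := by have := hD 2 1; simp [etaDiag] at this; linarith
  simp only [Fin.sum_univ_three, spinGrad_zero, spinGrad_one, spinGrad_two, h10, h20, h21]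
  rcases hs with rfl | rfl
  all_goals
    ext i j
    simp only [Matrix.one_fin_two, Matrix.sub_apply, Matrix.add_apply, Matrix.smul_apply,
      Matrix.mul_apply, Fin.sum_univ_two]
    fin_cases ν <;> fin_cases i <;> fin_cases j <;>
      simp [gam, h00, h11, h22, h10, h20, h21, Complex.ext_iff] <;>
      (try constructor) <;> ring

theorem gam_linearIndependent {s : ℝ} (hs : s = 1 ∨ s = -1) {v : Fin 3 → ℂ}
    (h : ∑ μ, v μ • gam s μ = 0) : ∀ μ, v μ = 0 := by
  have e : ∀ i j, (∑ μ, v μ • gam s μ) i j = 0 := fun i j => by rw [h]; rfl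
  have e00 := e 0 0; have e01 := e 0 1; have e10 := e 1 0
  simp [gam, Fin.sum_univ_three] at e00 e01 e10
  have hsc : (s : ℂ) ≠ 0 := by rcases hs with rfl | rfl <;> simp
  have h2 : v 2 = 0 := by linear_combination (e01 - e10) / 2
  have h1 : v 1 = 0 := by
    rw [h2, add_zero] at e01
    rcases mul_eq_zero.1 e01 with h | h
    · exact h
    · exact absurd h (mul_ne_zero Complex.I_ne_zero hsc)
  intro μ
  fin_cases μ
  exacts [e00, h1, h2]

theorem trace_gam (s : ℝ) (μ : Fin 3) : (gam s μ).trace = 0 := by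
  fin_cases μ <;> simp [gam, Matrix.trace_fin_two]

theorem trace_gam_mul_gam {s : ℝ} (hs : s = 1 ∨ s = -1) (μ ν : Fin 3) :
    (gam s μ * gam s ν).trace = if μ = ν then 2 * (etaDiag μ : ℂ) else 0 := by
  have hsc : (s : ℂ) * s = 1 := by rcases hs with rfl | rfl <;> simp
  fin_cases μ <;> fin_cases ν <;> simp [gam, Matrix.trace_fin_two, etaDiag]
  · norm_num
  · linear_combination (2 * Complex.I ^ 2) * hsc + 2 * Complex.I_sq
  · norm_num

theorem gam_isUnit {s : ℝ} (hs : s = 1 ∨ s = -1) (ν : Fin 3) : IsUnit (gam s ν) := by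
  rw [Matrix.isUnit_iff_isUnit_det, isUnit_iff_ne_zero]
  have hsc : (s : ℂ) ≠ 0 := by rcases hs with rfl | rfl <;> simp
  fin_cases ν <;> simp [gam, Matrix.det_fin_two, hsc]

/-! ### Symmetry operators: determining equations -/

section Determining

variable {s m : ℝ} {A : Spacetime → Fin 3 → ℝ} {U : Set Spacetime} {x : Spacetime}

theorem ContDiffOn.mdiff {M : Spacetime → Mat2} (hU : IsOpen U) (hx : x ∈ U)
    (hM : ∀ i j, ContDiffOn ℝ ∞ (fun y => M y i j) U) : MDiff M x := fun i j =>
  ((hM i j).contDiffAt (hU.mem_nhds hx)).differentiableAt (by simp)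

/-- The commutator condition for `X`, as equations for its coefficients at one point. -/
theorem commutator_iff (hU : IsOpen U) (hA : ContDiffOn ℝ ∞ A U) {X : FirstOrder}
    (hxi : ContDiffOn ℝ ∞ X.xi U) (hchi : ∀ i j, ContDiffOn ℝ ∞ (fun y => X.chi y i j) U)
    (hx : x ∈ U) (Psi : Fin 3 → Spacetime → Mat2) (Psi0 : Spacetime → Mat2) :
    (∀ ψ : Spacetime → Spinor, ContDiffOn ℝ ∞ ψ U →
      X.act A (dirac s m A ψ) x - dirac s m A (X.act A ψ) x =
        (∑ ν, Psi ν x *ᵥ mom A ν (dirac s m A ψ) x) + Psi0 x *ᵥ dirac s m A ψ x) ↔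
      (∀ ν μ, Psi ν x * gam s μ + Psi μ x * gam s ν = 0) ∧
      (∀ μ, X.chi x * gam s μ - gam s μ * X.chi x -
        Complex.I • (∑ ν, ((pd ν (fun y => X.xi y μ) x : ℝ) : ℂ) • gam s ν) + (m : ℂ) • Psi μ x =
          Psi0 x * gam s μ) ∧
      (m : ℂ) • Psi0 x - Complex.I • (∑ ν, gam s ν * mpd ν X.chi x) =
        ∑ ν, ∑ μ, (Complex.I / 2 * fieldStrength A ν μ x) •
          ((X.xi x ν : ℂ) • gam s μ - (X.xi x μ : ℂ) • gam s ν - Psi ν x * gam s μ) := by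
  have hA2 : ContDiffAt ℝ 2 A x := (hA.contDiffAt (hU.mem_nhds hx)).of_le two_le_infty
  have hxid : ∀ ν, DifferentiableAt ℝ (fun y => X.xi y ν) x := fun ν =>
    ((contDiffOn_pi.1 hxi ν).contDiffAt (hU.mem_nhds hx)).differentiableAt (by simp)
  have hxic : ∀ ν, DifferentiableAt ℝ (fun y => (X.xi y ν : ℂ)) x := fun ν =>
    Complex.ofRealCLM.differentiableAt.comp x (hxid ν)
  have hchid : MDiff X.chi x := ContDiffOn.mdiff hU hx hchi
  have key : ∀ ψ : Spacetime → Spinor, ContDiffOn ℝ ∞ ψ U →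
      (X.act A (dirac s m A ψ) x - dirac s m A (X.act A ψ) x) -
        ((∑ ν, Psi ν x *ᵥ mom A ν (dirac s m A ψ) x) + Psi0 x *ᵥ dirac s m A ψ x) =
      secondOrder A
        (fun ν μ => (X.xi x ν : ℂ) • gam s μ - (X.xi x μ : ℂ) • gam s ν - Psi ν x * gam s μ)
        (fun μ => (X.chi x * gam s μ - gam s μ * X.chi x -
          Complex.I • (∑ ν, ((pd ν (fun y => X.xi y μ) x : ℝ) : ℂ) • gam s ν) + (m : ℂ) • Psi μ x) -
          Psi0 x * gam s μ)
        ((m : ℂ) • Psi0 x - Complex.I • (∑ ν, gam s ν * mpd ν X.chi x)) ψ x := by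
    intro ψ hψ
    have hψ2 : ContDiffAt ℝ 2 ψ x := (hψ.contDiffAt (hU.mem_nhds hx)).of_le two_le_infty
    have e3 : (∑ ν, Psi ν x *ᵥ mom A ν (dirac s m A ψ) x) + Psi0 x *ᵥ dirac s m A ψ x =
        matOp A Psi Psi0 (dirac s m A ψ) x := rfl
    rw [e3, dirac_eq_matOp, act_eq_matOp,
      matOp_matOp hA2 hψ2 _ _ (fun ν => mdiff_const _ _) (mdiff_const _ _),
      matOp_matOp hA2 hψ2 _ _ (fun ν => MDiff.smul_const (hxic ν) _) hchid,
      matOp_matOp hA2 hψ2 _ _ (fun ν => mdiff_const _ _) (mdiff_const _ _),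
      secondOrder_sub, secondOrder_sub]
    congr 1
    · funext ν μ
      simp
    · funext μ
      simp only [Pi.sub_apply, mpd_smul_const (hxic μ), mpd_const, Fin.sum_univ_three,
        pd_ofReal (hxid μ)]
      simp only [Matrix.mul_smul, Matrix.mul_one, mul_zero,
        smul_zero, neg_smul, mul_neg, neg_mul]
      module
    · simp only [mpd_const, Fin.sum_univ_three]
      simp only [Matrix.mul_smul, Matrix.smul_mul, Matrix.mul_one, Matrix.one_mul, mul_zero,
        smul_zero, neg_smul, mul_neg, neg_mul]
      module
  have : (∀ ψ : Spacetime → Spinor, ContDiffOn ℝ ∞ ψ U →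
      X.act A (dirac s m A ψ) x - dirac s m A (X.act A ψ) x =
        (∑ ν, Psi ν x *ᵥ mom A ν (dirac s m A ψ) x) + Psi0 x *ᵥ dirac s m A ψ x) ↔
      ∀ ψ : Spacetime → Spinor, ContDiffOn ℝ ∞ ψ U → secondOrder A
        (fun ν μ => (X.xi x ν : ℂ) • gam s μ - (X.xi x μ : ℂ) • gam s ν - Psi ν x * gam s μ)
        (fun μ => (X.chi x * gam s μ - gam s μ * X.chi x -
          Complex.I • (∑ ν, ((pd ν (fun y => X.xi y μ) x : ℝ) : ℂ) • gam s ν) + (m : ℂ) • Psi μ x) -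
          Psi0 x * gam s μ)
        ((m : ℂ) • Psi0 x - Complex.I • (∑ ν, gam s ν * mpd ν X.chi x)) ψ x = 0 := by
    refine forall_congr' fun ψ => forall_congr' fun hψ => ?_
    rw [← key ψ hψ, sub_eq_zero]
  rw [this, secondOrder_eq_zero_iff hA2 hU hx]
  refine and_congr (forall_congr' fun ν => forall_congr' fun μ => ?_)
    (and_congr (forall_congr' fun μ => ?_) Iff.rfl)
  -- The terms with ξ are antisymmetric in ν and μ because ξ is scalar; symmetrization leaves only
  -- the multiplier.
  · rw [← neg_eq_zero]
    exact Eq.congr_left (by module)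
  · rw [sub_eq_zero]

/-- The Killing equation at a point. -/
def KillingAt (xi : Spacetime → Fin 3 → ℝ) (x : Spacetime) : Prop :=
  ∀ μ ν, etaDiag μ * pd μ (fun y => xi y ν) x + etaDiag ν * pd ν (fun y => xi y μ) x = 0

theorem etaDiag_mul_self (μ : Fin 3) : etaDiag μ * etaDiag μ = 1 := by
  fin_cases μ <;> simp [etaDiag]

theorem contDiffOn_spinCoeff {xi : Spacetime → Fin 3 → ℝ} (hU : IsOpen U)
    (hxi : ContDiffOn ℝ ∞ xi U) (s : ℝ) (α : Fin 3) : ContDiffOn ℝ ∞ (spinCoeff s xi α) U := by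
  unfold spinCoeff
  exact contDiffOn_const.mul (ContDiffOn.sum fun μ _ => ContDiffOn.sum fun σ _ =>
    (contDiffOn_const.mul (contDiffOn_pd hU (contDiffOn_pi.1 hxi μ) σ)).mul contDiffOn_const)

theorem pd_spinCoeff {xi : Spacetime → Fin 3 → ℝ} (hU : IsOpen U) (hxi : ContDiffOn ℝ ∞ xi U)
    (hx : x ∈ U) (s : ℝ) (β α : Fin 3) :
    pd β (spinCoeff s xi α) x =
      -(s / 4) * ∑ μ, ∑ σ, etaDiag σ * pd β (pd σ fun y => xi y μ) x * levi μ σ α := by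
  have hd : ∀ σ μ, DifferentiableAt ℝ (pd σ fun y => xi y μ) x := fun σ μ =>
    ((contDiffOn_pd hU (contDiffOn_pi.1 hxi μ) σ).contDiffAt (hU.mem_nhds hx)).differentiableAt
      (by simp)
  have h1 : ∀ σ μ, DifferentiableAt ℝ
      (fun y => etaDiag σ * pd σ (fun y => xi y μ) y * levi μ σ α) x := fun σ μ =>
    ((hd σ μ).const_mul _).mul_const _
  have e : spinCoeff s xi α = fun y => -(s / 4) * ∑ μ, ∑ σ,
    etaDiag σ * pd σ (fun y => xi y μ) y * levi μ σ α := rfl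
  rw [e, pd_const_mul _ (DifferentiableAt.fun_sum fun μ _ => DifferentiableAt.fun_sum fun σ _ =>
    h1 σ μ), pd_sum fun μ _ => DifferentiableAt.fun_sum fun σ _ => h1 σ μ]
  congr 1
  refine Finset.sum_congr rfl fun μ _ => ?_
  rw [pd_sum fun σ _ => h1 σ μ]
  refine Finset.sum_congr rfl fun σ _ => ?_
  rw [pd_mul ((hd σ μ).const_mul _) (differentiableAt_const _), pd_const_mul _ (hd σ μ)]
  simp

/-- The Minkowski divergence of the spin coefficients vanishes. -/
theorem div_spinCoeff {xi : Spacetime → Fin 3 → ℝ} (hU : IsOpen U) (hxi : ContDiffOn ℝ ∞ xi U)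
    (hx : x ∈ U) (s : ℝ) : ∑ α, etaDiag α * pd α (spinCoeff s xi α) x = 0 := by
  have hc : ∀ κ μ ν, pd μ (pd ν fun y => xi y κ) x = pd ν (pd μ fun y => xi y κ) x :=
    fun κ μ ν => pd_comm (((contDiffOn_pi.1 hxi κ).contDiffAt (hU.mem_nhds hx)).of_le
      two_le_infty) μ ν
  simp only [pd_spinCoeff hU hxi hx, Fin.sum_univ_three]
  simp only [levi, etaDiag]
  -- The antisymmetric symbol is contracted with symmetric second derivatives. No Killing equation
  -- enters, so the identity is available while ρ is still unknown.
  rw [hc 0 2 1, hc 1 2 0, hc 2 1 0]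
  norm_num
  ring

/-- With the last index lowered, ∂_β ∂_μ ξ_ν is symmetric in its first two indices and, by the
differentiated Killing equation, antisymmetric in its last two. Permuting indices cyclically shows
that such an array equals its own negative. -/
theorem pd_pd_eq_zero_of_killing {xi : Spacetime → Fin 3 → ℝ} (hU : IsOpen U)
    (hxi : ContDiffOn ℝ ∞ xi U) (hK : ∀ y ∈ U, KillingAt xi y) (hx : x ∈ U) (β μ ν : Fin 3) :
    pd β (pd μ fun y => xi y ν) x = 0 := by
  have hc : ∀ κ μ ν, pd μ (pd ν fun y => xi y κ) x = pd ν (pd μ fun y => xi y κ) x :=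
    fun κ μ ν => pd_comm (((contDiffOn_pi.1 hxi κ).contDiffAt (hU.mem_nhds hx)).of_le
      two_le_infty) μ ν
  have hd : ∀ σ μ, DifferentiableAt ℝ (pd σ fun y => xi y μ) x := fun σ μ =>
    ((contDiffOn_pd hU (contDiffOn_pi.1 hxi μ) σ).contDiffAt (hU.mem_nhds hx)).differentiableAt
      (by simp)
  have hk : ∀ β μ ν, etaDiag μ * pd β (pd μ fun y => xi y ν) x +
      etaDiag ν * pd β (pd ν fun y => xi y μ) x = 0 := by
    intro β μ ν
    have h1 := pd_congr (f := fun y => etaDiag μ * pd μ (fun y => xi y ν) y +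
      etaDiag ν * pd ν (fun y => xi y μ) y) (g := fun _ => 0) hU (fun y hy => hK y hy μ ν) hx β
    rwa [pd_add ((hd μ ν).const_mul _) ((hd ν μ).const_mul _), pd_const_mul _ (hd μ ν),
      pd_const_mul _ (hd ν μ), pd_const] at h1
  have hT : ∀ β μ ν, etaDiag ν * pd β (pd μ fun y => xi y ν) x =
      -(etaDiag μ * pd β (pd ν fun y => xi y μ) x) := by
    intro β μ ν
    have := hk β μ ν
    have h1 := etaDiag_mul_self μ
    have h2 := etaDiag_mul_self ν
    linear_combination etaDiag μ * etaDiag ν * this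
      - etaDiag ν * pd β (pd μ fun y => xi y ν) x * h1
      - etaDiag μ * pd β (pd ν fun y => xi y μ) x * h2
  have h0 : etaDiag ν * pd β (pd μ fun y => xi y ν) x = 0 := by
    have e1 := hT β μ ν
    have e2 := hT ν β μ
    have e3 := hT μ ν β
    rw [hc μ β ν] at e1
    rw [hc β ν μ] at e2
    rw [hc ν μ β] at e3
    linarith
  exact (mul_eq_zero.1 h0).resolve_left fun h => by
    have := etaDiag_mul_self ν
    simp [h] at this

theorem pd_spinCoeff_of_killing {xi : Spacetime → Fin 3 → ℝ} (hU : IsOpen U)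
    (hxi : ContDiffOn ℝ ∞ xi U) (hK : ∀ y ∈ U, KillingAt xi y) (hx : x ∈ U) (s : ℝ)
    (β α : Fin 3) : pd β (spinCoeff s xi α) x = 0 := by
  rw [pd_spinCoeff hU hxi hx]
  simp [pd_pd_eq_zero_of_killing hU hxi hK hx]

/-- The matrix `φ + φ_α γ^α`. -/
def spinMat (s : ℝ) (xi : Spacetime → Fin 3 → ℝ) (φ : Spacetime → ℂ) (x : Spacetime) : Mat2 :=
  φ x • (1 : Mat2) + ∑ α, (spinCoeff s xi α x : ℂ) • gam s α

theorem mpd_spinMat {xi : Spacetime → Fin 3 → ℝ} {φ : Spacetime → ℂ} (hU : IsOpen U)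
    (hxi : ContDiffOn ℝ ∞ xi U) (hφ : DifferentiableAt ℝ φ x) (hx : x ∈ U) (s : ℝ) (ν : Fin 3) :
    mpd ν (spinMat s xi φ) x =
      pd ν φ x • (1 : Mat2) + ∑ α, ((pd ν (spinCoeff s xi α) x : ℝ) : ℂ) • gam s α := by
  have hd : ∀ α, DifferentiableAt ℝ (spinCoeff s xi α) x := fun α =>
    ((contDiffOn_spinCoeff hU hxi s α).contDiffAt (hU.mem_nhds hx)).differentiableAt (by simp)
  have hdc : ∀ α, DifferentiableAt ℝ (fun y => (spinCoeff s xi α y : ℂ)) x := fun α =>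
    Complex.ofRealCLM.differentiableAt.comp x (hd α)
  have h2 := fun α => MDiff.smul_const (hdc α) (gam s α)
  have e : spinMat s xi φ = fun y => φ y • (1 : Mat2) + (((spinCoeff s xi 0 y : ℂ) • gam s 0 +
      (spinCoeff s xi 1 y : ℂ) • gam s 1) + (spinCoeff s xi 2 y : ℂ) • gam s 2) := by
    funext y; simp [spinMat, Fin.sum_univ_three]
  rw [e, mpd_add (MDiff.smul_const hφ _) (((h2 0).add (h2 1)).add (h2 2)),
    mpd_add ((h2 0).add (h2 1)) (h2 2), mpd_add (h2 0) (h2 1), mpd_smul_const hφ,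
    mpd_smul_const (hdc 0), mpd_smul_const (hdc 1), mpd_smul_const (hdc 2),
    pd_ofReal (hd 0), pd_ofReal (hd 1), pd_ofReal (hd 2), Fin.sum_univ_three]

/-- The coefficients of a symmetry operator. -/
structure IsSpinSymmetry (s : ℝ) (A : Spacetime → Fin 3 → ℝ) (U : Set Spacetime)
    (X : FirstOrder) (φ : Spacetime → ℂ) : Prop where
  smooth_xi : ContDiffOn ℝ ∞ X.xi U
  smooth_phi : ContDiffOn ℝ ∞ φ U
  killing : ∀ x ∈ U, KillingAt X.xi x
  chi_eq : ∀ x ∈ U, X.chi x = spinMat s X.xi φ x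
  pd_phi : ∀ x ∈ U, ∀ μ, pd μ φ x = ((∑ ν, fieldStrength A μ ν x * X.xi x ν : ℝ) : ℂ)

-- The scalar part is half the trace of χ. The hypothesis m ≠ 0 is what excludes proper conformal
-- fields: the trace of the zeroth-order equation is a multiple of mρ.
set_option maxHeartbeats 1000000 in
theorem IsSymmetry.exists_isSpinSymmetry (hs : s = 1 ∨ s = -1) (hm : m ≠ 0) (hU : IsOpen U)
    (hA : ContDiffOn ℝ ∞ A U) {X : FirstOrder} (hX : IsSymmetry s m A U X) :
    ∃ φ, IsSpinSymmetry s A U X φ := by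
  obtain ⟨hxi, hchi, Psi, Psi0, -, -, h⟩ := hX
  have hφ : ContDiffOn ℝ ∞ (fun y => (X.chi y 0 0 + X.chi y 1 1) / 2) U :=
    ((hchi 0 0).add (hchi 1 1)).div_const 2
  have hφd : ∀ x ∈ U, DifferentiableAt ℝ (fun y => (X.chi y 0 0 + X.chi y 1 1) / 2) x :=
    fun x hx => (hφ.contDiffAt (hU.mem_nhds hx)).differentiableAt (by simp)
  have hsym : ∀ x ∈ U, (∀ μ, Psi μ x = 0) ∧
      (∀ μ, X.chi x * gam s μ - gam s μ * X.chi x -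
        Complex.I • (∑ ν, ((pd ν (fun y => X.xi y μ) x : ℝ) : ℂ) • gam s ν) = Psi0 x * gam s μ) ∧
      (m : ℂ) • Psi0 x - Complex.I • (∑ ν, gam s ν * mpd ν X.chi x) =
        Complex.I • ∑ μ, ((∑ ν, X.xi x ν * fieldStrength A ν μ x : ℝ) : ℂ) • gam s μ := by
    intro x hx
    obtain ⟨h1, h2, h3⟩ := (commutator_iff hU hA hxi hchi hx Psi Psi0).1
      fun ψ hψ => h ψ hψ x hx
    -- The diagonal case 2 Ψ^μ γ^μ = 0 suffices, since γ^μ is invertible.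
    have hPsi : ∀ μ, Psi μ x = 0 := by
      intro μ
      have := h1 μ μ
      rw [← two_smul ℂ, smul_eq_zero] at this
      have h0 : Psi μ x * gam s μ = 0 * gam s μ := by simpa using this
      exact (gam_isUnit hs μ).mul_right_cancel h0
    refine ⟨hPsi, fun μ => by simpa [hPsi] using h2 μ, h3.trans ?_⟩
    have f : ∀ ν μ, fieldStrength A μ ν x = -fieldStrength A ν μ x := fun ν μ => by
      simp [fieldStrength]
    have f0 : ∀ ν, fieldStrength A ν ν x = 0 := fun ν => by simp [fieldStrength]
    simp only [hPsi, Fin.sum_univ_three, f0, f 0 1, f 0 2, f 1 2]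
    push_cast
    simp only [zero_mul]
    module
  have halg := fun x hx => symbol_algebra hs (hsym x hx).2.1
  have hspin : ∀ x ∈ U, X.chi x =
      spinMat s X.xi (fun y => (X.chi y 0 0 + X.chi y 1 1) / 2) x := by
    intro x hx
    obtain ⟨-, -, -, h⟩ := halg x hx
    exact h
  have hmpd : ∀ x ∈ U, ∀ ν, mpd ν X.chi x =
      pd ν (fun y => (X.chi y 0 0 + X.chi y 1 1) / 2) x • (1 : Mat2) +
        ∑ α, ((pd ν (spinCoeff s X.xi α) x : ℝ) : ℂ) • gam s α := by
    intro x hx ν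
    rw [mpd_congr hU hspin hx, mpd_spinMat hU hxi (hφd x hx) hx]
  -- Take the trace of the zeroth-order equation. The gradient of φ multiplies a traceless γ^ν, and
  -- the traces of γ^ν γ^α turn the spin coefficients into their divergence, which is zero; only mΨ₀
  -- = -imρ is left.
  have hrho : ∀ x ∈ U, Psi0 x = 0 := by
    intro x hx
    obtain ⟨ρ, h1, -, -⟩ := halg x hx
    have h3 := congrArg Matrix.trace (hsym x hx).2.2
    have hdiv := div_spinCoeff hU hxi hx s
    have hdivc : ∑ α, (etaDiag α : ℂ) * ((pd α (spinCoeff s X.xi α) x : ℝ) : ℂ) = 0 := by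
      exact_mod_cast hdiv
    have ht : ∀ ν, (gam s ν * mpd ν X.chi x).trace =
        2 * ((etaDiag ν : ℂ) * ((pd ν (spinCoeff s X.xi ν) x : ℝ) : ℂ)) := by
      intro ν
      rw [hmpd x hx, mul_add, Matrix.trace_add, Matrix.mul_smul, Matrix.mul_one,
        Matrix.trace_smul, trace_gam, Finset.mul_sum, Matrix.trace_sum]
      simp only [Matrix.mul_smul, Matrix.trace_smul, trace_gam_mul_gam hs, smul_eq_mul, mul_ite, mul_zero,
        Finset.sum_ite_eq, Finset.mem_univ, if_true, zero_add]
      ring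
    rw [h1, Matrix.trace_sub, Matrix.trace_smul, Matrix.trace_smul, Matrix.trace_smul,
      Matrix.trace_smul, Matrix.trace_sum, Matrix.trace_sum] at h3
    simp only [ht, ← Finset.mul_sum, hdivc, Matrix.trace_smul, trace_gam, Matrix.trace_one] at h3
    simp [hm] at h3
    simp [h1, h3]
  have hK : ∀ x ∈ U, KillingAt X.xi x := by
    intro x hx
    obtain ⟨ρ, h1, h2, -⟩ := halg x hx
    have : ρ = 0 := by
      rw [hrho x hx] at h1
      have := congrFun (congrFun h1 0) 0
      simpa using this.symm
    intro μ ν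
    have := h2 μ ν
    simpa [‹ρ = 0›] using this
  refine ⟨_, hxi, hφ, hK, hspin, fun x hx μ => ?_⟩
  have h3 := (hsym x hx).2.2
  -- The spin coefficients are now known to be constant, so the remaining identity is linear in the
  -- γ^μ, and their independence gives the gradient of φ.
  simp only [hrho x hx, hmpd x hx, pd_spinCoeff_of_killing hU hxi hK hx, smul_zero, zero_sub,
    Complex.ofReal_zero, zero_smul, Finset.sum_const_zero, add_zero, Matrix.mul_smul,
    Matrix.mul_one] at h3
  rw [← smul_neg] at h3
  have h4 := smul_right_injective Mat2 Complex.I_ne_zero h3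
  have h5 : ∑ μ, (pd μ (fun y => (X.chi y 0 0 + X.chi y 1 1) / 2) x +
      ((∑ ν, X.xi x ν * fieldStrength A ν μ x : ℝ) : ℂ)) • gam s μ = 0 := by
    simp only [add_smul, Finset.sum_add_distrib, ← h4]
    simp
  rw [eq_neg_of_add_eq_zero_left (gam_linearIndependent hs h5 μ), ← Complex.ofReal_neg]
  congr 1
  rw [← Finset.sum_neg_distrib]
  refine Finset.sum_congr rfl fun ν _ => ?_
  rw [fieldStrength, fieldStrength]; ring

theorem IsSpinSymmetry.smooth_chi (hU : IsOpen U) {X : FirstOrder} {φ : Spacetime → ℂ}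
    (h : IsSpinSymmetry s A U X φ) (i j : Fin 2) : ContDiffOn ℝ ∞ (fun y => X.chi y i j) U := by
  have : ContDiffOn ℝ ∞ (fun y => spinMat s X.xi φ y i j) U := by
    simp only [spinMat, Matrix.add_apply, Matrix.sum_apply, Matrix.smul_apply, smul_eq_mul]
    exact (h.smooth_phi.mul contDiffOn_const).add (ContDiffOn.sum fun α _ =>
      (Complex.ofRealCLM.contDiff.comp_contDiffOn (contDiffOn_spinCoeff hU h.smooth_xi s α)).mul
        contDiffOn_const)
  exact this.congr fun y hy => by rw [h.chi_eq y hy]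

theorem IsSpinSymmetry.mpd_chi (hU : IsOpen U) {X : FirstOrder} {φ : Spacetime → ℂ}
    (h : IsSpinSymmetry s A U X φ) (hx : x ∈ U) (ν : Fin 3) :
    mpd ν X.chi x = pd ν φ x • (1 : Mat2) := by
  rw [mpd_congr hU h.chi_eq hx, mpd_spinMat hU h.smooth_xi
    ((h.smooth_phi.contDiffAt (hU.mem_nhds hx)).differentiableAt (by simp)) hx]
  simp [pd_spinCoeff_of_killing hU h.smooth_xi h.killing hx]

/-- The multiplier can be taken to be zero: such an operator commutes with H. -/
theorem IsSpinSymmetry.isSymmetry (hs : s = 1 ∨ s = -1) (hU : IsOpen U)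
    (hA : ContDiffOn ℝ ∞ A U) {X : FirstOrder} {φ : Spacetime → ℂ}
    (h : IsSpinSymmetry s A U X φ) : IsSymmetry s m A U X := by
  refine ⟨h.smooth_xi, h.smooth_chi hU, fun _ _ => 0, fun _ => 0, fun _ _ _ => contDiffOn_const,
    fun _ _ => contDiffOn_const, fun ψ hψ x hx => ?_⟩
  refine (commutator_iff hU hA h.smooth_xi (h.smooth_chi hU) hx (fun _ _ => 0) (fun _ => 0)).2
    ⟨by simp, fun μ => ?_, ?_⟩ ψ hψ
  · rw [h.chi_eq x hx, spinMat]
    simp only [spinCoeff_eq_spinGrad]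
    simpa using symbol_algebra_of_killing hs (h.killing x hx) (φ x) μ
  · have f : ∀ ν μ, fieldStrength A μ ν x = -fieldStrength A ν μ x := fun ν μ => by
      simp [fieldStrength]
    have f0 : ∀ ν, fieldStrength A ν ν x = 0 := fun ν => by simp [fieldStrength]
    simp only [h.mpd_chi hU hx, h.pd_phi x hx, Fin.sum_univ_three, Matrix.mul_smul, Matrix.mul_one,
      f0, f 0 1, f 0 2, f 1 2]
    push_cast
    simp only [zero_mul]
    module

/-- The commutation of two symmetry operators, as equations for their coefficients. -/
theorem commute_iff (hU : IsOpen U) (hA : ContDiffOn ℝ ∞ A U) {X Y : FirstOrder}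
    {φ θ : Spacetime → ℂ} (hX : IsSpinSymmetry s A U X φ) (hY : IsSpinSymmetry s A U Y θ)
    (hx : x ∈ U) :
    (∀ ψ : Spacetime → Spinor, ContDiffOn ℝ ∞ ψ U →
      X.act A (Y.act A ψ) x = Y.act A (X.act A ψ) x) ↔
      (∀ μ, ∑ ν, (X.xi x ν * pd ν (fun y => Y.xi y μ) x -
        Y.xi x ν * pd ν (fun y => X.xi y μ) x) = 0) ∧
      (∑ ν, ∑ μ, fieldStrength A ν μ x * X.xi x ν * Y.xi x μ = 0) ∧
      X.chi x * Y.chi x = Y.chi x * X.chi x := by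
  have hA2 : ContDiffAt ℝ 2 A x := (hA.contDiffAt (hU.mem_nhds hx)).of_le two_le_infty
  have hd : ∀ {Z : FirstOrder}, ContDiffOn ℝ ∞ Z.xi U → ∀ ν,
      DifferentiableAt ℝ (fun y => Z.xi y ν) x := fun hZ ν =>
    ((contDiffOn_pi.1 hZ ν).contDiffAt (hU.mem_nhds hx)).differentiableAt (by simp)
  have hdc : ∀ {Z : FirstOrder}, ContDiffOn ℝ ∞ Z.xi U → ∀ ν,
      DifferentiableAt ℝ (fun y => (Z.xi y ν : ℂ)) x := fun hZ ν =>
    Complex.ofRealCLM.differentiableAt.comp x (hd hZ ν)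
  have key : ∀ ψ : Spacetime → Spinor, ContDiffOn ℝ ∞ ψ U →
      X.act A (Y.act A ψ) x - Y.act A (X.act A ψ) x =
      secondOrder A
        (fun ν μ => ((X.xi x ν : ℂ) * Y.xi x μ - (Y.xi x ν : ℂ) * X.xi x μ) • (1 : Mat2))
        (fun μ => (Complex.I * ((∑ ν, (X.xi x ν * pd ν (fun y => Y.xi y μ) x -
          Y.xi x ν * pd ν (fun y => X.xi y μ) x) : ℝ) : ℂ)) • (1 : Mat2))
        ((Complex.I * ((2 * ∑ ν, ∑ μ, fieldStrength A ν μ x * X.xi x ν * Y.xi x μ : ℝ) : ℂ)) •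
          (1 : Mat2) + (X.chi x * Y.chi x - Y.chi x * X.chi x)) ψ x := by
    intro ψ hψ
    have hψ2 : ContDiffAt ℝ 2 ψ x := (hψ.contDiffAt (hU.mem_nhds hx)).of_le two_le_infty
    rw [act_eq_matOp, act_eq_matOp,
      matOp_matOp hA2 hψ2 _ _ (fun ν => MDiff.smul_const (hdc hY.smooth_xi ν) _)
        (ContDiffOn.mdiff hU hx (hY.smooth_chi hU)),
      matOp_matOp hA2 hψ2 _ _ (fun ν => MDiff.smul_const (hdc hX.smooth_xi ν) _)
        (ContDiffOn.mdiff hU hx (hX.smooth_chi hU)),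
      secondOrder_sub]
    congr 1
    · funext ν μ
      simp only [Pi.sub_apply, Matrix.mul_smul, Matrix.mul_one]
      module
    · funext μ
      simp only [Pi.sub_apply, mpd_smul_const (hdc hX.smooth_xi μ),
        mpd_smul_const (hdc hY.smooth_xi μ), Fin.sum_univ_three,
        pd_ofReal (hd hX.smooth_xi μ), pd_ofReal (hd hY.smooth_xi μ)]
      simp only [Matrix.mul_smul, Matrix.smul_mul, Matrix.mul_one, Matrix.one_mul]
      push_cast
      module
    · have f : ∀ ν μ, fieldStrength A μ ν x = -fieldStrength A ν μ x := fun ν μ => by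
        simp [fieldStrength]
      have f0 : ∀ ν, fieldStrength A ν ν x = 0 := fun ν => by simp [fieldStrength]
      simp only [hX.mpd_chi hU hx, hY.mpd_chi hU hx, hX.pd_phi x hx, hY.pd_phi x hx,
        Fin.sum_univ_three, Matrix.mul_smul, Matrix.mul_one,
        f0, f 0 1, f 0 2, f 1 2]
      push_cast
      module
  have : (∀ ψ : Spacetime → Spinor, ContDiffOn ℝ ∞ ψ U →
      X.act A (Y.act A ψ) x = Y.act A (X.act A ψ) x) ↔
      (∀ ψ : Spacetime → Spinor, ContDiffOn ℝ ∞ ψ U → secondOrder A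
        (fun ν μ => ((X.xi x ν : ℂ) * Y.xi x μ - (Y.xi x ν : ℂ) * X.xi x μ) • (1 : Mat2))
        (fun μ => (Complex.I * ((∑ ν, (X.xi x ν * pd ν (fun y => Y.xi y μ) x -
          Y.xi x ν * pd ν (fun y => X.xi y μ) x) : ℝ) : ℂ)) • (1 : Mat2))
        ((Complex.I * ((2 * ∑ ν, ∑ μ, fieldStrength A ν μ x * X.xi x ν * Y.xi x μ : ℝ) : ℂ)) •
          (1 : Mat2) + (X.chi x * Y.chi x - Y.chi x * X.chi x)) ψ x = 0) := by
    refine forall_congr' fun ψ => forall_congr' fun hψ => ?_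
    rw [← key ψ hψ, sub_eq_zero]
  rw [this, secondOrder_eq_zero_iff hA2 hU hx]
  have hF : ∑ ν, ∑ μ, (Complex.I / 2 * fieldStrength A ν μ x) •
      ((X.xi x ν : ℂ) * Y.xi x μ - (Y.xi x ν : ℂ) * X.xi x μ) • (1 : Mat2) =
      (Complex.I * ((∑ ν, ∑ μ, fieldStrength A ν μ x * X.xi x ν * Y.xi x μ : ℝ) : ℂ)) •
        (1 : Mat2) := by
    have f : ∀ ν μ, fieldStrength A μ ν x = -fieldStrength A ν μ x := fun ν μ => by
      simp [fieldStrength]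
    have f0 : ∀ ν, fieldStrength A ν ν x = 0 := fun ν => by simp [fieldStrength]
    simp only [Fin.sum_univ_three, f0, f 0 1, f 0 2, f 1 2]
    push_cast
    module
  have hone : ∀ c : ℂ, c • (1 : Mat2) = 0 ↔ c = 0 := fun c => by simp
  rw [hF]
  constructor
  · rintro ⟨-, h1, h2⟩
    -- The matrix commutator is traceless and everything else is a multiple of the identity, so the
    -- trace separates them. Differentiating the scalar parts gives 2iF(ξ, η), of which the
    -- commutators of momenta cancel only half.
    have hF0 : ∑ ν, ∑ μ, fieldStrength A ν μ x * X.xi x ν * Y.xi x μ = 0 := by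
      have h3 := congrArg Matrix.trace h2
      rw [Matrix.trace_add, Matrix.trace_sub, Matrix.trace_mul_comm (X.chi x), sub_self,
        Matrix.trace_smul, Matrix.trace_smul, Matrix.trace_one] at h3
      have h4 : Complex.I * (((∑ ν, ∑ μ, fieldStrength A ν μ x * X.xi x ν * Y.xi x μ : ℝ) : ℂ)) = 0 := by
        push_cast at h3 ⊢
        simp only [Fintype.card_fin, smul_eq_mul] at h3
        linear_combination h3 / 2
      exact Complex.ofReal_eq_zero.1 ((mul_eq_zero.1 h4).resolve_left Complex.I_ne_zero)
    refine ⟨fun μ => ?_, hF0, ?_⟩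
    · have := (hone _).1 (h1 μ)
      exact Complex.ofReal_eq_zero.1 ((mul_eq_zero.1 this).resolve_left Complex.I_ne_zero)
    · rw [hF0] at h2
      simpa [sub_eq_zero] using h2
  · rintro ⟨h1, h2, h3⟩
    refine ⟨fun ν μ => by module, fun μ => by simp [h1 μ], by simp [h2, h3]⟩

end Determining

/-! ### The Killing fields of the table -/

/-- The constant gradient `∂_μ ξ^i` of the vector field `l_{αν}`. -/
def lGrad (α ν μ i : Fin 3) : ℝ :=
  etaDiag α * (if μ = α then 1 else 0) * (Pi.single ν 1 : Fin 3 → ℝ) i -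
    etaDiag ν * (if μ = ν then 1 else 0) * (Pi.single α 1 : Fin 3 → ℝ) i

theorem contDiff_lVec (α ν : Fin 3) : ContDiff ℝ ∞ (lVec α ν) := by
  unfold lVec pVec
  exact ((contDiff_const.mul (contDiff_apply ℝ ℝ α)).smul contDiff_const).sub
    ((contDiff_const.mul (contDiff_apply ℝ ℝ ν)).smul contDiff_const)

theorem contDiff_pVec (ν : Fin 3) : ContDiff ℝ ∞ (pVec ν) := contDiff_const

theorem pd_lVec (α ν μ i : Fin 3) (x : Spacetime) :
    pd μ (fun y => lVec α ν y i) x = lGrad α ν μ i := by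
  have e : (fun y : Spacetime => lVec α ν y i) = fun y =>
      (etaDiag α * (Pi.single ν 1 : Fin 3 → ℝ) i) * y α -
        (etaDiag ν * (Pi.single α 1 : Fin 3 → ℝ) i) * y ν := by
    funext y; simp [lVec, pVec]; ring
  have hd : ∀ κ : Fin 3, DifferentiableAt ℝ (fun y : Spacetime => y κ) x := fun κ =>
    differentiableAt_apply κ x
  rw [e, pd_sub ((hd α).const_mul _) ((hd ν).const_mul _), pd_const_mul _ (hd α),
    pd_const_mul _ (hd ν), pd_coord, pd_coord, lGrad]
  ring

/-- The constant gradients `∂_μ ξ^i` of the vector fields of the table. -/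
def SetKind.grad : SetKind → Fin 2 → Fin 3 → Fin 3 → ℝ
  | .p0p1 => 0
  | .p1p2 => 0
  | .p0l21 => ![0, lGrad 2 1]
  | .p1l02 => ![0, lGrad 0 2]
  | .p1null => 0
  | .nullRot _ => ![0, lGrad 2 1 + lGrad 0 1]

theorem SetKind.contDiff_killing (κ : SetKind) (j : Fin 2) : ContDiff ℝ ∞ (κ.killing j) := by
  have hnull : ContDiff ℝ ∞ ((1 / 2 : ℝ) • (pVec 0 + pVec 2)) :=
    ((contDiff_pVec 0).add (contDiff_pVec 2)).const_smul (1 / 2 : ℝ)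
  cases κ <;> fin_cases j
  · exact contDiff_pVec 0
  · exact contDiff_pVec 1
  · exact contDiff_pVec 1
  · exact contDiff_pVec 2
  · exact contDiff_pVec 0
  · exact contDiff_lVec 2 1
  · exact contDiff_pVec 1
  · exact contDiff_lVec 0 2
  · exact contDiff_pVec 1
  · exact hnull
  · exact hnull
  · rename_i a
    exact ((contDiff_lVec 2 1).add (contDiff_lVec 0 1)).add
      (contDiff_const (c := a • (Pi.single 0 1 - Pi.single 2 1 : Fin 3 → ℝ)))

theorem SetKind.pd_killing (κ : SetKind) (j : Fin 2) (μ i : Fin 3) (x : Spacetime) :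
    pd μ (fun y => κ.killing j y i) x = κ.grad j μ i := by
  have hp : ∀ ν, pd μ (fun y => pVec ν y i) x = 0 := fun ν => pd_const _ _ _
  have hn : pd μ (fun y => ((1 / 2 : ℝ) • (pVec 0 + pVec 2)) y i) x = 0 :=
    pd_const (((1 / 2 : ℝ) • (Pi.single 0 1 + Pi.single 2 1 : Fin 3 → ℝ)) i) μ x
  cases κ <;> fin_cases j
  · exact hp 0
  · exact hp 1
  · exact hp 1
  · exact hp 2
  · exact hp 0
  · exact pd_lVec 2 1 μ i x
  · exact hp 1
  · exact pd_lVec 0 2 μ i x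
  · exact hp 1
  · exact hn
  · exact hn
  · rename_i a
    have hd : ∀ α ν, DifferentiableAt ℝ (fun y => lVec α ν y i) x := fun α ν =>
      (contDiff_pi.1 (contDiff_lVec α ν) i).differentiable (by simp) x
    have h1 := pd_add (hd 2 1) (hd 0 1) μ
    have h2 := pd_add ((hd 2 1).fun_add (hd 0 1))
      (differentiableAt_const ((a • (pVec 0 x - pVec 2 x)) i)) μ
    rw [h1, pd_lVec, pd_lVec, pd_const, add_zero] at h2
    exact h2

theorem lGrad_killing (α ν μ i : Fin 3) :
    etaDiag μ * lGrad α ν μ i + etaDiag i * lGrad α ν i μ = 0 := by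
  have h := etaDiag_mul_self
  simp only [lGrad, Pi.single_apply]
  split_ifs <;> subst_vars <;> simp_all

theorem SetKind.grad_killing (κ : SetKind) (j : Fin 2) (μ i : Fin 3) :
    etaDiag μ * κ.grad j μ i + etaDiag i * κ.grad j i μ = 0 := by
  cases κ <;> fin_cases j
  all_goals first
    | simp [SetKind.grad, lGrad_killing]; done
    | (have h1 := lGrad_killing 2 1 μ i
       have h2 := lGrad_killing 0 1 μ i
       simp only [SetKind.grad, Pi.add_apply, Matrix.cons_val_one, Matrix.cons_val_fin_one,
         Fin.mk_one]
       linarith)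

theorem SetKind.killingAt (κ : SetKind) (j : Fin 2) (x : Spacetime) :
    KillingAt (κ.killing j) x := fun μ i => by
  rw [κ.pd_killing, κ.pd_killing, κ.grad_killing]

theorem SetKind.grad_first (κ : SetKind) : κ.grad 0 = 0 := by
  cases κ <;> rfl

/-- The first field of each row is constant, so the Lie bracket is just the derivative of the second
field along it. -/
theorem SetKind.bracket (κ : SetKind) (x : Spacetime) (i : Fin 3) :
    ∑ μ, κ.killing 0 x μ * κ.grad 1 μ i = 0 := by
  cases κ <;> fin_cases i <;>
    simp [SetKind.killing, SetKind.grad, lGrad, pVec, Fin.sum_univ_three, etaDiag]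

/-- The constant matrix `φ_α γ^α` of a vector field of the table. -/
def SetKind.spin (κ : SetKind) (s : ℝ) (j : Fin 2) : Mat2 :=
  ∑ α, (spinGrad s (κ.grad j) α : ℂ) • gam s α

theorem SetKind.spinCoeff_killing (κ : SetKind) (s : ℝ) (j : Fin 2) (α : Fin 3) (x : Spacetime) :
    spinCoeff s (κ.killing j) α x = spinGrad s (κ.grad j) α := by
  rw [spinCoeff_eq_spinGrad]
  simp only [κ.pd_killing]

theorem SetKind.spinMat_killing (κ : SetKind) (s : ℝ) (j : Fin 2) (φ : Spacetime → ℂ)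
    (x : Spacetime) : spinMat s (κ.killing j) φ x = φ x • (1 : Mat2) + κ.spin s j := by
  simp only [spinMat, κ.spinCoeff_killing, SetKind.spin]

theorem SetKind.spin_first (κ : SetKind) (s : ℝ) : κ.spin s 0 = 0 := by
  simp [SetKind.spin, spinGrad, κ.grad_first]

/-! ### Calculus in adapted coordinates -/

theorem pd_comp {E : Type*} [NormedAddCommGroup E] [NormedSpace ℝ E] {g : Spacetime → E}
    {c : Spacetime → Spacetime} {x : Spacetime} (hg : DifferentiableAt ℝ g (c x))
    (hc : DifferentiableAt ℝ c x) (α : Fin 3) :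
    pd α (fun y => g (c y)) x = ∑ ν, pd α (fun y => c y ν) x • pd ν g (c x) := by
  have e : pd α (fun y => g (c y)) x = fderiv ℝ g (c x) (pd α c x) := by
    rw [pd, pd, fderiv_fun_comp x hg hc]; rfl
  rw [e, fderiv_eq_sum_pd]
  simp only [pd_apply hc]

theorem pd_comp_real {E : Type*} [NormedAddCommGroup E] [NormedSpace ℝ E] {g : ℝ → E}
    {c : Spacetime → ℝ} {x : Spacetime} (hg : DifferentiableAt ℝ g (c x))
    (hc : DifferentiableAt ℝ c x) (α : Fin 3) :
    pd α (fun y => g (c y)) x = pd α c x • deriv g (c x) := by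
  rw [pd, pd, fderiv_fun_comp x hg hc]
  simp only [ContinuousLinearMap.comp_apply]
  rw [← mul_one (fderiv ℝ c x (Pi.single α 1)), ← smul_eq_mul, map_smul, smul_eq_mul, mul_one]
  rfl

/-- A function on a convex open set whose partial derivatives in all directions but one vanish
depends on a single coordinate. -/
theorem eq_of_pd_eq_zero {E : Type*} [NormedAddCommGroup E] [NormedSpace ℝ E]
    {B : Set Spacetime} (hB : IsOpen B) (hc : Convex ℝ B) {f : Spacetime → E}
    (hf : DifferentiableOn ℝ f B) {k : Fin 3} (h : ∀ u ∈ B, ∀ ν ≠ k, pd ν f u = 0)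
    {u v : Spacetime} (hu : u ∈ B) (hv : v ∈ B) (huv : u k = v k) : f u = f v := by
  -- Along this segment the k-th coordinate has zero velocity, so every term of the directional
  -- derivative vanishes; convexity keeps the segment inside B.
  let L : ℝ → Spacetime := fun t => u + t • (v - u)
  have hL : ∀ t, HasDerivAt L (v - u) t := fun t => by
    have := ((hasDerivAt_id t).smul_const (v - u)).const_add u
    rwa [one_smul] at this
  have hLc : Continuous L := by fun_prop
  have hS : IsOpen (L ⁻¹' B) := hB.preimage hLc
  have hSc : Convex ℝ (L ⁻¹' B) := by
    intro t ht t' ht' a b ha hb hab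
    have : L (a • t + b • t') = a • L t + b • L t' := by
      ext i
      simp only [L, smul_eq_mul, Pi.add_apply, Pi.smul_apply, Pi.sub_apply]
      linear_combination -(u i) * hab
    rw [Set.mem_preimage, this]
    exact hc ht ht' ha hb hab
  have h0 : L 0 = u := by simp [L]
  have h1 : L 1 = v := by simp [L]
  have hd : ∀ t ∈ L ⁻¹' B, HasDerivAt (f ∘ L) 0 t := by
    intro t ht
    have hfd := (hf.differentiableAt (hB.mem_nhds ht)).hasFDerivAt
    have := hfd.comp_hasDerivAt t (hL t)
    rw [fderiv_eq_sum_pd, Finset.sum_eq_zero] at this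
    · exact this
    · intro ν _
      by_cases hν : ν = k
      · subst hν; simp [huv]
      · rw [h _ ht ν hν, smul_zero]
  have := hS.is_const_of_deriv_eq_zero hSc.isPreconnected
    (fun t ht => (hd t ht).differentiableAt.differentiableWithinAt) (fun t ht => (hd t ht).deriv)
    (x := 0) (y := 1) (by simpa [h0] using hu) (by simpa [h1] using hv)
  simpa [h0, h1] using this

/-! ### Potentials depending on one coordinate and their symmetry operators. -/

namespace SepChart

variable {C : SepChart} {κ : SetKind} {I : Fin 3 → Set ℝ} {a : Fin 3 → ℝ → ℝ} {x : Spacetime}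

/-- The set of coordinate triples of a box. -/
def box (I : Fin 3 → Set ℝ) : Set Spacetime := {u | ∀ ν, u ν ∈ I ν}

theorem IsBox.isOpen_box (hI : C.IsBox I) : IsOpen (box I) := by
  have : box I = Set.univ.pi I := by ext u; simp [box]
  rw [this]
  exact isOpen_set_pi Set.finite_univ fun ν _ => (hI.1 ν).1

theorem IsBox.convex_box (hI : C.IsBox I) : Convex ℝ (box I) := by
  have : box I = Set.univ.pi I := by ext u; simp [box]
  rw [this]
  exact convex_pi fun ν _ => (hI.1 ν).2.1.convex

theorem IsBox.nonempty_box (hI : C.IsBox I) : (box I).Nonempty :=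
  ⟨fun ν => (hI.1 ν).2.2.some, fun ν => (hI.1 ν).2.2.some_mem⟩

theorem IsAdapted.coord_mem (hC : C.IsAdapted κ) (hx : x ∈ C.source) : C.coord x ∈ C.target :=
  (hC.2.2.1 x hx).1

theorem IsAdapted.inv_coord (hC : C.IsAdapted κ) (hx : x ∈ C.source) : C.inv (C.coord x) = x :=
  (hC.2.2.1 x hx).2

theorem IsAdapted.coord_box (hx : x ∈ C.region I) : C.coord x ∈ box I := hx.2

theorem IsAdapted.coord_inv (hC : C.IsAdapted κ) (hI : C.IsBox I) {u : Spacetime}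
    (hu : u ∈ box I) : C.coord (C.inv u) = u := (hC.2.2.2.1 u (hI.2 u hu)).2

theorem IsAdapted.inv_region (hC : C.IsAdapted κ) (hI : C.IsBox I) {u : Spacetime}
    (hu : u ∈ box I) : C.inv u ∈ C.region I :=
  ⟨(hC.2.2.2.1 u (hI.2 u hu)).1, fun ν => by rw [hC.coord_inv hI hu]; exact hu ν⟩

theorem IsAdapted.isOpen_region (hC : C.IsAdapted κ) (hI : C.IsBox I) : IsOpen (C.region I) := by
  have : C.region I = C.source ∩ C.coord ⁻¹' box I := rfl
  rw [this]
  exact hC.2.2.2.2.1.continuousOn.isOpen_inter_preimage hC.1 hI.isOpen_box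

theorem IsAdapted.contDiffAt_coord (hC : C.IsAdapted κ) (hx : x ∈ C.source) :
    ContDiffAt ℝ ∞ C.coord x := hC.2.2.2.2.1.contDiffAt (hC.1.mem_nhds hx)

theorem IsAdapted.contDiffOn_inv (hC : C.IsAdapted κ) (hI : C.IsBox I) :
    ContDiffOn ℝ ∞ C.inv (box I) := hC.2.2.2.2.2.1.mono fun u hu => hI.2 u hu

theorem IsAdapted.contDiffOn_coord (hC : C.IsAdapted κ) :
    ContDiffOn ℝ ∞ C.coord (C.region I) := hC.2.2.2.2.1.mono fun _ h => h.1

theorem IsAdapted.killing_coord (hC : C.IsAdapted κ) (hx : x ∈ C.source) (j : Fin 2) (ν : Fin 3) :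
    ∑ μ, κ.killing j x μ * pd μ (fun y => C.coord y ν) x = if ν = C.ign j then 1 else 0 :=
  hC.2.2.2.2.2.2.2 x hx j ν

theorem index_cases {p : Fin 3} {q : Fin 2 → Fin 3} (h : ∀ ν : Fin 3, ν = p ∨ ν = q 0 ∨ ν = q 1) :
    q 0 ≠ q 1 ∧ p ≠ q 0 ∧ p ≠ q 1 := by
  have h0 := h 0; have h1 := h 1; have h2 := h 2
  generalize q 0 = b at *
  generalize q 1 = c at *
  clear h
  revert p b c
  decide

theorem IsAdapted.ign_ne (hC : C.IsAdapted κ) : C.ign 0 ≠ C.ign 1 :=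
  (index_cases hC.2.2.2.2.2.2.1).1

theorem IsAdapted.sep_ne (hC : C.IsAdapted κ) (j : Fin 2) : C.sep ≠ C.ign j := by
  fin_cases j
  exacts [(index_cases hC.2.2.2.2.2.2.1).2.1, (index_cases hC.2.2.2.2.2.2.1).2.2]

theorem IsAdapted.exists_ign (hC : C.IsAdapted κ) {ν : Fin 3} (h : ν ≠ C.sep) :
    ∃ j, ν = C.ign j := by
  rcases hC.2.2.2.2.2.2.1 ν with h1 | h1 | h1
  exacts [absurd h1 h, ⟨0, h1⟩, ⟨1, h1⟩]

theorem IsAdapted.sum_eq (hC : C.IsAdapted κ) {M : Type*} [AddCommMonoid M] (f : Fin 3 → M) :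
    ∑ ν, f ν = f C.sep + ∑ j, f (C.ign j) := by
  have h : (Finset.univ : Finset (Fin 3)) = {C.sep, C.ign 0, C.ign 1} := by
    ext ν; simpa using hC.2.2.2.2.2.2.1 ν
  rw [h, Finset.sum_insert, Finset.sum_insert, Finset.sum_singleton, Fin.sum_univ_two]
  · simpa using hC.ign_ne
  · simpa using ⟨hC.sep_ne 0, hC.sep_ne 1⟩

theorem IsAdapted.differentiableAt_coord (hC : C.IsAdapted κ) (hx : x ∈ C.source) (ν : Fin 3) :
    DifferentiableAt ℝ (fun y => C.coord y ν) x :=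
  differentiableAt_pi.1 ((hC.contDiffAt_coord hx).differentiableAt (by simp)) ν

theorem IsAdapted.contDiffAt_comp_sep (hC : C.IsAdapted κ) (hI : C.IsBox I) {b : ℝ → ℝ}
    (hb : ContDiffOn ℝ ∞ b (I C.sep)) (hx : x ∈ C.region I) :
    ContDiffAt ℝ ∞ (fun y => b (C.coord y C.sep)) x :=
  ContDiffAt.comp x (hb.contDiffAt ((hI.1 C.sep).1.mem_nhds (hx.2 C.sep)))
    (contDiffAt_pi.1 (hC.contDiffAt_coord hx.1) C.sep)

theorem IsAdapted.contDiffOn_potential (hC : C.IsAdapted κ) (hI : C.IsBox I)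
    (ha : ∀ ν, ContDiffOn ℝ ∞ (a ν) (I C.sep)) :
    ContDiffOn ℝ ∞ (C.potential a) (C.region I) := fun x hx => by
  refine (contDiffAt_pi.2 fun α => ?_).contDiffWithinAt
  exact ContDiffAt.sum fun ν _ => (contDiffAt_pd (m := ∞)
    (contDiffAt_pi.1 (hC.contDiffAt_coord hx.1) ν) (by simp) α).mul
    (hC.contDiffAt_comp_sep hI (ha ν) hx)

theorem IsAdapted.pd_potential (hC : C.IsAdapted κ) (hI : C.IsBox I)
    (ha : ∀ ν, ContDiffOn ℝ ∞ (a ν) (I C.sep)) (hx : x ∈ C.region I) (μ α : Fin 3) :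
    pd μ (fun y => C.potential a y α) x = ∑ ν, (pd μ (pd α fun y => C.coord y ν) x *
      a ν (C.coord x C.sep) + pd α (fun y => C.coord y ν) x *
        (pd μ (fun y => C.coord y C.sep) x * deriv (a ν) (C.coord x C.sep))) := by
  have h1 : ∀ ν, DifferentiableAt ℝ (pd α fun y => C.coord y ν) x := fun ν =>
    (contDiffAt_pd (m := ∞) (contDiffAt_pi.1 (hC.contDiffAt_coord hx.1) ν) (by simp)
      α).differentiableAt (by simp)
  have h2 : ∀ ν, DifferentiableAt ℝ (fun y => a ν (C.coord y C.sep)) x := fun ν =>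
    (hC.contDiffAt_comp_sep hI (ha ν) hx).differentiableAt (by simp)
  unfold potential
  rw [pd_sum fun ν _ => (h1 ν).fun_mul (h2 ν)]
  refine Finset.sum_congr rfl fun ν _ => ?_
  rw [pd_mul (h1 ν) (h2 ν), pd_comp_real (g := a ν) (c := fun y => C.coord y C.sep)
    (((ha ν).contDiffAt ((hI.1 C.sep).1.mem_nhds (hx.2 C.sep))).differentiableAt (by simp))
    (hC.differentiableAt_coord hx.1 C.sep), smul_eq_mul]

/-- This is d(a_ν(τ) du_ν) = a_ν' dτ ∧ du_ν; the second derivatives of the coordinates cancel. -/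
theorem IsAdapted.fieldStrength_potential (hC : C.IsAdapted κ) (hI : C.IsBox I)
    (ha : ∀ ν, ContDiffOn ℝ ∞ (a ν) (I C.sep)) (hx : x ∈ C.region I) (μ α : Fin 3) :
    fieldStrength (C.potential a) μ α x = ∑ ν, deriv (a ν) (C.coord x C.sep) *
      (pd μ (fun y => C.coord y C.sep) x * pd α (fun y => C.coord y ν) x -
        pd α (fun y => C.coord y C.sep) x * pd μ (fun y => C.coord y ν) x) := by
  rw [fieldStrength, hC.pd_potential hI ha hx, hC.pd_potential hI ha hx, ← Finset.sum_sub_distrib]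
  refine Finset.sum_congr rfl fun ν _ => ?_
  rw [pd_comm ((contDiffAt_pi.1 (hC.contDiffAt_coord hx.1) ν).of_le two_le_infty) μ α]
  ring

/-- The field η_j pairs to zero with dτ and to one or zero with the other differentials, so a single
term survives. The result is the gradient of a_{v_j}(τ), which is why that function can serve as the
scalar part. -/
theorem IsAdapted.fieldStrength_killing (hC : C.IsAdapted κ) (hI : C.IsBox I)
    (ha : ∀ ν, ContDiffOn ℝ ∞ (a ν) (I C.sep)) (hx : x ∈ C.region I) (μ : Fin 3) (j : Fin 2) :
    ∑ α, fieldStrength (C.potential a) μ α x * κ.killing j x α =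
      pd μ (fun y => C.coord y C.sep) x * deriv (a (C.ign j)) (C.coord x C.sep) := by
  have h1 : ∑ α, fieldStrength (C.potential a) μ α x * κ.killing j x α =
      ∑ ν, deriv (a ν) (C.coord x C.sep) * (pd μ (fun y => C.coord y C.sep) x *
        (∑ α, κ.killing j x α * pd α (fun y => C.coord y ν) x) -
        (∑ α, κ.killing j x α * pd α (fun y => C.coord y C.sep) x) *
          pd μ (fun y => C.coord y ν) x) := by
    simp only [hC.fieldStrength_potential hI ha hx, Fin.sum_univ_three]
    ring
  rw [h1]
  simp only [hC.killing_coord hx.1, hC.sep_ne j, if_false, zero_mul, sub_zero, mul_ite, mul_one,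
    mul_zero, Finset.sum_ite_eq', Finset.mem_univ, if_true]
  ring

theorem IsAdapted.isSpinSymmetry (hC : C.IsAdapted κ) (hI : C.IsBox I)
    (ha : ∀ ν, ContDiffOn ℝ ∞ (a ν) (I C.sep)) (s : ℝ) (j : Fin 2) :
    IsSpinSymmetry s (C.potential a) (C.region I) (C.operators s κ a j)
      (fun y => (a (C.ign j) (C.coord y C.sep) : ℂ)) where
  smooth_xi := (κ.contDiff_killing j).contDiffOn
  smooth_phi := fun x hx => (Complex.ofRealCLM.contDiff.contDiffAt.comp x
    (hC.contDiffAt_comp_sep hI (ha (C.ign j)) hx)).contDiffWithinAt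
  killing := fun x _ => κ.killingAt j x
  chi_eq := fun _ _ => rfl
  pd_phi := fun x hx μ => by
    rw [pd_ofReal ((hC.contDiffAt_comp_sep hI (ha (C.ign j)) hx).differentiableAt (by simp)),
      pd_comp_real (g := a (C.ign j)) (c := fun y => C.coord y C.sep)
      (((ha _).contDiffAt ((hI.1 C.sep).1.mem_nhds (hx.2 C.sep))).differentiableAt (by simp))
      (hC.differentiableAt_coord hx.1 C.sep), smul_eq_mul]
    exact congrArg _ (hC.fieldStrength_killing hI ha hx μ j).symm

theorem operators_chi (C : SepChart) (s : ℝ) (κ : SetKind) (a : Fin 3 → ℝ → ℝ) (j : Fin 2)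
    (x : Spacetime) : (C.operators s κ a j).chi x =
      (a (C.ign j) (C.coord x C.sep) : ℂ) • (1 : Mat2) + κ.spin s j :=
  κ.spinMat_killing s j (fun y => (a (C.ign j) (C.coord y C.sep) : ℂ)) x

/-- The operators commute because the fields do, because F(η₁, η₂) contains the factor dτ(η₁) = 0,
and because the spin matrix of the first field is zero. -/
theorem IsAdapted.isCompleteSet (hC : C.IsAdapted κ) (hI : C.IsBox I)
    (ha : ∀ ν, ContDiffOn ℝ ∞ (a ν) (I C.sep)) {s m : ℝ} (hs : s = 1 ∨ s = -1) :
    IsCompleteSet s m (C.potential a) (C.region I) (C.operators s κ a) := by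
  have hU := hC.isOpen_region hI
  have hA := hC.contDiffOn_potential hI ha
  refine ⟨fun j => (hC.isSpinSymmetry hI ha s j).isSymmetry hs hU hA, ?_, ?_⟩
  · intro ψ hψ x hx
    refine (commute_iff hU hA (hC.isSpinSymmetry hI ha s 0) (hC.isSpinSymmetry hI ha s 1) hx).2
      ⟨fun μ => ?_, ?_, ?_⟩ ψ hψ
    · change ∑ ν, (κ.killing 0 x ν * pd ν (fun y => κ.killing 1 y μ) x -
        κ.killing 1 x ν * pd ν (fun y => κ.killing 0 y μ) x) = 0
      simp only [κ.pd_killing, κ.grad_first, Pi.zero_apply, mul_zero, sub_zero, κ.bracket]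
    · change ∑ ν, ∑ μ, fieldStrength (C.potential a) ν μ x * κ.killing 0 x ν * κ.killing 1 x μ = 0
      have : ∀ ν, ∑ μ, fieldStrength (C.potential a) ν μ x * κ.killing 0 x ν * κ.killing 1 x μ =
          κ.killing 0 x ν * pd ν (fun y => C.coord y C.sep) x *
            deriv (a (C.ign 1)) (C.coord x C.sep) := by
        intro ν
        rw [mul_assoc, ← hC.fieldStrength_killing hI ha hx ν 1, Finset.mul_sum]
        exact Finset.sum_congr rfl fun _ _ => by ring
      simp only [this, ← Finset.sum_mul, hC.killing_coord hx.1, hC.sep_ne 0, if_false, zero_mul]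
    · simp only [operators_chi, κ.spin_first, add_zero, Matrix.smul_mul, Matrix.mul_smul,
        Matrix.one_mul, Matrix.mul_one]
  · intro c hc j
    obtain ⟨u, hu⟩ := hI.nonempty_box
    have hx := hC.inv_region hI hu
    have h := hc _ hx
    -- Pairing the linear relation with du_{v_j} isolates the coefficient c_j.
    have h2 : ∑ k, c k * (∑ μ, κ.killing k (C.inv u) μ *
        pd μ (fun y => C.coord y (C.ign j)) (C.inv u)) = 0 := by
      have h3 : ∀ μ, ∑ k, c k * κ.killing k (C.inv u) μ = 0 := fun μ => by
        simpa [operators, symOp] using congrFun h μ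
      calc _ = ∑ μ, (∑ k, c k * κ.killing k (C.inv u) μ) *
            pd μ (fun y => C.coord y (C.ign j)) (C.inv u) := by
            simp only [Fin.sum_univ_two, Fin.sum_univ_three]; ring
        _ = 0 := by simp [h3]
    simp only [hC.killing_coord hx.1] at h2
    have hne := hC.ign_ne
    fin_cases j <;> simpa [hne, hne.symm] using h2

/-! ### Separation of variables -/

/-- The matrix `γ^α ∂_α u_ν`. -/
def coordGam (C : SepChart) (s : ℝ) (ν : Fin 3) (x : Spacetime) : Mat2 :=
  ∑ α, ((pd α (fun y => C.coord y ν) x : ℝ) : ℂ) • gam s α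

/-- The properties of the frame matrix which make the Dirac equation separate. -/
structure IsFrame (C : SepChart) (s : ℝ) (κ : SetKind) : Prop where
  smooth : ∀ i j, ContDiffOn ℝ ∞ (fun u => C.frame u i j) C.target
  unit : ∀ u ∈ C.target, IsUnit (C.frame u)
  -- Differentiating N along v_j, times i, cancels the spin matrix in X_j.
  ign : ∀ j, ∀ u ∈ C.target, mpd (C.ign j) C.frame u = Complex.I • (κ.spin s j * C.frame u)
  gSep : ∀ x ∈ C.source, C.coordGam s C.sep x * C.frame (C.coord x) =
    C.frame (C.coord x) * C.gSep (C.coord x C.sep)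
  gIgn : ∀ x ∈ C.source, ∀ j, C.coordGam s (C.ign j) x * C.frame (C.coord x) =
    C.frame (C.coord x) * C.gIgn j (C.coord x C.sep)
  -- The left side collects all the terms of HNχ in which N is differentiated; the derivatives along
  -- v_j have already been replaced by spin matrices, hence the minus sign.
  gZero : ∀ x ∈ C.source, Complex.I • (C.coordGam s C.sep x * mpd C.sep C.frame (C.coord x)) -
    ∑ j, C.coordGam s (C.ign j) x * (κ.spin s j * C.frame (C.coord x)) =
      C.frame (C.coord x) * C.gZero (C.coord x C.sep)

/-- The field `exp(-i λ₁ v₁ - i λ₂ v₂) N χ` in the coordinates `u`. -/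
def assemble (C : SepChart) (lam : Fin 2 → ℂ) (χ : Spacetime → Spinor) (u : Spacetime) : Spinor :=
  Complex.exp (-Complex.I * ∑ j, lam j * (u (C.ign j) : ℂ)) • (C.frame u *ᵥ χ u)

theorem separated_eq_assemble (lam : Fin 2 → ℂ) (χ : ℝ → Spinor) (x : Spacetime) :
    C.separated lam χ x = C.assemble lam (fun u => χ (u C.sep)) (C.coord x) := rfl

theorem contDiff_phase (C : SepChart) (lam : Fin 2 → ℂ) :
    ContDiff ℝ ∞ fun u : Spacetime => -Complex.I * ∑ j, lam j * (u (C.ign j) : ℂ) :=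
  contDiff_const.mul (ContDiff.sum fun j _ => contDiff_const.mul
    (Complex.ofRealCLM.contDiff.comp (contDiff_apply ℝ ℝ (C.ign j))))

theorem pd_phase (lam : Fin 2 → ℂ) (u : Spacetime) (ν : Fin 3) :
    pd ν (fun u : Spacetime => Complex.exp (-Complex.I * ∑ j, lam j * (u (C.ign j) : ℂ))) u =
      (-Complex.I * ∑ j, lam j * (if ν = C.ign j then 1 else 0)) *
        Complex.exp (-Complex.I * ∑ j, lam j * (u (C.ign j) : ℂ)) := by
  have hd : ∀ j, DifferentiableAt ℝ (fun u : Spacetime => (u (C.ign j) : ℂ)) u := fun j =>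
    Complex.ofRealCLM.differentiableAt.comp u (differentiableAt_apply (C.ign j) u)
  have h0 : pd ν (fun u : Spacetime => -Complex.I * ∑ j, lam j * (u (C.ign j) : ℂ)) u =
      -Complex.I * ∑ j, lam j * (if ν = C.ign j then 1 else 0) := by
    rw [pd_mul_complex (differentiableAt_const _)
      (DifferentiableAt.fun_sum fun j _ => (hd j).const_mul _),
      pd_sum fun j _ => (hd j).const_mul _, pd_const, zero_mul, zero_add]
    congr 1
    refine Finset.sum_congr rfl fun j _ => ?_
    rw [pd_mul_complex (differentiableAt_const _) (hd j),
      pd_ofReal (f := fun u : Spacetime => u (C.ign j)) (differentiableAt_apply (C.ign j) u),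
      pd_coord, pd_const]
    split_ifs <;> simp
  have h1 := (((C.contDiff_phase lam).differentiable (by simp)) u).hasFDerivAt.cexp
  have h2 := pd_eq_of_hasFDerivAt h1 ν
  rw [h2, ← h0]
  exact mul_comm _ _

theorem differentiableAt_phase (lam : Fin 2 → ℂ) (u : Spacetime) :
    DifferentiableAt ℝ
      (fun u : Spacetime => Complex.exp (-Complex.I * ∑ j, lam j * (u (C.ign j) : ℂ))) u :=
  (((C.contDiff_phase lam).differentiable (by simp)) u).cexp

section Frame

variable {s m : ℝ} {lam : Fin 2 → ℂ} {χ : Spacetime → Spinor}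

theorem IsFrame.mdiff (hC : C.IsAdapted κ) (hF : C.IsFrame s κ) {u : Spacetime}
    (hu : u ∈ C.target) : MDiff C.frame u := fun i j =>
  ((hF.smooth i j).contDiffAt (hC.2.1.mem_nhds hu)).differentiableAt (by simp)

theorem IsFrame.differentiableAt_assemble (hC : C.IsAdapted κ) (hF : C.IsFrame s κ) {u : Spacetime}
    (hu : u ∈ C.target) (hχ : DifferentiableAt ℝ χ u) :
    DifferentiableAt ℝ (C.assemble lam χ) u :=
  (differentiableAt_phase lam u).fun_smul (differentiableAt_mulVec (hF.mdiff hC hu) hχ)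

theorem IsFrame.pd_assemble (hC : C.IsAdapted κ) (hF : C.IsFrame s κ) {u : Spacetime}
    (hu : u ∈ C.target) (hχ : DifferentiableAt ℝ χ u) (ν : Fin 3) :
    pd ν (C.assemble lam χ) u = Complex.exp (-Complex.I * ∑ j, lam j * (u (C.ign j) : ℂ)) •
      ((-Complex.I * ∑ j, lam j * (if ν = C.ign j then 1 else 0)) • (C.frame u *ᵥ χ u) +
        mpd ν C.frame u *ᵥ χ u + C.frame u *ᵥ pd ν χ u) := by
  have hN := hF.mdiff hC hu
  have e : C.assemble lam χ = fun u => Complex.exp (-Complex.I * ∑ j, lam j * (u (C.ign j) : ℂ)) •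
    (C.frame u *ᵥ χ u) := rfl
  rw [e, pd_smul (differentiableAt_phase lam u) (differentiableAt_mulVec hN hχ),
    pd_mulVec hN hχ, pd_phase]
  module

theorem IsAdapted.mom_comp (hC : C.IsAdapted κ) {g : Spacetime → Spinor} (hx : x ∈ C.source)
    (hg : DifferentiableAt ℝ g (C.coord x)) (α : Fin 3) :
    mom (C.potential a) α (fun y => g (C.coord y)) x =
      ∑ ν, ((pd α (fun y => C.coord y ν) x : ℝ) : ℂ) •
        (Complex.I • pd ν g (C.coord x) - (a ν (C.coord x C.sep) : ℂ) • g (C.coord x)) := by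
  rw [mom, pd_comp hg ((hC.contDiffAt_coord hx).differentiableAt (by simp))]
  simp only [Fin.sum_univ_three, potential]
  push_cast
  simp only [← Complex.coe_smul]
  module

/-- In the coordinates X_j is i∂_{v_j} plus the spin matrix, as its scalar part cancels the
potential. The phase contributes λ_j and the derivative of N cancels the spin matrix, so the
eigenvalue equation says that χ does not depend on v_j. -/
theorem IsFrame.act_assemble (hC : C.IsAdapted κ) (hF : C.IsFrame s κ)
    (hx : x ∈ C.source) (hχ : DifferentiableAt ℝ χ (C.coord x)) (j : Fin 2) :
    (C.operators s κ a j).act (C.potential a) (fun y => C.assemble lam χ (C.coord y)) x =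
      lam j • C.assemble lam χ (C.coord x) +
        (Complex.I * Complex.exp (-Complex.I * ∑ j, lam j * (C.coord x (C.ign j) : ℂ))) •
          (C.frame (C.coord x) *ᵥ pd (C.ign j) χ (C.coord x)) := by
  have hu := hC.coord_mem hx
  have hg := hF.differentiableAt_assemble (lam := lam) hC hu hχ
  have h1 : ∑ α, (κ.killing j x α : ℂ) •
      mom (C.potential a) α (fun y => C.assemble lam χ (C.coord y)) x =
      ∑ ν, ((∑ α, κ.killing j x α * pd α (fun y => C.coord y ν) x : ℝ) : ℂ) •
        (Complex.I • pd ν (C.assemble lam χ) (C.coord x) -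
          (a ν (C.coord x C.sep) : ℂ) • C.assemble lam χ (C.coord x)) := by
    simp only [hC.mom_comp hx hg, Fin.sum_univ_three]
    push_cast
    module
  simp only [hC.killing_coord hx] at h1
  have h2 : ∀ v : Fin 3 → Spinor,
      ∑ ν, (((if ν = C.ign j then (1 : ℝ) else 0) : ℝ) : ℂ) • v ν = v (C.ign j) := by
    intro v
    rw [Finset.sum_eq_single (C.ign j)] <;> simp +contextual
  have hchi : (C.operators s κ a j).chi x =
      (a (C.ign j) (C.coord x C.sep) : ℂ) • (1 : Mat2) + κ.spin s j := operators_chi C s κ a j x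
  have h3 : ∑ k, lam k * (if C.ign j = C.ign k then (1 : ℂ) else 0) = lam j := by
    have hne := hC.ign_ne
    fin_cases j <;> simp [hne, hne.symm]
  rw [FirstOrder.act, hchi]
  change (∑ α, (κ.killing j x α : ℂ) • mom (C.potential a) α _ x) + _ = _
  rw [h1, h2, hF.pd_assemble hC hu hχ, hF.ign j _ hu, h3, assemble]
  simp only [Matrix.add_mulVec, Matrix.smul_mulVec, Matrix.one_mulVec, Matrix.mulVec_smul,
    ← Matrix.mulVec_mulVec, smul_add, smul_smul]
  rw [← sub_eq_zero]
  set E := Complex.exp (-Complex.I * ∑ j, lam j * (C.coord x (C.ign j) : ℂ))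
  have hI : Complex.I * Complex.I = -1 := Complex.I_mul_I
  have e1 : Complex.I * (E * (-Complex.I * lam j)) = E * lam j := by
    linear_combination -(E * lam j) * hI
  have e2 : Complex.I * (E * Complex.I) = -E := by linear_combination E * hI
  rw [e1, e2]
  module

/-- The relations γ^α ∂_α u_ν N = N G_ν let N be pulled out on the left; the terms from its
derivatives assemble to Z. -/
theorem IsFrame.dirac_assemble (hC : C.IsAdapted κ) (hF : C.IsFrame s κ)
    (hx : x ∈ C.source) (hχ : DifferentiableAt ℝ χ (C.coord x)) :
    dirac s m (C.potential a) (fun y => C.assemble lam χ (C.coord y)) x =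
      Complex.exp (-Complex.I * ∑ j, lam j * (C.coord x (C.ign j) : ℂ)) •
        (C.frame (C.coord x) *ᵥ
          (C.gSep (C.coord x C.sep) *ᵥ (Complex.I • pd C.sep χ (C.coord x) -
              (a C.sep (C.coord x C.sep) : ℂ) • χ (C.coord x)) +
            (∑ j, C.gIgn j (C.coord x C.sep) *ᵥ (Complex.I • pd (C.ign j) χ (C.coord x) +
              (lam j - (a (C.ign j) (C.coord x C.sep) : ℂ)) • χ (C.coord x))) +
            C.gZero (C.coord x C.sep) *ᵥ χ (C.coord x) - (m : ℂ) • χ (C.coord x))) := by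
  have hu := hC.coord_mem hx
  have hg := hF.differentiableAt_assemble (lam := lam) hC hu hχ
  have h1 : ∑ α, gam s α *ᵥ mom (C.potential a) α (fun y => C.assemble lam χ (C.coord y)) x =
      ∑ ν, C.coordGam s ν x *ᵥ (Complex.I • pd ν (C.assemble lam χ) (C.coord x) -
          (a ν (C.coord x C.sep) : ℂ) • C.assemble lam χ (C.coord x)) := by
    simp only [hC.mom_comp hx hg, Fin.sum_univ_three, coordGam, Matrix.mulVec_add,
      Matrix.add_mulVec, Matrix.mulVec_smul, Matrix.smul_mulVec]
    module
  have h3 : ∀ j, ∑ k, lam k * (if C.ign j = C.ign k then (1 : ℂ) else 0) = lam j := by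
    intro j
    have hne := hC.ign_ne
    fin_cases j <;> simp [hne, hne.symm]
  have h4 : ∑ k, lam k * (if C.sep = C.ign k then (1 : ℂ) else 0) = 0 := by
    simp [hC.sep_ne]
  rw [dirac, h1, hC.sum_eq]
  simp only [hF.pd_assemble hC hu hχ, hF.ign _ _ hu, h3, h4]
  have hz := congrArg (fun M => M *ᵥ χ (C.coord x)) (hF.gZero x hx)
  simp only [Matrix.sub_mulVec, Fin.sum_univ_two, Matrix.add_mulVec, Matrix.smul_mulVec,
    ← Matrix.mulVec_mulVec] at hz
  have hs0 : ∀ v, C.frame (C.coord x) *ᵥ C.gSep (C.coord x C.sep) *ᵥ v =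
      C.coordGam s C.sep x *ᵥ C.frame (C.coord x) *ᵥ v := fun v => by
    rw [Matrix.mulVec_mulVec, Matrix.mulVec_mulVec, hF.gSep x hx]
  have hi0 : ∀ j v, C.frame (C.coord x) *ᵥ C.gIgn j (C.coord x C.sep) *ᵥ v =
      C.coordGam s (C.ign j) x *ᵥ C.frame (C.coord x) *ᵥ v := fun j v => by
    rw [Matrix.mulVec_mulVec, Matrix.mulVec_mulVec, hF.gIgn x hx]
  simp only [Fin.sum_univ_two, Matrix.mulVec_add, Matrix.mulVec_sub, Matrix.mulVec_smul, hs0, hi0,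
    ← hz, assemble, Matrix.smul_mulVec, ← Matrix.mulVec_mulVec, smul_add, smul_sub, smul_smul]
  set E := Complex.exp (-Complex.I * (lam 0 * (C.coord x (C.ign 0) : ℂ) +
    lam 1 * (C.coord x (C.ign 1) : ℂ)))
  have hI : Complex.I * Complex.I = -1 := Complex.I_mul_I
  have e1 : ∀ j, Complex.I * (E * (-Complex.I * lam j)) = E * lam j := fun j => by
    linear_combination -(E * lam j) * hI
  have e2 : Complex.I * (E * Complex.I) = -E := by linear_combination E * hI
  rw [e1, e1, e2]
  module

theorem _root_.DiracSep.act_congr {A : Spacetime → Fin 3 → ℝ} {X : FirstOrder}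
    {f g : Spacetime → Spinor} {U : Set Spacetime} (hU : IsOpen U) (h : ∀ y ∈ U, f y = g y)
    (hx : x ∈ U) : X.act A f x = X.act A g x := by
  simp only [FirstOrder.act, mom_congr hU h hx, h x hx]

theorem _root_.DiracSep.dirac_congr {A : Spacetime → Fin 3 → ℝ}
    {f g : Spacetime → Spinor} {U : Set Spacetime} (hU : IsOpen U) (h : ∀ y ∈ U, f y = g y)
    (hx : x ∈ U) : dirac s m A f x = dirac s m A g x := by
  simp only [dirac, mom_congr hU h hx, h x hx]

theorem _root_.DiracSep.mulVec_eq_zero_of_isUnit {M : Mat2} (hM : IsUnit M) {v : Spinor}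
    (h : M *ᵥ v = 0) : v = 0 :=
  Matrix.mulVec_injective_of_isUnit hM (by rw [h, Matrix.mulVec_zero])

theorem _root_.DiracSep.coe_ne_zero_of_one_le {n : ℕ∞} (hn : 1 ≤ n) : (n : WithTop ℕ∞) ≠ 0 := by
  intro h
  have h0 : n = 0 := by exact_mod_cast h
  simp [h0] at hn

theorem _root_.DiracSep.coe_le_infty (n : ℕ∞) : (n : WithTop ℕ∞) ≤ ∞ :=
  WithTop.coe_le_coe.2 (OrderTop.le_top n)

/-- The phase and N are invertible, so any ψ is an assembled field for a unique coefficient. The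
eigenvalue equations make this coefficient constant along v₁ and v₂, hence on the convex box a
function of τ, and the Dirac equation is then the ordinary differential system multiplied by an
invertible matrix. -/
theorem IsFrame.jointSystem_iff (hC : C.IsAdapted κ) (hF : C.IsFrame s κ) (hI : C.IsBox I)
    {n : ℕ∞} (hn : 1 ≤ n) {ψ : Spacetime → Spinor} (hψ : ContDiffOn ℝ n ψ (C.region I)) :
    JointSystem s m (C.potential a) (C.operators s κ a) lam (C.region I) ψ ↔
      ∃ χ : ℝ → Spinor, ContDiffOn ℝ n χ (I C.sep) ∧
        C.SeparatedODE m a lam (I C.sep) χ ∧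
        ∀ x ∈ C.region I, ψ x = C.separated lam χ x := by
  have hU := hC.isOpen_region hI
  have hn0 := coe_ne_zero_of_one_le hn
  have hode : ∀ χ : ℝ → Spinor, DifferentiableOn ℝ χ (I C.sep) → ∀ x ∈ C.region I,
      (∀ j, (C.operators s κ a j).act (C.potential a) (C.separated lam χ) x =
        lam j • C.separated lam χ x) ∧
      dirac s m (C.potential a) (C.separated lam χ) x =
        Complex.exp (-Complex.I * ∑ j, lam j * (C.coord x (C.ign j) : ℂ)) •
        (C.frame (C.coord x) *ᵥ
          (C.gSep (C.coord x C.sep) *ᵥ (Complex.I • deriv χ (C.coord x C.sep) -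
              (a C.sep (C.coord x C.sep) : ℂ) • χ (C.coord x C.sep)) +
            (∑ j, (lam j - (a (C.ign j) (C.coord x C.sep) : ℂ)) •
              (C.gIgn j (C.coord x C.sep) *ᵥ χ (C.coord x C.sep))) +
            C.gZero (C.coord x C.sep) *ᵥ χ (C.coord x C.sep) -
              (m : ℂ) • χ (C.coord x C.sep))) := by
    intro χ hχ x hx
    have hd : DifferentiableAt ℝ χ (C.coord x C.sep) :=
      hχ.differentiableAt ((hI.1 C.sep).1.mem_nhds (hx.2 C.sep))
    have hd' : DifferentiableAt ℝ (fun u : Spacetime => χ (u C.sep)) (C.coord x) :=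
      DifferentiableAt.comp (C.coord x) hd (differentiableAt_apply C.sep _)
    have hp : ∀ ν, pd ν (fun u : Spacetime => χ (u C.sep)) (C.coord x) =
        if ν = C.sep then deriv χ (C.coord x C.sep) else 0 := fun ν => by
      rw [pd_comp_real (c := fun u : Spacetime => u C.sep) hd (differentiableAt_apply C.sep _),
        pd_coord]
      split_ifs <;> simp
    have hs : C.separated lam χ = fun y => C.assemble lam (fun u => χ (u C.sep)) (C.coord y) := rfl
    refine ⟨fun j => ?_, ?_⟩
    · rw [hs, hF.act_assemble hC hx.1 hd', hp, if_neg (hC.sep_ne j).symm]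
      simp
    · rw [hs, hF.dirac_assemble hC hx.1 hd', hp, if_pos rfl]
      simp only [hp, (hC.sep_ne _).symm, if_false, smul_zero, zero_add, Matrix.mulVec_smul]
  constructor
  · intro h
    let φ : Spacetime → Spinor := fun u =>
      Complex.exp (Complex.I * ∑ j, lam j * (u (C.ign j) : ℂ)) • ((C.frame u)⁻¹ *ᵥ ψ (C.inv u))
    have hB := hI.isOpen_box
    have hdet : ∀ u ∈ box I, (C.frame u).det ≠ 0 := fun u hu =>
      isUnit_iff_ne_zero.1 ((Matrix.isUnit_iff_isUnit_det _).1 (hF.unit u (hI.2 u hu)))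
    have hsm : ∀ i j, ContDiffOn ℝ ∞ (fun u => C.frame u i j) (box I) := fun i j =>
      (hF.smooth i j).mono fun u hu => hI.2 u hu
    have hinv : ∀ i j, ContDiffOn ℝ ∞ (fun u => (C.frame u)⁻¹ i j) (box I) := by
      have hd : ContDiffOn ℝ ∞ (fun u => (C.frame u).det⁻¹) (box I) := by
        refine ContDiffOn.inv ?_ hdet
        simp only [Matrix.det_fin_two]
        exact ((hsm 0 0).mul (hsm 1 1)).sub ((hsm 0 1).mul (hsm 1 0))
      intro i j
      simp only [Matrix.inv_def, Ring.inverse_eq_inv', Matrix.adjugate_fin_two, Matrix.smul_apply,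
        smul_eq_mul]
      refine hd.mul ?_
      fin_cases i <;> fin_cases j
      exacts [hsm 1 1, (hsm 0 1).neg, (hsm 1 0).neg, hsm 0 0]
    have hphase : ContDiff ℝ n fun u : Spacetime =>
        Complex.exp (Complex.I * ∑ j, lam j * (u (C.ign j) : ℂ)) := by
      have e : (fun u : Spacetime => Complex.exp (Complex.I * ∑ j, lam j * (u (C.ign j) : ℂ))) =
          fun u => Complex.exp (-Complex.I * ∑ j, (-lam) j * (u (C.ign j) : ℂ)) := by
        funext u
        congr 1
        simp only [Pi.neg_apply, Fin.sum_univ_two]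
        ring
      rw [e]
      exact (C.contDiff_phase (-lam)).cexp.of_le (coe_le_infty n)
    have hφ : ContDiffOn ℝ n φ (box I) := by
      refine ContDiffOn.smul hphase.contDiffOn (contDiffOn_mulVec (fun i j => (hinv i j).of_le (coe_le_infty n))
        (hψ.comp ((hC.contDiffOn_inv hI).of_le (coe_le_infty n)) fun u hu =>
          hC.inv_region hI hu))
    have hφd : ∀ u ∈ box I, DifferentiableAt ℝ φ u := fun u hu =>
      (hφ.contDiffAt (hB.mem_nhds hu)).differentiableAt hn0
    have hψφ : ∀ x ∈ C.region I, ψ x = C.assemble lam φ (C.coord x) := by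
      intro x hx
      have hu := IsAdapted.coord_box hx
      simp only [assemble, φ, Matrix.mulVec_smul, smul_smul, Matrix.mulVec_mulVec]
      rw [Matrix.mul_nonsing_inv _ (isUnit_iff_ne_zero.2 (hdet _ hu)), ← Complex.exp_add,
        hC.inv_coord hx.1]
      simp
    have hpd : ∀ u ∈ box I, ∀ ν ≠ C.sep, pd ν φ u = 0 := by
      intro u hu ν hν
      obtain ⟨j, rfl⟩ := hC.exists_ign hν
      have hx := hC.inv_region hI hu
      have h1 := (h _ hx).1 j
      rw [act_congr hU hψφ hx, hψφ _ hx, hF.act_assemble hC hx.1 (by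
        rw [hC.coord_inv hI hu]; exact hφd u hu), add_eq_left, hC.coord_inv hI hu,
        smul_eq_zero] at h1
      exact mulVec_eq_zero_of_isUnit (hF.unit u (hI.2 u hu))
        (h1.resolve_left (mul_ne_zero Complex.I_ne_zero (Complex.exp_ne_zero _)))
    obtain ⟨b, hb⟩ := hI.nonempty_box
    have hupd : ∀ t ∈ I C.sep, Function.update b C.sep t ∈ box I := by
      intro t ht ν
      by_cases hν : ν = C.sep
      · subst hν; simpa using ht
      · simpa [hν] using hb ν
    -- The coefficient is restricted to the coordinate line through a base point b of the box.
    let χ : ℝ → Spinor := fun t => φ (Function.update b C.sep t)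
    have hχ : ContDiffOn ℝ n χ (I C.sep) :=
      hφ.comp (contDiff_update n b C.sep).contDiffOn hupd
    have hφχ : ∀ u ∈ box I, φ u = χ (u C.sep) := fun u hu =>
      eq_of_pd_eq_zero hB hI.convex_box (fun v hv => (hφd v hv).differentiableWithinAt) hpd hu
        (hupd _ (hu C.sep)) (by simp)
    have hψχ : ∀ x ∈ C.region I, ψ x = C.separated lam χ x := fun x hx => by
      rw [hψφ x hx, separated_eq_assemble, assemble, assemble, hφχ _ (IsAdapted.coord_box hx)]
    refine ⟨χ, hχ, fun t ht => ?_, hψχ⟩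
    have hu := hupd t ht
    have hx := hC.inv_region hI hu
    have h1 := (h _ hx).2
    rw [dirac_congr hU hψχ hx, (hode χ (hχ.differentiableOn hn0) _ hx).2, smul_eq_zero,
      hC.coord_inv hI hu] at h1
    have h2 := mulVec_eq_zero_of_isUnit (hF.unit _ (hI.2 _ hu))
      (h1.resolve_left (Complex.exp_ne_zero _))
    simpa using h2
  · rintro ⟨χ, hχ, hχo, hψχ⟩ x hx
    obtain ⟨h1, h2⟩ := hode χ (hχ.differentiableOn hn0) x hx
    refine ⟨fun j => ?_, ?_⟩
    · rw [act_congr hU hψχ hx, hψχ x hx, h1]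
    · rw [dirac_congr hU hψχ hx, h2, hχo _ (hx.2 C.sep), Matrix.mulVec_zero, smul_zero]

end Frame

end SepChart

/-! ### Matrix exponentials -/

theorem exp_smul_sigma_three (c : ℂ) :
    NormedSpace.exp (c • (!![1, 0; 0, -1] : Mat2)) =
      !![Complex.exp c, 0; 0, Complex.exp (-c)] := by
  have h : c • (!![1, 0; 0, -1] : Mat2) = Matrix.diagonal ![c, -c] := by
    ext i j; fin_cases i <;> fin_cases j <;> simp
  rw [h, Matrix.exp_diagonal]
  ext i j
  fin_cases i <;> fin_cases j <;> simp [NormedSpace.exp, Pi.exp_def, Complex.exp_eq_exp_ℂ]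

/-- The matrix with columns (1, 1) and (1, -1) diagonalizes σ₁, which reduces the claim to σ₃. -/
theorem exp_smul_sigma_one (c : ℂ) :
    NormedSpace.exp (c • (!![0, 1; 1, 0] : Mat2)) =
      !![Complex.cosh c, Complex.sinh c; Complex.sinh c, Complex.cosh c] := by
  have hinv : (!![1, 1; 1, -1] : Mat2)⁻¹ = !![1 / 2, 1 / 2; 1 / 2, -1 / 2] := by
    refine Matrix.inv_eq_right_inv ?_
    ext i j; fin_cases i <;> fin_cases j <;> norm_num
  have hu : IsUnit (!![1, 1; 1, -1] : Mat2) := by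
    rw [Matrix.isUnit_iff_isUnit_det, isUnit_iff_ne_zero, Matrix.det_fin_two]; norm_num
  have h : c • (!![0, 1; 1, 0] : Mat2) =
      !![1, 1; 1, -1] * (c • !![1, 0; 0, -1]) * (!![1, 1; 1, -1])⁻¹ := by
    rw [hinv]
    ext i j
    fin_cases i <;> fin_cases j <;> simp <;> ring
  rw [h, Matrix.exp_conj _ _ hu, exp_smul_sigma_three, hinv]
  ext i j
  fin_cases i <;> fin_cases j <;> simp [Complex.cosh, Complex.sinh] <;> ring

theorem exp_of_sq_eq_zero {M : Mat2} (h : M * M = 0) : NormedSpace.exp M = 1 + M := by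
  rw [NormedSpace.exp_eq_tsum ℂ]
  simp only
  rw [tsum_eq_sum (s := Finset.range 2)]
  · simp [Finset.sum_range_succ]
  · intro n hn
    obtain ⟨k, rfl⟩ : ∃ k, n = k + 2 := ⟨n - 2, by simp at hn; omega⟩
    rw [pow_add, pow_two, h, mul_zero, smul_zero]

/-! ### Verification of charts through their inverse maps -/

namespace SepChart

variable {C : SepChart} {κ : SetKind} {s : ℝ} {x : Spacetime}

/-- The chain rule gives the product in the other order, and for square matrices this is enough. It
lets the charts be checked through their inverse maps, which are far easier to differentiate than
the root, argument and logarithm in the direct formulas. -/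
theorem pd_coord_mul_pd_inv (hs : IsOpen C.source) (ht : IsOpen C.target)
    (h1 : ∀ x ∈ C.source, C.coord x ∈ C.target ∧ C.inv (C.coord x) = x)
    (hc : ContDiffOn ℝ ∞ C.coord C.source) (hi : ContDiffOn ℝ ∞ C.inv C.target)
    (hx : x ∈ C.source) :
    (Matrix.of fun ν i => pd ν (fun v => C.inv v i) (C.coord x)) *
      (Matrix.of fun α ν => pd α (fun y => C.coord y ν) x) = 1 := by
  refine mul_eq_one_comm.1 ?_
  ext α i
  have hid : DifferentiableAt ℝ (fun v => C.inv v i) (C.coord x) :=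
    (contDiffAt_pi.1 (hi.contDiffAt (ht.mem_nhds (h1 x hx).1)) i).differentiableAt (by simp)
  have hcd : DifferentiableAt ℝ C.coord x :=
    (hc.contDiffAt (hs.mem_nhds hx)).differentiableAt (by simp)
  have := pd_comp (g := fun v => C.inv v i) hid hcd α
  rw [pd_congr hs (g := fun y => y i) (fun y hy => by rw [(h1 y hy).2]) hx, pd_coord] at this
  simpa [Matrix.mul_apply, Matrix.one_apply] using this.symm

/-- A vector field is the coordinate field of v_j exactly when it is the partial derivative of the
inverse map with respect to v_j. -/
theorem isAdapted_of_inverse (hs : IsOpen C.source) (ht : IsOpen C.target)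
    (h1 : ∀ x ∈ C.source, C.coord x ∈ C.target ∧ C.inv (C.coord x) = x)
    (h2 : ∀ u ∈ C.target, C.inv u ∈ C.source ∧ C.coord (C.inv u) = u)
    (hc : ContDiffOn ℝ ∞ C.coord C.source) (hi : ContDiffOn ℝ ∞ C.inv C.target)
    (hcover : ∀ ν : Fin 3, ν = C.sep ∨ ν = C.ign 0 ∨ ν = C.ign 1)
    (hk : ∀ u ∈ C.target, ∀ j i,
      pd (C.ign j) (fun v => C.inv v i) u = κ.killing j (C.inv u) i) :
    C.IsAdapted κ := by
  refine ⟨hs, ht, h1, h2, hc, hi, hcover, fun x hx j ν => ?_⟩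
  have h := congrFun (congrFun (pd_coord_mul_pd_inv hs ht h1 hc hi hx) (C.ign j)) ν
  simp only [Matrix.mul_apply, Matrix.of_apply, hk _ (h1 x hx).1, (h1 x hx).2,
    Matrix.one_apply] at h
  rw [h]
  exact if_congr eq_comm rfl rfl

/-- The condition `gam_eq` is the family of frame relations contracted with the Jacobian of the
inverse map; multiplying by the Jacobian of the coordinates recovers them one by one. In each chart
N commutes with the spin matrices and its τ-derivative is a scalar f times N, so the zeroth-order
condition is free of N. -/
theorem IsAdapted.isFrame_of_inverse (hC : C.IsAdapted κ) {f : Spacetime → ℂ}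
    (smooth : ∀ i j, ContDiffOn ℝ ∞ (fun u => C.frame u i j) C.target)
    (unit : ∀ u ∈ C.target, IsUnit (C.frame u))
    (ign : ∀ j, ∀ u ∈ C.target, mpd (C.ign j) C.frame u = Complex.I • (κ.spin s j * C.frame u))
    (gam_eq : ∀ u ∈ C.target, ∀ i, gam s i * C.frame u =
      ((pd C.sep (fun v => C.inv v i) u : ℝ) : ℂ) • (C.frame u * C.gSep (u C.sep)) +
        ∑ j, (κ.killing j (C.inv u) i : ℂ) • (C.frame u * C.gIgn j (u C.sep)))
    (comm : ∀ u ∈ C.target, ∀ j, κ.spin s j * C.frame u = C.frame u * κ.spin s j)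
    (sep : ∀ u ∈ C.target, mpd C.sep C.frame u = f u • C.frame u)
    (zero : ∀ u ∈ C.target, (Complex.I * f u) • C.gSep (u C.sep) -
      ∑ j, C.gIgn j (u C.sep) * κ.spin s j = C.gZero (u C.sep)) :
    C.IsFrame s κ := by
  have hJ : ∀ x ∈ C.source, ∀ ν, ∑ i, pd C.sep (fun v => C.inv v i) (C.coord x) *
      pd i (fun y => C.coord y ν) x = if ν = C.sep then 1 else 0 := by
    intro x hx ν
    have h := congrFun (congrFun (pd_coord_mul_pd_inv hC.1 hC.2.1 hC.2.2.1 hC.2.2.2.2.1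
      hC.2.2.2.2.2.1 hx) C.sep) ν
    simp only [Matrix.mul_apply, Matrix.of_apply, Matrix.one_apply] at h
    rw [h]
    exact if_congr eq_comm rfl rfl
  have key : ∀ x ∈ C.source, ∀ ν, C.coordGam s ν x * C.frame (C.coord x) =
      (if ν = C.sep then (1 : ℂ) else 0) • (C.frame (C.coord x) * C.gSep (C.coord x C.sep)) +
        ∑ j, (if ν = C.ign j then (1 : ℂ) else 0) •
          (C.frame (C.coord x) * C.gIgn j (C.coord x C.sep)) := by
    intro x hx ν
    have h0 : ∀ p : Prop, [Decidable p] → (if p then (1 : ℂ) else 0) =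
        ((if p then (1 : ℝ) else 0 : ℝ) : ℂ) := fun p _ => by split_ifs <;> simp
    have hu := hC.coord_mem hx
    simp only [h0, ← hJ x hx, ← hC.killing_coord hx]
    have e : C.coordGam s ν x * C.frame (C.coord x) =
        ∑ i, ((pd i (fun y => C.coord y ν) x : ℝ) : ℂ) • (gam s i * C.frame (C.coord x)) := by
      simp only [coordGam, Finset.sum_mul, Matrix.smul_mul]
    rw [e]
    simp only [gam_eq _ hu, hC.inv_coord hx, Fin.sum_univ_three, Fin.sum_univ_two]
    push_cast
    module
  have hsep : ∀ x ∈ C.source, C.coordGam s C.sep x * C.frame (C.coord x) =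
      C.frame (C.coord x) * C.gSep (C.coord x C.sep) := fun x hx => by
    simp [key x hx, hC.sep_ne]
  have hign : ∀ x ∈ C.source, ∀ j, C.coordGam s (C.ign j) x * C.frame (C.coord x) =
      C.frame (C.coord x) * C.gIgn j (C.coord x C.sep) := fun x hx j => by
    have hne := hC.ign_ne
    have h1 := (hC.sep_ne j).symm
    rw [key x hx]
    fin_cases j <;> simp_all [hne.symm]
  refine ⟨smooth, unit, ign, hsep, hign, fun x hx => ?_⟩
  have hu := hC.coord_mem hx
  rw [← zero _ hu, sep _ hu, Matrix.mul_smul, hsep x hx, Matrix.mul_sub, Matrix.mul_smul, smul_smul,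
    Finset.mul_sum]
  congr 1
  refine Finset.sum_congr rfl fun j _ => ?_
  rw [comm _ hu, ← Matrix.mul_assoc, hign x hx, Matrix.mul_assoc]

end SepChart

/-! ### Partial derivatives of elementary functions -/

section Elementary

variable {f : Spacetime → ℝ} {x : Spacetime}

theorem pd_neg (ν : Fin 3) :
    pd ν (fun y => -f y) x = -pd ν f x := by
  rw [pd, fderiv_fun_neg]; rfl

theorem pd_sq (hf : DifferentiableAt ℝ f x) (ν : Fin 3) :
    pd ν (fun y => f y ^ 2) x = 2 * f x * pd ν f x := by
  simp only [pow_two]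
  rw [pd_mul hf hf]; ring

theorem pd_cube (hf : DifferentiableAt ℝ f x) (ν : Fin 3) :
    pd ν (fun y => f y ^ 3) x = 3 * f x ^ 2 * pd ν f x := by
  have e : (fun y => f y ^ 3) = fun y => f y ^ 2 * f y := by funext y; ring
  rw [e, pd_mul (hf.fun_pow 2) hf, pd_sq hf]; ring

theorem pd_cos (hf : DifferentiableAt ℝ f x) (ν : Fin 3) :
    pd ν (fun y => Real.cos (f y)) x = -Real.sin (f x) * pd ν f x := by
  rw [pd_comp_real (g := Real.cos) Real.differentiableAt_cos hf, Real.deriv_cos, smul_eq_mul]; ring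

theorem pd_sin (hf : DifferentiableAt ℝ f x) (ν : Fin 3) :
    pd ν (fun y => Real.sin (f y)) x = Real.cos (f x) * pd ν f x := by
  rw [pd_comp_real (g := Real.sin) Real.differentiableAt_sin hf, Real.deriv_sin, smul_eq_mul]; ring

theorem pd_cosh (hf : DifferentiableAt ℝ f x) (ν : Fin 3) :
    pd ν (fun y => Real.cosh (f y)) x = Real.sinh (f x) * pd ν f x := by
  rw [pd_comp_real (g := Real.cosh) Real.differentiable_cosh.differentiableAt hf, Real.deriv_cosh,
    smul_eq_mul]; ring

theorem pd_sinh (hf : DifferentiableAt ℝ f x) (ν : Fin 3) :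
    pd ν (fun y => Real.sinh (f y)) x = Real.cosh (f x) * pd ν f x := by
  rw [pd_comp_real (g := Real.sinh) Real.differentiable_sinh.differentiableAt hf, Real.deriv_sinh,
    smul_eq_mul]; ring

end Elementary

/-! ### Frames -/

theorem mpd_of_hasDerivAt {F : ℝ → Mat2} {F' : Mat2} {k : Fin 3} {u : Spacetime}
    (h : ∀ i j, HasDerivAt (fun t => F t i j) (F' i j) (u k)) (ν : Fin 3) :
    mpd ν (fun v => F (v k)) u = (if ν = k then (1 : ℂ) else 0) • F' := by
  ext i j
  have := pd_comp_real (g := fun t => F t i j) (c := fun v : Spacetime => v k)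
    (h i j).differentiableAt (differentiableAt_apply k u) ν
  rw [mpd_apply, this, pd_coord, (h i j).deriv]
  split_ifs <;> simp

theorem mpd_smul {f : Spacetime → ℂ} {M : Spacetime → Mat2} {u : Spacetime}
    (hf : DifferentiableAt ℝ f u) (hM : MDiff M u) (ν : Fin 3) :
    mpd ν (fun v => f v • M v) u = pd ν f u • M u + f u • mpd ν M u := by
  ext i j
  simp only [mpd_apply, Matrix.smul_apply, smul_eq_mul, Matrix.add_apply]
  exact pd_mul_complex hf (hM i j) ν

theorem isUnit_of_det_ne_zero {M : Mat2} (h : M.det ≠ 0) : IsUnit M := by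
  rwa [Matrix.isUnit_iff_isUnit_det, isUnit_iff_ne_zero]

theorem gam_zero_eq (s : ℝ) : gam s 0 = !![1, 0; 0, -1] := rfl
theorem gam_one_eq (s : ℝ) :
    gam s 1 = !![0, Complex.I * (s : ℂ); Complex.I * (s : ℂ), 0] := rfl

theorem spin_p0l21 (s : ℝ) : SetKind.p0l21.spin s 1 = (-(s : ℂ) / 2) • gam s 0 := by
  simp [SetKind.spin, Fin.sum_univ_three, spinGrad_zero, spinGrad_one, spinGrad_two,
    SetKind.grad, lGrad, etaDiag, -Complex.coe_smul]
  module

theorem spin_p1l02 (s : ℝ) : SetKind.p1l02.spin s 1 = (-(s : ℂ) / 2) • gam s 1 := by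
  simp [SetKind.spin, Fin.sum_univ_three, spinGrad_zero, spinGrad_one, spinGrad_two,
    SetKind.grad, lGrad, etaDiag, -Complex.coe_smul]
  module

theorem spin_nullRot (s a : ℝ) :
    (SetKind.nullRot a).spin s 1 = (-(s : ℂ) / 2) • (gam s 0 - gam s 2) := by
  simp [SetKind.spin, Fin.sum_univ_three, spinGrad_zero, spinGrad_one, spinGrad_two,
    SetKind.grad, lGrad, etaDiag, -Complex.coe_smul]
  module

theorem spin_eq_zero {κ : SetKind} (h : κ.grad = 0) (s : ℝ) (j : Fin 2) : κ.spin s j = 0 := by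
  simp [SetKind.spin, spinGrad, h]

/-! ### Cartesian and null coordinates -/

theorem isAdapted_p0p1 (s : ℝ) : (chartP0P1 s).IsAdapted .p0p1 := by
  refine SepChart.isAdapted_of_inverse isOpen_univ isOpen_univ (fun x _ => ⟨trivial, rfl⟩)
    (fun x _ => ⟨trivial, rfl⟩) contDiffOn_id contDiffOn_id
    (by change ∀ ν : Fin 3, ν = 2 ∨ ν = 0 ∨ ν = 1; decide) ?_
  intro u _ j i
  fin_cases j <;> simp [chartP0P1, pd_coord, SetKind.killing, pVec, Pi.single_apply, eq_comm]

theorem isAdapted_p1p2 (s : ℝ) : (chartP1P2 s).IsAdapted .p1p2 := by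
  refine SepChart.isAdapted_of_inverse isOpen_univ isOpen_univ (fun x _ => ⟨trivial, rfl⟩)
    (fun x _ => ⟨trivial, rfl⟩) contDiffOn_id contDiffOn_id
    (by change ∀ ν : Fin 3, ν = 0 ∨ ν = 1 ∨ ν = 2; decide) ?_
  intro u _ j i
  fin_cases j <;> simp [chartP1P2, pd_coord, SetKind.killing, pVec, Pi.single_apply, eq_comm]

theorem isAdapted_p1null (s : ℝ) : (chartNull s).IsAdapted .p1null := by
  refine SepChart.isAdapted_of_inverse isOpen_univ isOpen_univ (fun x _ => ⟨trivial, ?_⟩)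
    (fun x _ => ⟨trivial, ?_⟩) ?_ ?_
    (by change ∀ ν : Fin 3, ν = 0 ∨ ν = 1 ∨ ν = 2; decide) ?_
  · ext i; fin_cases i <;> simp [chartNull]
  · ext i; fin_cases i <;> simp [chartNull] <;> ring
  · refine (contDiff_pi.2 fun i => ?_).contDiffOn
    fin_cases i <;> simp [chartNull] <;> fun_prop
  · refine (contDiff_pi.2 fun i => ?_).contDiffOn
    fin_cases i <;> simp [chartNull] <;> fun_prop
  · intro u _ j i
    fin_cases j <;> fin_cases i <;>
      simp (disch := fun_prop) [chartNull, pd_coord, pd_add, pd_sub, div_eq_mul_inv, pd_mul,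
        SetKind.killing, pVec, Pi.single_apply]

/-- Pairs of translations have no spin matrices, so N = 1 and only the Jacobian has to match the
constant matrices G. -/
theorem isFrame_of_trivial {C : SepChart} {κ : SetKind} {s : ℝ} (hC : C.IsAdapted κ)
    (hκ : κ.grad = 0) (hN : C.frame = fun _ => 1) (hZ : C.gZero = fun _ => 0)
    (h : ∀ u ∈ C.target, ∀ i, gam s i =
      ((pd C.sep (fun v => C.inv v i) u : ℝ) : ℂ) • C.gSep (u C.sep) +
        ∑ j, (κ.killing j (C.inv u) i : ℂ) • C.gIgn j (u C.sep)) : C.IsFrame s κ := by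
  have hs := spin_eq_zero hκ s
  refine hC.isFrame_of_inverse (f := fun _ => 0) ?_ ?_ ?_ ?_ ?_ ?_ ?_
  · simp only [hN]; exact fun _ _ => contDiffOn_const
  · simp [hN]
  · simp [hN, hs]
  · simpa [hN] using h
  · simp [hN]
  · simp [hN]
  · simp [hs, hZ]

theorem isFrame_p0p1 (s : ℝ) : (chartP0P1 s).IsFrame s .p0p1 := by
  refine isFrame_of_trivial (isAdapted_p0p1 s) rfl rfl rfl fun u _ i => ?_
  fin_cases i <;> simp [chartP0P1, pd_coord, SetKind.killing, pVec]

theorem isFrame_p1p2 (s : ℝ) : (chartP1P2 s).IsFrame s .p1p2 := by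
  refine isFrame_of_trivial (isAdapted_p1p2 s) rfl rfl rfl fun u _ i => ?_
  fin_cases i <;> simp [chartP1P2, pd_coord, SetKind.killing, pVec]

theorem isFrame_p1null (s : ℝ) : (chartNull s).IsFrame s .p1null := by
  refine isFrame_of_trivial (isAdapted_p1null s) rfl rfl rfl fun u _ i => ?_
  fin_cases i <;> simp (disch := fun_prop) [chartNull, pd_coord, pd_add, pd_sub, div_eq_mul_inv,
    pd_mul, SetKind.killing, pVec, Pi.single_apply] <;> module

/-! ### Polar coordinates -/

theorem mem_polar_source {s : ℝ} {x : Spacetime} :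
    x ∈ (chartPolar s).source ↔ (⟨x 1, x 2⟩ : ℂ) ∈ Complex.slitPlane := by
  rw [Complex.mem_slitPlane_iff]; rfl

/-- The pair (x¹, x²) is read as a point of the slit complex plane: radius and angle are modulus and
argument, and the angle is smooth as the imaginary part of the complex logarithm. -/
theorem isAdapted_polar (s : ℝ) : (chartPolar s).IsAdapted .p0l21 := by
  have hcont : ∀ i : Fin 3, Continuous fun x : Spacetime => x i := continuous_apply
  have hsrc : ∀ x ∈ (chartPolar s).source, 0 < x 1 ^ 2 + x 2 ^ 2 := by
    rintro x (h | h)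
    · positivity
    · positivity
  refine SepChart.isAdapted_of_inverse ?_ ?_ ?_ ?_ ?_ ?_
    (by change ∀ ν : Fin 3, ν = 1 ∨ ν = 0 ∨ ν = 2; decide) ?_
  · exact (isOpen_lt continuous_const (hcont 1)).union (isOpen_ne_fun (hcont 2) continuous_const)
  · exact (isOpen_lt continuous_const (hcont 1)).inter
      ((isOpen_lt continuous_const (hcont 2)).inter (isOpen_lt (hcont 2) continuous_const))
  · intro x hx
    have hz := (Complex.mem_slitPlane_iff_arg.1 (mem_polar_source.1 hx))
    have hn : Real.sqrt (x 1 ^ 2 + x 2 ^ 2) = ‖(⟨x 1, x 2⟩ : ℂ)‖ := by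
      rw [Complex.norm_eq_sqrt_sq_add_sq]
    refine ⟨⟨Real.sqrt_pos.2 (hsrc x hx), Complex.neg_pi_lt_arg _,
      lt_of_le_of_ne (Complex.arg_le_pi _) hz.1⟩, ?_⟩
    ext i
    fin_cases i
    · simp [chartPolar]
    · simp [chartPolar, hn, Complex.norm_mul_cos_arg]
    · simp [chartPolar, hn, Complex.norm_mul_sin_arg]
  · rintro u ⟨h0, h1, h2⟩
    have hz : (⟨u 1 * Real.cos (u 2), u 1 * Real.sin (u 2)⟩ : ℂ) =
        (u 1 : ℂ) * (Complex.cos (u 2) + Complex.sin (u 2) * Complex.I) := by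
      apply Complex.ext <;> simp [Complex.cos_ofReal_re, Complex.sin_ofReal_re,
        Complex.cos_ofReal_im, Complex.sin_ofReal_im]
    have harg : Complex.arg ⟨u 1 * Real.cos (u 2), u 1 * Real.sin (u 2)⟩ = u 2 := by
      rw [hz, Complex.arg_mul_cos_add_sin_mul_I h0 ⟨h1, h2.le⟩]
    have hsq : (u 1 * Real.cos (u 2)) ^ 2 + (u 1 * Real.sin (u 2)) ^ 2 = u 1 ^ 2 := by
      linear_combination u 1 ^ 2 * Real.cos_sq_add_sin_sq (u 2)
    constructor
    · rw [mem_polar_source]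
      change (⟨u 1 * Real.cos (u 2), u 1 * Real.sin (u 2)⟩ : ℂ) ∈ Complex.slitPlane
      rw [Complex.mem_slitPlane_iff_arg, harg]
      refine ⟨h2.ne, fun h => ?_⟩
      rw [Complex.ext_iff] at h
      simp only [Complex.zero_re, Complex.zero_im] at h
      rw [h.1, h.2] at hsq
      rw [zero_pow two_ne_zero, add_zero] at hsq
      exact (pow_pos h0 2).ne hsq
    · ext i
      fin_cases i
      · simp [chartPolar]
      · change Real.sqrt ((u 1 * Real.cos (u 2)) ^ 2 + (u 1 * Real.sin (u 2)) ^ 2) = u 1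
        rw [hsq, Real.sqrt_sq h0.le]
      · simpa [chartPolar] using harg
  · intro x hx
    refine (contDiffAt_pi.2 fun i => ?_).contDiffWithinAt
    fin_cases i
    · exact (contDiff_apply ℝ ℝ 0).contDiffAt
    · have h : ContDiffAt ℝ ∞ (fun x : Spacetime => x 1 ^ 2 + x 2 ^ 2) x := by fun_prop
      exact h.sqrt (hsrc x hx).ne'
    · have h1 : ContDiffAt ℝ ∞ (fun x : Spacetime => (⟨x 1, x 2⟩ : ℂ)) x := by
        have e : (fun x : Spacetime => (⟨x 1, x 2⟩ : ℂ)) =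
            fun x => (x 1 : ℂ) + (x 2 : ℂ) * Complex.I := by
          funext x; apply Complex.ext <;> simp
        rw [e]
        exact ((Complex.ofRealCLM.contDiff.comp (contDiff_apply ℝ ℝ 1)).add
          ((Complex.ofRealCLM.contDiff.comp (contDiff_apply ℝ ℝ 2)).mul
            contDiff_const)).contDiffAt
      have h2 : ContDiffAt ℝ ∞ Complex.log (⟨x 1, x 2⟩ : ℂ) :=
        (Complex.contDiffAt_log (mem_polar_source.1 hx)).restrict_scalars ℝ
      have h3 : ContDiffAt ℝ ∞ (fun x : Spacetime => (Complex.log ⟨x 1, x 2⟩).im) x :=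
        ContDiffAt.comp (g := Complex.imCLM) x Complex.imCLM.contDiff.contDiffAt
          (ContDiffAt.comp (g := Complex.log) x h2 h1)
      simpa [Complex.log_im, chartPolar] using h3
  · refine (contDiff_pi.2 fun i => ?_).contDiffOn
    fin_cases i <;> simp [chartPolar] <;> fun_prop
  · intro u _ j i
    fin_cases j <;> fin_cases i <;>
      simp (disch := fun_prop) [chartPolar, pd_coord, pd_mul, pd_cos, pd_sin,
        SetKind.killing, pVec, lVec, etaDiag, Pi.single_apply]

theorem polar_frame (s : ℝ) (u : Spacetime) : (chartPolar s).frame u =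
    !![Complex.exp (-Complex.I * s * u 2 / 2), 0; 0, Complex.exp (-(-Complex.I * s * u 2 / 2))] := by
  simp only [chartPolar, gam_zero_eq]
  rw [exp_smul_sigma_three]

theorem isFrame_polar {s : ℝ} (hs : s = 1 ∨ s = -1) : (chartPolar s).IsFrame s .p0l21 := by
  let F : ℝ → Mat2 := fun t =>
    !![Complex.exp (-Complex.I * s * t / 2), 0; 0, Complex.exp (-(-Complex.I * s * t / 2))]
  have hfr : (chartPolar s).frame = fun v => F (v 2) := funext (polar_frame s)
  have hF : ∀ t : ℝ, ∀ i j, HasDerivAt (fun t => F t i j)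
      ((Complex.I • (((-(s : ℂ) / 2) • gam s 0) * F t)) i j) t := by
    intro t i j
    have h1 : HasDerivAt (fun z : ℂ => -Complex.I * s * z / 2) (-Complex.I * s / 2) (t : ℂ) := by
      simpa using ((hasDerivAt_id (t : ℂ)).const_mul (-Complex.I * (s : ℂ))).div_const 2
    have h2 := h1.cexp.comp_ofReal
    have h3 := h1.fun_neg.cexp.comp_ofReal
    have h4 : HasDerivAt (fun _ : ℝ => (0 : ℂ)) 0 t := hasDerivAt_const t 0
    fin_cases i <;> fin_cases j
    · refine h2.congr_deriv ?_
      simp [F, gam_zero_eq]; ring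
    · refine h4.congr_deriv ?_
      simp [F, gam_zero_eq]
    · refine h4.congr_deriv ?_
      simp [F, gam_zero_eq]
    · refine h3.congr_deriv ?_
      simp [F, gam_zero_eq]; ring
  have hmpd : ∀ ν u, mpd ν (chartPolar s).frame u =
      (if ν = 2 then (1 : ℂ) else 0) • (Complex.I • (((-(s : ℂ) / 2) • gam s 0) * F (u 2))) := by
    intro ν u
    rw [hfr]
    exact mpd_of_hasDerivAt (hF (u 2)) ν
  -- N does not depend on r, so f = 0 and Z comes from the spin matrix of the rotation alone.
  refine (isAdapted_polar s).isFrame_of_inverse (f := fun _ => 0) ?_ ?_ ?_ ?_ ?_ ?_ ?_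
  · intro i j
    have hc : ∀ c : ℂ, ContDiff ℝ ∞ fun u : Spacetime => Complex.exp (c * (u 2 : ℂ)) := fun c =>
      (contDiff_const.mul (Complex.ofRealCLM.contDiff.comp (contDiff_apply ℝ ℝ 2))).cexp
    have h1 := hc (-Complex.I * s / 2)
    have h2 := hc (-(-Complex.I * s / 2))
    have h3 : ContDiff ℝ ∞ fun _ : Spacetime => (0 : ℂ) := contDiff_const
    refine ContDiff.contDiffOn ?_
    simp only [polar_frame]
    fin_cases i <;> fin_cases j
    · convert h1 using 3; simp; ring_nf
    · exact h3
    · exact h3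
    · convert h2 using 3; simp; ring_nf
  · intro u _
    refine isUnit_of_det_ne_zero ?_
    rw [polar_frame, Matrix.det_fin_two]
    simp [Complex.exp_ne_zero]
  · intro j u _
    rw [hmpd]
    fin_cases j
    · simp [chartPolar, SetKind.spin_first]
    · change (if (2 : Fin 3) = 2 then (1 : ℂ) else 0) • _ = Complex.I • (SetKind.p0l21.spin s 1 * _)
      rw [if_pos rfl, one_smul, spin_p0l21, hfr]
  · rintro u ⟨hu, -, -⟩ i
    have hr : (u 1 : ℂ) ≠ 0 := by exact_mod_cast hu.ne'
    -- The two diagonal entries of N differ by the full rotation phase e^{isφ}, where s = ±1. This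
    -- and its converse `hexp2` are all that is needed about the exponentials, which are then
    -- replaced by the symbols E and E'.
    have hexp : Complex.exp (-(-Complex.I * s * u 2 / 2)) = Complex.exp (-Complex.I * s * u 2 / 2) *
        (Complex.cos (u 2) + s * Complex.I * Complex.sin (u 2)) := by
      have e : Complex.cos (u 2) + s * Complex.I * Complex.sin (u 2) =
          Complex.exp (s * u 2 * Complex.I) := by
        rw [Complex.exp_mul_I]
        rcases hs with rfl | rfl <;> simp <;> ring
      rw [e, ← Complex.exp_add]
      congr 1; ring
    have hcs : Complex.sin (u 2) ^ 2 + Complex.cos (u 2) ^ 2 = 1 := Complex.sin_sq_add_cos_sq _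
    have hexp2 : Complex.exp (-Complex.I * s * u 2 / 2) = Complex.exp (-(-Complex.I * s * u 2 / 2)) *
        (Complex.cos (u 2) - s * Complex.I * Complex.sin (u 2)) := by
      have hsc : (s : ℂ) ^ 2 = 1 := by rcases hs with rfl | rfl <;> simp
      rw [hexp]
      linear_combination -Complex.exp (-Complex.I * s * u 2 / 2) * (hcs - Complex.sin (u 2) ^ 2 *
        (Complex.I ^ 2 * hsc + Complex.I_sq))
    rw [polar_frame]
    generalize Complex.exp (-Complex.I * s * u 2 / 2) = E at *
    generalize Complex.exp (-(-Complex.I * s * u 2 / 2)) = E' at *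
    have hp : pd (chartPolar s).sep (fun v => (chartPolar s).inv v i) u =
        ![0, Real.cos (u 2), Real.sin (u 2)] i := by
      fin_cases i <;> simp (disch := fun_prop) [chartPolar, pd_coord, pd_mul, pd_cos, pd_sin]
    rw [hp]
    have hsc : (s : ℂ) * s = 1 := by rcases hs with rfl | rfl <;> simp
    fin_cases i
    · ext i j
      fin_cases i <;> fin_cases j <;>
        simp [chartPolar, SetKind.killing, pVec, lVec, etaDiag, gam]
    · ext i j
      fin_cases i <;> fin_cases j <;>
        simp [chartPolar, SetKind.killing, pVec, lVec, etaDiag, gam] <;> field_simp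
      · rw [hexp]; linear_combination E * Complex.sin (u 2) * (Complex.I ^ 2 * hsc + Complex.I_sq)
      · rw [hexp2]
        linear_combination -E' * Complex.sin (u 2) * (Complex.I ^ 2 * hsc + Complex.I_sq)
    · ext i j
      fin_cases i <;> fin_cases j <;>
        simp [chartPolar, SetKind.killing, pVec, lVec, etaDiag, gam] <;> field_simp
      · rw [hexp]; ring
      · rw [hexp2]; ring
  · intro u _ j
    rw [polar_frame]
    fin_cases j
    · simp [SetKind.spin_first]
    · change SetKind.p0l21.spin s 1 * _ = _ * SetKind.p0l21.spin s 1
      rw [spin_p0l21, gam_zero_eq]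
      ext i j; fin_cases i <;> fin_cases j <;> simp <;> ring
  · intro u _
    rw [hmpd]
    simp [chartPolar]
  · rintro u ⟨hu, -, -⟩
    simp only [Fin.sum_univ_two, SetKind.spin_first, spin_p0l21]
    simp [chartPolar]
    match_scalars
    field_simp

/-! ### Hyperbolic coordinates -/

/-- With P and Q the light-cone coordinates ε(a ± b), the root is u₀ and the exponential is e^{u₂}
or, with P and Q exchanged, e^{-u₂}. Half the sum and half the difference of the two identities give
the hyperbolic cosine and sine. -/
theorem sqrt_mul_exp_half_log_div {P Q : ℝ} (hP : 0 < P) (hQ : 0 < Q) :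
    Real.sqrt (P * Q) * Real.exp (1 / 2 * Real.log (P / Q)) = P := by
  have h : (Real.sqrt (P * Q) * Real.exp (1 / 2 * Real.log (P / Q))) ^ 2 = P ^ 2 := by
    rw [mul_pow, Real.sq_sqrt (by positivity), ← Real.exp_nat_mul]
    rw [show ((2 : ℕ) : ℝ) * (1 / 2 * Real.log (P / Q)) = Real.log (P / Q) by push_cast; ring,
      Real.exp_log (by positivity)]
    field_simp
  exact (pow_left_inj₀ (by positivity) hP.le two_ne_zero).1 h

theorem hyperbolic_inv_coord {ε a b : ℝ} (hε : ε = 1 ∨ ε = -1) (h : |b| < ε * a) :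
    ε * Real.sqrt (a ^ 2 - b ^ 2) * Real.cosh (1 / 2 * Real.log ((a + b) / (a - b))) = a ∧
      ε * Real.sqrt (a ^ 2 - b ^ 2) * Real.sinh (1 / 2 * Real.log ((a + b) / (a - b))) = b := by
  obtain ⟨h1, h2⟩ := abs_lt.1 h
  have hP : 0 < ε * (a + b) := by rcases hε with rfl | rfl <;> linarith
  have hQ : 0 < ε * (a - b) := by rcases hε with rfl | rfl <;> linarith
  have e1 := sqrt_mul_exp_half_log_div hP hQ
  have e2 := sqrt_mul_exp_half_log_div hQ hP
  have hε0 : ε ≠ 0 := by rcases hε with rfl | rfl <;> norm_num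
  have hε2 : ε * ε = 1 := by rcases hε with rfl | rfl <;> norm_num
  have hprod : ε * (a + b) * (ε * (a - b)) = a ^ 2 - b ^ 2 := by
    linear_combination (a ^ 2 - b ^ 2) * hε2
  have hneg : 1 / 2 * Real.log (ε * (a - b) / (ε * (a + b))) =
      -(1 / 2 * Real.log ((a + b) / (a - b))) := by
    rw [mul_div_mul_left _ _ hε0, ← inv_div (a + b), Real.log_inv]; ring
  rw [hprod, mul_div_mul_left _ _ hε0] at e1
  rw [mul_comm (ε * (a - b)), hprod, hneg] at e2
  rw [Real.cosh_eq, Real.sinh_eq]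
  constructor
  · linear_combination ε / 2 * (e1 + e2) + a * hε2
  · linear_combination ε / 2 * (e1 - e2) + b * hε2

theorem hyperbolic_coord_inv {ε u v : ℝ} (hε : ε = 1 ∨ ε = -1) (hu : 0 < u) :
    |ε * u * Real.sinh v| < ε * (ε * u * Real.cosh v) ∧
      Real.sqrt ((ε * u * Real.cosh v) ^ 2 - (ε * u * Real.sinh v) ^ 2) = u ∧
      1 / 2 * Real.log ((ε * u * Real.cosh v + ε * u * Real.sinh v) /
        (ε * u * Real.cosh v - ε * u * Real.sinh v)) = v := by
  have hε0 : ε ≠ 0 := by rcases hε with rfl | rfl <;> norm_num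
  have hε2 : ε * ε = 1 := by rcases hε with rfl | rfl <;> norm_num
  have h1 := Real.exp_pos v
  have h2 := Real.exp_pos (-v)
  rw [← Real.cosh_add_sinh] at h1
  rw [← Real.cosh_sub_sinh] at h2
  refine ⟨?_, ?_, ?_⟩
  · have : |ε| = 1 := by rcases hε with rfl | rfl <;> norm_num
    rw [abs_mul, abs_mul, this, one_mul, abs_of_pos hu,
      show ε * (ε * u * Real.cosh v) = u * Real.cosh v by linear_combination u * Real.cosh v * hε2]
    exact mul_lt_mul_of_pos_left (abs_lt.2 ⟨by linarith, by linarith⟩) hu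
  · rw [show (ε * u * Real.cosh v) ^ 2 - (ε * u * Real.sinh v) ^ 2 = u ^ 2 by
      linear_combination u ^ 2 * (Real.cosh v ^ 2 - Real.sinh v ^ 2) * hε2 +
        u ^ 2 * Real.cosh_sq_sub_sinh_sq v, Real.sqrt_sq hu.le]
  · rw [← mul_add, ← mul_sub, mul_div_mul_left _ _ (mul_ne_zero hε0 hu.ne'), Real.cosh_add_sinh,
      Real.cosh_sub_sinh, ← Real.exp_sub, Real.log_exp]; ring

theorem contDiffAt_hyperbolic {ε : ℝ} {a b : Spacetime → ℝ} {x : Spacetime}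
    (hε : ε = 1 ∨ ε = -1) (h : |b x| < ε * a x) (ha : ContDiff ℝ ∞ a) (hb : ContDiff ℝ ∞ b) :
    ContDiffAt ℝ ∞ (fun x => Real.sqrt (a x ^ 2 - b x ^ 2)) x ∧
      ContDiffAt ℝ ∞ (fun x => 1 / 2 * Real.log ((a x + b x) / (a x - b x))) x := by
  obtain ⟨h1, h2⟩ := abs_lt.1 h
  have hp : a x + b x ≠ 0 := by rcases hε with rfl | rfl <;> intro h0 <;> linarith
  have hq : a x - b x ≠ 0 := by rcases hε with rfl | rfl <;> intro h0 <;> linarith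
  have ha := ha.contDiffAt (x := x)
  have hb := hb.contDiffAt (x := x)
  constructor
  · refine ((ha.pow 2).sub (hb.pow 2)).sqrt ?_
    rw [sq_sub_sq]
    exact mul_ne_zero hp hq
  · exact contDiffAt_const.mul (((ha.add hb).div (ha.sub hb) hq).log (div_ne_zero hp hq))

theorem isAdapted_hypTime (s : ℝ) {ε : ℝ} (hε : ε = 1 ∨ ε = -1) :
    (chartHypTime s ε).IsAdapted .p1l02 := by
  have hcont : ∀ i : Fin 3, Continuous fun x : Spacetime => x i := continuous_apply
  refine SepChart.isAdapted_of_inverse ?_ ?_ ?_ ?_ ?_ ?_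
    (by change ∀ ν : Fin 3, ν = 0 ∨ ν = 1 ∨ ν = 2; decide) ?_
  · exact isOpen_lt (hcont 2).abs ((hcont 0).const_mul ε)
  · exact isOpen_lt continuous_const (hcont 0)
  · intro x (hx : |x 2| < ε * x 0)
    obtain ⟨h1, h2⟩ := abs_lt.1 hx
    obtain ⟨e0, e2⟩ := hyperbolic_inv_coord hε hx
    refine ⟨Real.sqrt_pos.2 ?_, ?_⟩
    · rcases hε with rfl | rfl <;> nlinarith
    · ext i
      fin_cases i
      · exact e0
      · rfl
      · exact e2
  · intro u (hu : 0 < u 0)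
    obtain ⟨e0, e1, e2⟩ := hyperbolic_coord_inv (v := u 2) hε hu
    refine ⟨e0, ?_⟩
    ext i
    fin_cases i
    · exact e1
    · rfl
    · exact e2
  · intro x (hx : |x 2| < ε * x 0)
    obtain ⟨h1, h2⟩ := contDiffAt_hyperbolic (a := fun x => x 0) (b := fun x => x 2) hε hx
      (contDiff_apply ℝ ℝ 0) (contDiff_apply ℝ ℝ 2)
    refine (contDiffAt_pi.2 fun i => ?_).contDiffWithinAt
    fin_cases i
    · exact h1
    · exact (contDiff_apply ℝ ℝ 1).contDiffAt
    · exact h2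
  · refine (contDiff_pi.2 fun i => ?_).contDiffOn
    fin_cases i <;> simp [chartHypTime] <;> fun_prop
  · intro u _ j i
    fin_cases j <;> fin_cases i <;>
      simp (disch := fun_prop) [chartHypTime, pd_coord, pd_mul, pd_cosh, pd_sinh, pd_const,
        SetKind.killing, pVec, lVec, etaDiag, Pi.single_apply]

/-- The same hyperbolic formulas apply with x⁰ and x² exchanged. -/
theorem isAdapted_hypSpace (s : ℝ) {ε : ℝ} (hε : ε = 1 ∨ ε = -1) :
    (chartHypSpace s ε).IsAdapted .p1l02 := by
  have hcont : ∀ i : Fin 3, Continuous fun x : Spacetime => x i := continuous_apply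
  refine SepChart.isAdapted_of_inverse ?_ ?_ ?_ ?_ ?_ ?_
    (by change ∀ ν : Fin 3, ν = 0 ∨ ν = 1 ∨ ν = 2; decide) ?_
  · exact isOpen_lt (hcont 0).abs ((hcont 2).const_mul ε)
  · exact isOpen_lt continuous_const (hcont 0)
  · intro x (hx : |x 0| < ε * x 2)
    obtain ⟨h1, h2⟩ := abs_lt.1 hx
    obtain ⟨e0, e2⟩ := hyperbolic_inv_coord hε hx
    refine ⟨Real.sqrt_pos.2 ?_, ?_⟩
    · rcases hε with rfl | rfl <;> nlinarith
    · ext i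
      fin_cases i
      · exact e2
      · rfl
      · exact e0
  · intro u (hu : 0 < u 0)
    obtain ⟨e0, e1, e2⟩ := hyperbolic_coord_inv (v := u 2) hε hu
    refine ⟨e0, ?_⟩
    ext i
    fin_cases i
    · exact e1
    · rfl
    · exact e2
  · intro x (hx : |x 0| < ε * x 2)
    obtain ⟨h1, h2⟩ := contDiffAt_hyperbolic (a := fun x => x 2) (b := fun x => x 0) hε hx
      (contDiff_apply ℝ ℝ 2) (contDiff_apply ℝ ℝ 0)
    refine (contDiffAt_pi.2 fun i => ?_).contDiffWithinAt
    fin_cases i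
    · exact h1
    · exact (contDiff_apply ℝ ℝ 1).contDiffAt
    · exact h2
  · refine (contDiff_pi.2 fun i => ?_).contDiffOn
    fin_cases i <;> simp [chartHypSpace] <;> fun_prop
  · intro u _ j i
    fin_cases j <;> fin_cases i <;>
      simp (disch := fun_prop) [chartHypSpace, pd_coord, pd_mul, pd_cosh, pd_sinh, pd_const,
        SetKind.killing, pVec, lVec, etaDiag, Pi.single_apply]

/-- The boost `exp(-(i s / 2) t γ¹)` in closed form. -/
def boostFrame (t : ℝ) : Mat2 :=
  !![(Real.cosh (t / 2) : ℂ), (Real.sinh (t / 2) : ℂ); (Real.sinh (t / 2) : ℂ),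
    (Real.cosh (t / 2) : ℂ)]

theorem exp_smul_gam_one {s : ℝ} (hs : s = 1 ∨ s = -1) (t : ℝ) :
    NormedSpace.exp ((-Complex.I * (s : ℂ) / 2 * (t : ℂ)) • gam s 1) = boostFrame t := by
  have hsc : (s : ℂ) * s = 1 := by rcases hs with rfl | rfl <;> simp
  have e : (-Complex.I * (s : ℂ) / 2 * (t : ℂ)) • gam s 1 =
      ((t / 2 : ℝ) : ℂ) • (!![0, 1; 1, 0] : Mat2) := by
    rw [gam_one_eq]
    have : -Complex.I * (s : ℂ) / 2 * (t : ℂ) * (Complex.I * s) = ((t / 2 : ℝ) : ℂ) := by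
      push_cast
      linear_combination (t : ℂ) / 2 * hsc - (t : ℂ) / 2 * s * s * (Complex.I_sq)
    ext i j
    fin_cases i <;> fin_cases j <;>
      simp [-Complex.ofReal_div, -neg_mul, this]
  rw [e, exp_smul_sigma_one, boostFrame, Complex.ofReal_cosh, Complex.ofReal_sinh]

theorem hasDerivAt_boostFrame {s : ℝ} (hs : s = 1 ∨ s = -1) (t : ℝ) (i j : Fin 2) :
    HasDerivAt (fun t => boostFrame t i j)
      ((Complex.I • (((-(s : ℂ) / 2) • gam s 1) * boostFrame t)) i j) t := by
  have hsc : (s : ℂ) * s = 1 := by rcases hs with rfl | rfl <;> simp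
  have h1 : HasDerivAt (fun t : ℝ => t / 2) (1 / 2) t := (hasDerivAt_id t).div_const 2
  have hc := h1.cosh.ofReal_comp
  have hh := h1.sinh.ofReal_comp
  fin_cases i <;> fin_cases j
  · refine hc.congr_deriv ?_
    simp [boostFrame, gam_one_eq]
    linear_combination (-1 / 2 : ℂ) * Complex.sinh (t / 2) * (hsc - s * s * Complex.I_sq)
  · refine hh.congr_deriv ?_
    simp [boostFrame, gam_one_eq]
    linear_combination (-1 / 2 : ℂ) * Complex.cosh (t / 2) * (hsc - s * s * Complex.I_sq)
  · refine hh.congr_deriv ?_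
    simp [boostFrame, gam_one_eq]
    linear_combination (-1 / 2 : ℂ) * Complex.cosh (t / 2) * (hsc - s * s * Complex.I_sq)
  · refine hc.congr_deriv ?_
    simp [boostFrame, gam_one_eq]
    linear_combination (-1 / 2 : ℂ) * Complex.sinh (t / 2) * (hsc - s * s * Complex.I_sq)

/-- The factor u₀^{-1/2} has logarithmic derivative -1/(2u₀). Through f it adds a multiple of G₀
that cancels the spin term of the boost in both hyperbolic charts, which is why Z = 0 there. -/
theorem isFrame_of_boost {C : SepChart} {s : ℝ} (hs : s = 1 ∨ s = -1)
    (hC : C.IsAdapted .p1l02) (htgt : C.target = {u | 0 < u 0}) (hsep : C.sep = 0)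
    (hign : C.ign = ![1, 2])
    (hfr : C.frame = fun u => ((1 / Real.sqrt (u 0) : ℝ) : ℂ) •
      NormedSpace.exp ((-Complex.I * (s : ℂ) / 2 * (u 2 : ℂ)) • gam s 1))
    (gam_eq : ∀ u : Spacetime, 0 < u 0 → ∀ i, gam s i * boostFrame (u 2) =
      ((pd 0 (fun v => C.inv v i) u : ℝ) : ℂ) • (boostFrame (u 2) * C.gSep (u 0)) +
        ∑ j, (SetKind.p1l02.killing j (C.inv u) i : ℂ) • (boostFrame (u 2) * C.gIgn j (u 0)))
    (zero : ∀ u : Spacetime, 0 < u 0 → (Complex.I * ((-(1 / (2 * u 0)) : ℝ) : ℂ)) • C.gSep (u 0) +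
      (s / 2 : ℂ) • (C.gIgn 1 (u 0) * gam s 1) = C.gZero (u 0)) :
    C.IsFrame s .p1l02 := by
  have hfr' : C.frame = fun u => ((1 / Real.sqrt (u 0) : ℝ) : ℂ) • boostFrame (u 2) := by
    rw [hfr]; funext u; rw [exp_smul_gam_one hs]
  have hsm : ∀ u : Spacetime, 0 < u 0 →
      HasDerivAt (fun t : ℝ => 1 / Real.sqrt t) (-(1 / (2 * u 0)) * (1 / Real.sqrt (u 0))) (u 0) := by
    intro u hu
    have hr := Real.sqrt_pos.2 hu
    simp only [one_div]
    refine ((Real.hasDerivAt_sqrt hu.ne').fun_inv hr.ne').congr_deriv ?_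
    rw [Real.sq_sqrt hu.le]
    field_simp
  have hMd : ∀ u, MDiff (fun v : Spacetime => boostFrame (v 2)) u := fun u i j =>
    DifferentiableAt.comp (g := fun t => boostFrame t i j) u
      (hasDerivAt_boostFrame hs (u 2) i j).differentiableAt (differentiableAt_apply 2 u)
  have hpr : ∀ u : Spacetime, 0 < u 0 → ∀ ν,
      pd ν (fun v : Spacetime => ((1 / Real.sqrt (v 0) : ℝ) : ℂ)) u =
        if ν = 0 then ((-(1 / (2 * u 0)) : ℝ) : ℂ) * ((1 / Real.sqrt (u 0) : ℝ) : ℂ) else 0 := by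
    intro u hu ν
    have := pd_comp_real (g := fun t : ℝ => ((1 / Real.sqrt t : ℝ) : ℂ))
      (c := fun v : Spacetime => v 0)
      (hsm u hu).ofReal_comp.differentiableAt (differentiableAt_apply 0 u) ν
    rw [this, pd_coord, (hsm u hu).ofReal_comp.deriv]
    split_ifs <;> simp
  have hmpd : ∀ u : Spacetime, 0 < u 0 → ∀ ν, mpd ν C.frame u =
      (if ν = 0 then ((-(1 / (2 * u 0)) : ℝ) : ℂ) else 0) • C.frame u +
      (if ν = 2 then (1 : ℂ) else 0) • (Complex.I • (((-(s : ℂ) / 2) • gam s 1) * C.frame u)) := by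
    intro u hu ν
    have hd : DifferentiableAt ℝ (fun v : Spacetime => ((1 / Real.sqrt (v 0) : ℝ) : ℂ)) u :=
      DifferentiableAt.comp (g := fun t : ℝ => ((1 / Real.sqrt t : ℝ) : ℂ)) u
        (hsm u hu).ofReal_comp.differentiableAt (differentiableAt_apply 0 u)
    rw [hfr', mpd_smul hd (hMd u), hpr u hu,
      mpd_of_hasDerivAt (F := boostFrame) (hasDerivAt_boostFrame hs (u 2)) ν]
    simp only [Matrix.mul_smul, Matrix.smul_mul]
    split_ifs <;> simp <;> module
  refine hC.isFrame_of_inverse (f := fun u => ((-(1 / (2 * u 0)) : ℝ) : ℂ)) ?_ ?_ ?_ ?_ ?_ ?_ ?_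
  · rw [htgt]
    intro i j u (hu : 0 < u 0)
    simp only [hfr', Matrix.smul_apply, smul_eq_mul]
    refine ContDiffAt.contDiffWithinAt (ContDiffAt.mul ?_ ?_)
    · have h0 : ContDiffAt ℝ ∞ (fun v : Spacetime => v 0) u := (contDiff_apply ℝ ℝ 0).contDiffAt
      exact Complex.ofRealCLM.contDiff.contDiffAt.comp u
        (contDiffAt_const.div (h0.sqrt hu.ne') (Real.sqrt_pos.2 hu).ne')
    · have h2 : ContDiff ℝ ∞ (fun v : Spacetime => v 2 / 2) :=
        (contDiff_apply ℝ ℝ 2).div_const 2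
      have hcc : ContDiffAt ℝ ∞ (fun v : Spacetime => (Real.cosh (v 2 / 2) : ℂ)) u :=
        (Complex.ofRealCLM.contDiff.comp h2.cosh).contDiffAt
      have hss : ContDiffAt ℝ ∞ (fun v : Spacetime => (Real.sinh (v 2 / 2) : ℂ)) u :=
        (Complex.ofRealCLM.contDiff.comp h2.sinh).contDiffAt
      fin_cases i <;> fin_cases j
      exacts [hcc, hss, hss, hcc]
  · rw [htgt]
    intro u (hu : 0 < u 0)
    refine isUnit_of_det_ne_zero ?_
    have h1 : (Real.cosh (u 2 / 2) : ℂ) * Real.cosh (u 2 / 2) -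
        Real.sinh (u 2 / 2) * Real.sinh (u 2 / 2) = 1 := by
      have := Real.cosh_sq_sub_sinh_sq (u 2 / 2)
      rw [pow_two, pow_two] at this
      exact_mod_cast this
    rw [hfr', Matrix.det_smul, boostFrame, Matrix.det_fin_two_of, h1, mul_one]
    have := Real.sqrt_pos.2 hu
    exact pow_ne_zero _ (by exact_mod_cast (one_div_pos.2 this).ne')
  · rw [htgt]
    intro j u (hu : 0 < u 0)
    rw [hmpd u hu, hign]
    fin_cases j
    · simp [SetKind.spin_first]
    · simp [spin_p1l02]
  · rw [htgt]
    intro u (hu : 0 < u 0) i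
    rw [hsep, hfr']
    simp only [Matrix.mul_smul, Matrix.smul_mul, gam_eq u hu i, Fin.sum_univ_two]
    module
  · intro u _ j
    rw [hfr']
    fin_cases j
    · simp [SetKind.spin_first]
    · have hcm : gam s 1 * boostFrame (u 2) = boostFrame (u 2) * gam s 1 := by
        rw [gam_one_eq, boostFrame]
        ext i j
        fin_cases i <;> fin_cases j <;> simp <;> ring
      simp only [Fin.mk_one, spin_p1l02, Matrix.mul_smul, Matrix.smul_mul, hcm]
      exact smul_comm _ _ _
  · rw [htgt]
    intro u (hu : 0 < u 0)
    rw [hsep, hmpd u hu]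
    simp
  · rw [htgt]
    intro u (hu : 0 < u 0)
    rw [hsep, ← zero u hu]
    simp only [Fin.sum_univ_two, SetKind.spin_first, spin_p1l02, Matrix.mul_smul, mul_zero]
    module

/-- N contains half of the boost parameter and the Jacobian all of it; these relations make the
frame equations polynomial. -/
theorem double_angle (t : ℝ) :
    ((Real.cosh t : ℝ) : ℂ) = (Real.cosh (t / 2) : ℂ) ^ 2 + (Real.sinh (t / 2) : ℂ) ^ 2 ∧
    ((Real.sinh t : ℝ) : ℂ) = 2 * (Real.sinh (t / 2) : ℂ) * (Real.cosh (t / 2) : ℂ) ∧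
    (Real.cosh (t / 2) : ℂ) ^ 2 - (Real.sinh (t / 2) : ℂ) ^ 2 = 1 := by
  have h1 := Real.cosh_two_mul (t / 2)
  have h2 := Real.sinh_two_mul (t / 2)
  rw [mul_div_cancel₀ t two_ne_zero] at h1 h2
  refine ⟨by exact_mod_cast h1, by exact_mod_cast h2, by exact_mod_cast Real.cosh_sq_sub_sinh_sq _⟩

theorem isFrame_hypTime {s ε : ℝ} (hs : s = 1 ∨ s = -1) (hε : ε = 1 ∨ ε = -1) :
    (chartHypTime s ε).IsFrame s .p1l02 := by
  have hεc : (ε : ℂ) * ε = 1 := by rcases hε with rfl | rfl <;> simp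
  have hsc : (s : ℂ) * s = 1 := by rcases hs with rfl | rfl <;> simp
  refine isFrame_of_boost hs (isAdapted_hypTime s hε) rfl rfl rfl rfl ?_ ?_
  · intro u hu i
    have hu' : (u 0 : ℂ) ≠ 0 := by exact_mod_cast hu.ne'
    have hp : pd 0 (fun v => (chartHypTime s ε).inv v i) u =
        ![ε * Real.cosh (u 2), 0, ε * Real.sinh (u 2)] i := by
      fin_cases i <;> simp (disch := fun_prop) [chartHypTime, pd_coord, pd_mul, pd_cosh, pd_sinh,
        pd_const]
    obtain ⟨h1, h2, h3⟩ := double_angle (u 2)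
    rw [hp]
    ext i' j'
    fin_cases i <;> fin_cases i' <;> fin_cases j' <;>
      simp [-Complex.ofReal_cosh, -Complex.ofReal_sinh, chartHypTime, SetKind.killing, pVec, lVec,
        etaDiag, h1, h2, boostFrame, gam] <;>
      field_simp <;> grind
  · intro u hu
    have hu' : (u 0 : ℂ) ≠ 0 := by exact_mod_cast hu.ne'
    ext i j
    fin_cases i <;> fin_cases j <;> simp [chartHypTime, gam] <;> field_simp <;> grind

theorem isFrame_hypSpace {s ε : ℝ} (hs : s = 1 ∨ s = -1) (hε : ε = 1 ∨ ε = -1) :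
    (chartHypSpace s ε).IsFrame s .p1l02 := by
  have hεc : (ε : ℂ) * ε = 1 := by rcases hε with rfl | rfl <;> simp
  have hsc : (s : ℂ) * s = 1 := by rcases hs with rfl | rfl <;> simp
  refine isFrame_of_boost hs (isAdapted_hypSpace s hε) rfl rfl rfl rfl ?_ ?_
  · intro u hu i
    have hu' : (u 0 : ℂ) ≠ 0 := by exact_mod_cast hu.ne'
    have hp : pd 0 (fun v => (chartHypSpace s ε).inv v i) u =
        ![ε * Real.sinh (u 2), 0, ε * Real.cosh (u 2)] i := by
      fin_cases i <;> simp (disch := fun_prop) [chartHypSpace, pd_coord, pd_mul, pd_cosh, pd_sinh,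
        pd_const]
    obtain ⟨h1, h2, h3⟩ := double_angle (u 2)
    rw [hp]
    ext i' j'
    fin_cases i <;> fin_cases i' <;> fin_cases j' <;>
      simp [-Complex.ofReal_cosh, -Complex.ofReal_sinh, chartHypSpace, SetKind.killing, pVec, lVec,
        etaDiag, h1, h2, boostFrame, gam] <;>
      field_simp <;> grind
  · intro u hu
    have hu' : (u 0 : ℂ) ≠ 0 := by exact_mod_cast hu.ne'
    ext i j
    fin_cases i <;> fin_cases j <;> simp [chartHypSpace, gam] <;> field_simp <;> grind

/-! ### Coordinates adapted to null rotations -/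

/-- The null rotation `exp (c (γ⁰ - γ²))` in closed form. -/
def nullFrame (c : ℂ) : Mat2 := !![1 + c, -c; c, 1 - c]

theorem nullFrame_eq (s : ℝ) (c : ℂ) : nullFrame c = 1 + c • (gam s 0 - gam s 2) := by
  ext i j; fin_cases i <;> fin_cases j <;> simp [gam, nullFrame, sub_eq_add_neg]

theorem exp_smul_null (s : ℝ) (c : ℂ) :
    NormedSpace.exp (c • (gam s 0 - gam s 2)) = nullFrame c := by
  rw [nullFrame_eq s]
  refine exp_of_sq_eq_zero ?_
  have h : (gam s 0 - gam s 2) * (gam s 0 - gam s 2) = 0 := by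
    ext i j; fin_cases i <;> fin_cases j <;> simp [gam]
  rw [Matrix.smul_mul, Matrix.mul_smul, h, smul_zero, smul_zero]

/-- Since (γ⁰ - γ²)² = 0, the frame is affine in u₂. The derivative equation holds because the
quadratic term drops out, and N commutes with the spin matrix. -/
theorem isFrame_of_nullRotation {C : SepChart} {s a : ℝ}
    (hC : C.IsAdapted (.nullRot a)) (hsep : C.sep = 0) (hign : C.ign = ![1, 2])
    (hfr : C.frame = fun u =>
      NormedSpace.exp ((-Complex.I * (s : ℂ) / 2 * (u 2 : ℂ)) • (gam s 0 - gam s 2)))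
    (gam_eq : ∀ u ∈ C.target, ∀ i,
      gam s i * nullFrame (-Complex.I * (s : ℂ) / 2 * (u 2 : ℂ)) =
      ((pd 0 (fun v => C.inv v i) u : ℝ) : ℂ) •
        (nullFrame (-Complex.I * (s : ℂ) / 2 * (u 2 : ℂ)) * C.gSep (u 0)) +
        ∑ j, ((SetKind.nullRot a).killing j (C.inv u) i : ℂ) •
          (nullFrame (-Complex.I * (s : ℂ) / 2 * (u 2 : ℂ)) * C.gIgn j (u 0)))
    (zero : ∀ u ∈ C.target, (s / 2 : ℂ) • (C.gIgn 1 (u 0) * (gam s 0 - gam s 2)) =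
      C.gZero (u 0)) :
    C.IsFrame s (.nullRot a) := by
  have hfr' : C.frame = fun u =>
      1 + (-Complex.I * (s : ℂ) / 2 * (u 2 : ℂ)) • (gam s 0 - gam s 2) := by
    rw [hfr]; funext u; rw [exp_smul_null, nullFrame_eq s]
  have hsq : (gam s 0 - gam s 2) * (gam s 0 - gam s 2) = 0 := by
    ext i j; fin_cases i <;> fin_cases j <;> simp [gam]
  have hmpd : ∀ u ν, mpd ν C.frame u =
      (if ν = 2 then (1 : ℂ) else 0) • ((-Complex.I * (s : ℂ) / 2) • (gam s 0 - gam s 2)) := by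
    intro u ν
    rw [hfr']
    refine mpd_of_hasDerivAt (F := fun t : ℝ =>
      1 + (-Complex.I * (s : ℂ) / 2 * (t : ℂ)) • (gam s 0 - gam s 2)) (fun i j => ?_) ν
    have h1 : HasDerivAt (fun z : ℂ => -Complex.I * s / 2 * z) (-Complex.I * s / 2) (u 2 : ℂ) := by
      simpa using (hasDerivAt_id (u 2 : ℂ)).const_mul (-Complex.I * (s : ℂ) / 2)
    exact (h1.comp_ofReal.mul_const _).const_add _
  refine hC.isFrame_of_inverse (f := fun _ => 0) ?_ ?_ ?_ ?_ ?_ ?_ ?_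
  · intro i j
    rw [hfr']
    refine ContDiff.contDiffOn ?_
    exact contDiff_const.add ((contDiff_const.mul
      (Complex.ofRealCLM.contDiff.comp (contDiff_apply ℝ ℝ 2))).mul contDiff_const)
  · intro u _
    refine isUnit_of_det_ne_zero ?_
    rw [hfr', Matrix.det_fin_two]
    simp [gam]
    ring_nf
    simp
  · intro j u _
    rw [hmpd, hign, hfr']
    fin_cases j
    · simp [SetKind.spin_first]
    · simp only [Fin.mk_one, spin_nullRot, Matrix.smul_mul, Matrix.mul_add, mul_one,
        Matrix.mul_smul, hsq]
      simp
      module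
  · intro u hu i
    simp only [hsep, hfr', ← nullFrame_eq, gam_eq u hu i]
  · intro u _ j
    rw [hfr']
    fin_cases j
    · simp [SetKind.spin_first]
    · simp only [Fin.mk_one, spin_nullRot, Matrix.smul_mul, Matrix.mul_add, Matrix.add_mul, mul_one,
        one_mul, Matrix.mul_smul, hsq, smul_zero, add_zero]
  · intro u _
    rw [hsep, hmpd]
    simp
  · intro u hu
    rw [hsep, ← zero u hu]
    simp only [Fin.sum_univ_two, SetKind.spin_first, spin_nullRot, Matrix.mul_smul, mul_zero]
    module

theorem isAdapted_nullRot (s : ℝ) {a : ℝ} (ha : a ≠ 0) :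
    (chartNullRot s a).IsAdapted (.nullRot a) := by
  refine SepChart.isAdapted_of_inverse isOpen_univ isOpen_univ (fun x _ => ⟨trivial, ?_⟩)
    (fun x _ => ⟨trivial, ?_⟩) ?_ ?_
    (by change ∀ ν : Fin 3, ν = 0 ∨ ν = 1 ∨ ν = 2; decide) ?_
  · ext i; fin_cases i <;> simp [chartNullRot] <;> field_simp <;> ring
  · ext i; fin_cases i <;> simp [chartNullRot] <;> field_simp <;> ring
  · refine (contDiff_pi.2 fun i => ?_).contDiffOn
    fin_cases i <;> simp [chartNullRot] <;> fun_prop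
  · refine (contDiff_pi.2 fun i => ?_).contDiffOn
    fin_cases i <;> simp [chartNullRot] <;> fun_prop
  · intro u _ j i
    fin_cases j <;> fin_cases i <;>
      simp (disch := fun_prop) [chartNullRot, pd_coord, pd_add, pd_sub, pd_mul, pd_const, pd_sq,
        pd_cube, SetKind.killing, pVec, lVec, etaDiag, Pi.single_apply] <;> field_simp <;> ring

theorem isFrame_nullRot {s a : ℝ} (hs : s = 1 ∨ s = -1) (ha : a ≠ 0) :
    (chartNullRot s a).IsFrame s (.nullRot a) := by
  have hsc : (s : ℂ) * s = 1 := by rcases hs with rfl | rfl <;> simp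
  have hac : (a : ℂ) ≠ 0 := by exact_mod_cast ha
  have hI : Complex.I * Complex.I = -1 := Complex.I_mul_I
  refine isFrame_of_nullRotation (isAdapted_nullRot s ha) rfl rfl rfl ?_ ?_
  · intro u _ i
    have hp : pd 0 (fun v => (chartNullRot s a).inv v i) u =
        ![-(1 / (2 * a)) * u 2, -(1 / (2 * a)), -(1 / (2 * a)) * u 2] i := by
      fin_cases i <;> simp (disch := fun_prop) [chartNullRot, pd_coord, pd_add, pd_sub, pd_mul,
        pd_const, pd_sq, pd_cube]
    rw [hp]
    ext i' j'
    fin_cases i <;> fin_cases i' <;> fin_cases j' <;>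
      simp [chartNullRot, SetKind.killing, pVec, lVec, etaDiag, gam,
        nullFrame] <;>
      field_simp <;> grind
  -- For a ≠ 0 the matrix G₂ is itself a multiple of the nilpotent γ⁰ - γ², so Z = 0.
  · intro u _
    ext i j
    fin_cases i <;> fin_cases j <;> simp [chartNullRot, gam]

theorem isAdapted_nullRotZero (s : ℝ) : (chartNullRotZero s).IsAdapted (.nullRot 0) := by
  have hcont : ∀ i : Fin 3, Continuous fun x : Spacetime => x i := continuous_apply
  refine SepChart.isAdapted_of_inverse ?_ ?_ ?_ ?_ ?_ ?_
    (by change ∀ ν : Fin 3, ν = 0 ∨ ν = 1 ∨ ν = 2; decide) ?_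
  · exact isOpen_ne_fun ((hcont 0).sub (hcont 2)) continuous_const
  · exact isOpen_ne_fun (hcont 0) continuous_const
  · intro x (hx : x 0 - x 2 ≠ 0)
    refine ⟨hx, ?_⟩
    ext i; fin_cases i <;> simp [chartNullRotZero] <;> field_simp <;> ring
  · intro u (hu : u 0 ≠ 0)
    have e : 1 / 2 * (u 0 + u 1 + u 0 * u 2 ^ 2) - 1 / 2 * (-u 0 + u 1 + u 0 * u 2 ^ 2) = u 0 := by
      ring
    constructor
    · change 1 / 2 * (u 0 + u 1 + u 0 * u 2 ^ 2) - 1 / 2 * (-u 0 + u 1 + u 0 * u 2 ^ 2) ≠ 0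
      rwa [e]
    · ext i
      fin_cases i
      · exact e
      · change 1 / 2 * (u 0 + u 1 + u 0 * u 2 ^ 2) + 1 / 2 * (-u 0 + u 1 + u 0 * u 2 ^ 2) -
          (u 0 * u 2) ^ 2 / (1 / 2 * (u 0 + u 1 + u 0 * u 2 ^ 2) -
            1 / 2 * (-u 0 + u 1 + u 0 * u 2 ^ 2)) = u 1
        rw [e]; field_simp; ring
      · change u 0 * u 2 / (1 / 2 * (u 0 + u 1 + u 0 * u 2 ^ 2) -
            1 / 2 * (-u 0 + u 1 + u 0 * u 2 ^ 2)) = u 2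
        rw [e]; field_simp
  · intro x (hx : x 0 - x 2 ≠ 0)
    have hc : ∀ i : Fin 3, ContDiffAt ℝ ∞ (fun x : Spacetime => x i) x := fun i =>
      (contDiff_apply ℝ ℝ i).contDiffAt
    refine (contDiffAt_pi.2 fun i => ?_).contDiffWithinAt
    fin_cases i
    · exact (hc 0).sub (hc 2)
    · exact ((hc 0).add (hc 2)).sub (((hc 1).pow 2).div ((hc 0).sub (hc 2)) hx)
    · exact (hc 1).div ((hc 0).sub (hc 2)) hx
  · refine (contDiff_pi.2 fun i => ?_).contDiffOn
    fin_cases i <;> simp [chartNullRotZero] <;> fun_prop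
  · intro u _ j i
    fin_cases j <;> fin_cases i <;>
      simp (disch := fun_prop) [chartNullRotZero, pd_coord, pd_add, pd_neg, pd_mul, pd_const,
        pd_sq, SetKind.killing, pVec, lVec, etaDiag, Pi.single_apply] <;> ring

theorem isFrame_nullRotZero {s : ℝ} (hs : s = 1 ∨ s = -1) :
    (chartNullRotZero s).IsFrame s (.nullRot 0) := by
  have hsc : (s : ℂ) * s = 1 := by rcases hs with rfl | rfl <;> simp
  have hI : Complex.I * Complex.I = -1 := Complex.I_mul_I
  refine isFrame_of_nullRotation (isAdapted_nullRotZero s) rfl rfl rfl ?_ ?_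
  · intro u (hu : u 0 ≠ 0) i
    have hu' : (u 0 : ℂ) ≠ 0 := by exact_mod_cast hu
    have hp : pd 0 (fun v => (chartNullRotZero s).inv v i) u =
        ![1 / 2 * (1 + u 2 ^ 2), u 2, 1 / 2 * (-1 + u 2 ^ 2)] i := by
      fin_cases i <;> simp (disch := fun_prop) [chartNullRotZero, pd_coord, pd_add, pd_neg, pd_mul,
        pd_const, pd_sq]
    rw [hp]
    ext i' j'
    fin_cases i <;> fin_cases i' <;> fin_cases j' <;>
      simp [chartNullRotZero, SetKind.killing, pVec, lVec, etaDiag, gam,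
        nullFrame] <;>
      field_simp <;> grind
  · intro u (hu : u 0 ≠ 0)
    have hu' : (u 0 : ℂ) ≠ 0 := by exact_mod_cast hu
    ext i j
    fin_cases i <;> fin_cases j <;> simp [chartNullRotZero, gam] <;> field_simp <;> grind

/-! ### The table -/

theorem SetKind.isAdapted_of_mem_charts (s : ℝ) {κ : SetKind} {C : SepChart}
    (hC : C ∈ κ.charts s) : C.IsAdapted κ := by
  cases κ with
  | p0p1 => obtain rfl := hC; exact isAdapted_p0p1 s
  | p1p2 => obtain rfl := hC; exact isAdapted_p1p2 s
  | p0l21 => obtain rfl := hC; exact isAdapted_polar s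
  | p1l02 =>
    obtain rfl | rfl | rfl | rfl := hC
    · exact isAdapted_hypTime s (Or.inl rfl)
    · exact isAdapted_hypTime s (Or.inr rfl)
    · exact isAdapted_hypSpace s (Or.inl rfl)
    · exact isAdapted_hypSpace s (Or.inr rfl)
  | p1null => obtain rfl := hC; exact isAdapted_p1null s
  | nullRot a =>
    obtain ⟨ha, rfl⟩ | ⟨rfl, rfl⟩ := hC
    · exact isAdapted_nullRot s ha
    · exact isAdapted_nullRotZero s

theorem SetKind.isFrame_of_mem_charts {s : ℝ} (hs : s = 1 ∨ s = -1) {κ : SetKind} {C : SepChart}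
    (hC : C ∈ κ.charts s) : C.IsFrame s κ := by
  cases κ with
  | p0p1 => obtain rfl := hC; exact isFrame_p0p1 s
  | p1p2 => obtain rfl := hC; exact isFrame_p1p2 s
  | p0l21 => obtain rfl := hC; exact isFrame_polar hs
  | p1l02 =>
    obtain rfl | rfl | rfl | rfl := hC
    · exact isFrame_hypTime hs (Or.inl rfl)
    · exact isFrame_hypTime hs (Or.inr rfl)
    · exact isFrame_hypSpace hs (Or.inl rfl)
    · exact isFrame_hypSpace hs (Or.inr rfl)
  | p1null => obtain rfl := hC; exact isFrame_p1null s
  | nullRot a =>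
    obtain ⟨ha, rfl⟩ | ⟨rfl, rfl⟩ := hC
    · exact isFrame_nullRot hs ha
    · exact isFrame_nullRotZero hs

theorem dense_setOf_ne_zero {l : Spacetime →L[ℝ] ℝ} (hl : l ≠ 0) : Dense {x | l x ≠ 0} :=
  (dense_compl_singleton (0 : ℝ)).preimage (l.isOpenMap_of_ne_zero hl)

/-- Each union of domains contains the set where at most two nonzero linear forms do not vanish. -/
theorem SetKind.dense_sources (s : ℝ) (κ : SetKind) : Dense (⋃ C ∈ κ.charts s, C.source) := by
  let π : Fin 3 → Spacetime →L[ℝ] ℝ := ContinuousLinearMap.proj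
  have hsub : Dense {x : Spacetime | x 0 - x 2 ≠ 0} := by
    refine dense_setOf_ne_zero (l := π 0 - π 2) fun h => ?_
    have := congrArg (fun l : Spacetime →L[ℝ] ℝ => l (Pi.single 0 1)) h
    simp [π] at this
  have hadd : Dense {x : Spacetime | x 0 + x 2 ≠ 0} := by
    refine dense_setOf_ne_zero (l := π 0 + π 2) fun h => ?_
    have := congrArg (fun l : Spacetime →L[ℝ] ℝ => l (Pi.single 0 1)) h
    simp [π] at this
  cases κ with
  | p0p1 => simp [charts, chartP0P1]
  | p1p2 => simp [charts, chartP1P2]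
  | p1null => simp [charts, chartNull]
  | p0l21 =>
    have h2 : Dense {x : Spacetime | x 2 ≠ 0} := by
      refine dense_setOf_ne_zero (l := π 2) fun h => ?_
      have := congrArg (fun l : Spacetime →L[ℝ] ℝ => l (Pi.single 2 1)) h
      simp [π] at this
    exact h2.mono fun x hx => Set.mem_biUnion (x := chartPolar s) rfl (Or.inr hx)
  | p1l02 =>
    have hc : ∀ i : Fin 3, Continuous fun x : Spacetime => x i := continuous_apply
    refine (hadd.inter_of_isOpen_right hsub
      (isOpen_ne_fun ((hc 0).sub (hc 2)) continuous_const)).mono ?_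
    rintro x ⟨h1 : x 0 + x 2 ≠ 0, h2 : x 0 - x 2 ≠ 0⟩
    -- The signs of x⁰ + x² and x⁰ - x² decide which of the four wedges contains x.
    rcases lt_or_gt_of_ne h1 with h1 | h1 <;> rcases lt_or_gt_of_ne h2 with h2 | h2
    · refine Set.mem_biUnion (x := chartHypTime s (-1)) (Or.inr (Or.inl rfl)) ?_
      change |x 2| < -1 * x 0
      exact abs_lt.2 ⟨by linarith, by linarith⟩
    · refine Set.mem_biUnion (x := chartHypSpace s (-1)) (Or.inr (Or.inr (Or.inr rfl))) ?_
      change |x 0| < -1 * x 2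
      exact abs_lt.2 ⟨by linarith, by linarith⟩
    · refine Set.mem_biUnion (x := chartHypSpace s 1) (Or.inr (Or.inr (Or.inl rfl))) ?_
      change |x 0| < 1 * x 2
      exact abs_lt.2 ⟨by linarith, by linarith⟩
    · refine Set.mem_biUnion (x := chartHypTime s 1) (Or.inl rfl) ?_
      change |x 2| < 1 * x 0
      exact abs_lt.2 ⟨by linarith, by linarith⟩
  | nullRot a =>
    by_cases ha : a = 0
    · exact hsub.mono fun x hx => Set.mem_biUnion (x := chartNullRotZero s) (Or.inr ⟨ha, rfl⟩) hx
    · exact dense_univ.mono fun x _ =>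
        Set.mem_biUnion (x := chartNullRot s a) (Or.inl ⟨ha, rfl⟩) trivial

/-! ### Lorentzian linear algebra -/

/-- The Lorentzian cross product. -/
def lcross (a b : Fin 3 → ℝ) : Fin 3 → ℝ :=
  ![a 1 * b 2 - a 2 * b 1, a 0 * b 2 - a 2 * b 0, a 1 * b 0 - a 0 * b 1]

/-- The Minkowski inner product. -/
def lform (a b : Fin 3 → ℝ) : ℝ := a 0 * b 0 - a 1 * b 1 - a 2 * b 2

theorem lcross_smul_left (t : ℝ) (a b : Fin 3 → ℝ) : lcross (t • a) b = t • lcross a b := by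
  ext i; fin_cases i <;> simp [lcross] <;> ring

theorem lcross_smul_right (t : ℝ) (a b : Fin 3 → ℝ) : lcross a (t • b) = t • lcross a b := by
  ext i; fin_cases i <;> simp [lcross] <;> ring

theorem lcross_add_left (a b c : Fin 3 → ℝ) : lcross (a + b) c = lcross a c + lcross b c := by
  ext i; fin_cases i <;> simp [lcross] <;> ring

theorem lcross_sub_right (a b c : Fin 3 → ℝ) : lcross a (b - c) = lcross a b - lcross a c := by
  ext i; fin_cases i <;> simp [lcross] <;> ring

theorem lform_lcross_left (a b : Fin 3 → ℝ) : lform (lcross a b) a = 0 := by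
  simp [lcross, lform]; ring

theorem lform_lcross_right (a b : Fin 3 → ℝ) : lform (lcross a b) b = 0 := by
  simp [lcross, lform]; ring

theorem exists_smul_of_lcross_eq_zero {a b : Fin 3 → ℝ} (ha : a ≠ 0) (h : lcross a b = 0) :
    ∃ t : ℝ, b = t • a := by
  have h0 := congrFun h 0
  have h1 := congrFun h 1
  have h2 := congrFun h 2
  simp [lcross] at h0 h1 h2
  by_cases a0 : a 0 = 0
  · by_cases a1 : a 1 = 0
    · have a2 : a 2 ≠ 0 := fun a2 => ha (by ext i; fin_cases i <;> assumption)
      refine ⟨b 2 / a 2, ?_⟩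
      ext i; fin_cases i <;> simp <;> field_simp <;> linarith
    · refine ⟨b 1 / a 1, ?_⟩
      ext i; fin_cases i <;> simp <;> field_simp <;> linarith
  · refine ⟨b 0 / a 0, ?_⟩
    ext i; fin_cases i <;> simp <;> field_simp <;> linarith

theorem eta_mul_eta : eta * eta = 1 := by
  rw [eta, Matrix.diagonal_mul_diagonal]
  simp [etaDiag_mul_self]

/-- A proper Lorentz transformation together with a matrix implementing it on spinors. -/
structure IsLorentz (s : ℝ) (L : Matrix (Fin 3) (Fin 3) ℝ) (S : Mat2) : Prop where
  lorentz : Lᵀ * eta * L = eta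
  det_one : L.det = 1
  unit_S : IsUnit S
  spin : ∀ ν, S⁻¹ * (∑ α, (L ν α : ℂ) • gam s α) * S = gam s ν

theorem isLorentz_one (s : ℝ) : IsLorentz s 1 1 := by
  refine ⟨by simp, by simp, isUnit_one, fun ν => ?_⟩
  simp [Matrix.one_apply]

theorem mul_eta_mul_transpose {L : Matrix (Fin 3) (Fin 3) ℝ} (h : Lᵀ * eta * L = eta) :
    L * eta * Lᵀ = eta := by
  have h1 : (eta * Lᵀ * eta) * L = 1 := by
    rw [Matrix.mul_assoc, Matrix.mul_assoc, ← Matrix.mul_assoc Lᵀ, h, eta_mul_eta]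
  have h2 := mul_eq_one_comm.1 h1
  calc L * eta * Lᵀ = L * (eta * Lᵀ * eta) * eta := by
        simp only [Matrix.mul_assoc, eta_mul_eta, mul_one]
    _ = eta := by rw [h2, one_mul]

theorem lform_mulVec {L : Matrix (Fin 3) (Fin 3) ℝ} (h : Lᵀ * eta * L = eta) (a b : Fin 3 → ℝ) :
    lform (L *ᵥ a) (L *ᵥ b) = lform a b := by
  have e : ∀ a b : Fin 3 → ℝ, lform a b = a ⬝ᵥ (eta *ᵥ b) := fun a b => by
    simp [lform, eta, Matrix.mulVec_diagonal, dotProduct, Fin.sum_univ_three, etaDiag]; ring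
  rw [e, e, Matrix.mulVec_mulVec, ← Matrix.vecMul_transpose, ← Matrix.dotProduct_mulVec,
    Matrix.mulVec_mulVec, ← Matrix.mul_assoc, h]

/-- For every matrix L the cofactor identity det(L) (a × b) = ηLᵀη (La × Lb) holds; for a proper
Lorentz matrix the determinant is 1 and ηLᵀη is the inverse of L. -/
theorem mulVec_lcross {L : Matrix (Fin 3) (Fin 3) ℝ} (h : Lᵀ * eta * L = eta) (hd : L.det = 1)
    (a b : Fin 3 → ℝ) : L *ᵥ lcross a b = lcross (L *ᵥ a) (L *ᵥ b) := by
  have h1 : lcross a b = (eta * Lᵀ * eta) *ᵥ lcross (L *ᵥ a) (L *ᵥ b) := by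
    have e : lcross a b = L.det • lcross a b := by rw [hd, one_smul]
    rw [e, ← Matrix.mulVec_mulVec, ← Matrix.mulVec_mulVec]
    ext i
    fin_cases i <;> simp [lcross, eta, Matrix.mulVec, dotProduct,
      Fin.sum_univ_three, Matrix.det_fin_three, Matrix.diagonal_apply, etaDiag] <;> ring
  rw [h1, Matrix.mulVec_mulVec]
  have h2 : L * (eta * Lᵀ * eta) = 1 := by
    rw [← Matrix.mul_assoc, ← Matrix.mul_assoc, mul_eta_mul_transpose h, eta_mul_eta]
  rw [h2, Matrix.one_mulVec]

/-- The half-turn about a non-null vector. -/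
def halfTurn (n : Fin 3 → ℝ) : Matrix (Fin 3) (Fin 3) ℝ :=
  Matrix.of fun i j => 2 * n i * (etaDiag j * n j) / lform n n - if i = j then 1 else 0

theorem halfTurn_mulVec (n v : Fin 3 → ℝ) :
    halfTurn n *ᵥ v = (2 * lform n v / lform n n) • n - v := by
  ext i
  fin_cases i <;>
    simp [halfTurn, Matrix.mulVec, dotProduct, Fin.sum_univ_three, lform, etaDiag] <;> ring

/-- The spinor matrix is the Clifford element n_α γ^α, whose square is (n, n). Conjugation by it is
minus the reflection in n, which has determinant 1 in dimension three. Half-turns thus give Lorentz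
maps with explicit spinor matrices and without exponentials. -/
theorem isLorentz_halfTurn {s : ℝ} (hs : s = 1 ∨ s = -1) {n : Fin 3 → ℝ} (hn : lform n n ≠ 0) :
    IsLorentz s (halfTurn n) (∑ α, ((etaDiag α * n α : ℝ) : ℂ) • gam s α) := by
  have hI : Complex.I * Complex.I = -1 := Complex.I_mul_I
  have hsc : (s : ℂ) * s = 1 := by rcases hs with rfl | rfl <;> simp
  set S : Mat2 := ∑ α, ((etaDiag α * n α : ℝ) : ℂ) • gam s α with hS
  have hSS : S * S = (lform n n : ℂ) • (1 : Mat2) := by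
    rw [hS]
    ext i j
    fin_cases i <;> fin_cases j <;>
      simp [Fin.sum_univ_three, gam, etaDiag, lform, Matrix.mul_apply] <;> grind
  have hqc : (lform n n : ℂ) ≠ 0 := by exact_mod_cast hn
  have hu : IsUnit S := by
    refine (Matrix.isUnit_iff_isUnit_det S).2 (isUnit_iff_ne_zero.2 fun h => ?_)
    have := congrArg Matrix.det hSS
    rw [Matrix.det_mul, h, Matrix.det_smul] at this
    simp only [zero_mul, Fintype.card_fin, Matrix.det_one, mul_one] at this
    exact pow_ne_zero 2 hqc this.symm
  refine ⟨?_, ?_, hu, fun ν => ?_⟩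
  · ext i j
    have hn' : n 0 ^ 2 - n 1 ^ 2 - n 2 ^ 2 ≠ 0 := by
      simp only [pow_two]; exact hn
    fin_cases i <;> fin_cases j <;>
      simp [halfTurn, eta, Matrix.mul_apply, Fin.sum_univ_three, lform, etaDiag,
        Matrix.diagonal_apply] <;> field_simp <;> ring
  · have hn' : n 0 ^ 2 - n 1 ^ 2 - n 2 ^ 2 ≠ 0 := by
      simp only [pow_two]; exact hn
    simp [halfTurn, Matrix.det_fin_three, lform, etaDiag]
    field_simp
    ring
  · have hn' : n 0 ^ 2 - n 1 ^ 2 - n 2 ^ 2 ≠ 0 := by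
      simp only [pow_two]; exact hn
    have key : (∑ α, (halfTurn n ν α : ℂ) • gam s α) =
        (2 * n ν / lform n n : ℂ) • S - gam s ν := by
      rw [hS]
      simp only [halfTurn, Fin.sum_univ_three, Matrix.of_apply]
      push_cast
      fin_cases ν <;> simp [-Complex.coe_smul] <;> match_scalars <;> ring
    have hanti : S * gam s ν = (2 * n ν : ℂ) • (1 : Mat2) - gam s ν * S := by
      rw [hS]
      ext i j
      fin_cases ν <;> fin_cases i <;> fin_cases j <;>
        simp [Fin.sum_univ_three, gam, etaDiag, Matrix.mul_apply] <;> grind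
    have h1 : (∑ α, (halfTurn n ν α : ℂ) • gam s α) * S = S * gam s ν := by
      rw [key, hanti, Matrix.sub_mul, Matrix.smul_mul, hSS, smul_smul, div_mul_cancel₀ _ hqc]
    rw [Matrix.mul_assoc, h1, ← Matrix.mul_assoc, Matrix.nonsing_inv_mul _
      ((Matrix.isUnit_iff_isUnit_det S).1 hu), Matrix.one_mul]

/-- Vectors of equal square are exchanged by the half-turn about their sum; the second hypothesis
says that this sum is not null. -/
theorem exists_isLorentz_of_lform {s : ℝ} (hs : s = 1 ∨ s = -1) {v t : Fin 3 → ℝ}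
    (hq : lform v v = lform t t) (h : lform v v + lform v t ≠ 0) :
    ∃ L S, IsLorentz s L S ∧ L *ᵥ v = t := by
  have e : lform (v + t) (v + t) = 2 * (lform v v + lform v t) := by
    have : lform (v + t) (v + t) = lform v v + 2 * lform v t + lform t t := by
      simp [lform]; ring
    rw [this, ← hq]; ring
  have e' : 2 * lform (v + t) v = lform (v + t) (v + t) := by
    rw [e]; simp [lform]; ring
  have hn : lform (v + t) (v + t) ≠ 0 := by rw [e]; exact mul_ne_zero two_ne_zero h
  refine ⟨_, _, isLorentz_halfTurn hs hn, ?_⟩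
  rw [halfTurn_mulVec, e', div_self hn, one_smul, add_sub_cancel_left]

/-- If v + re is null then v - re is not, because (v, v) ≠ 0; so one of the two signs of r always
admits a half-turn. -/
theorem exists_isLorentz_smul {s : ℝ} (hs : s = 1 ∨ s = -1) {v e : Fin 3 → ℝ} {r : ℝ}
    (hv : lform v v ≠ 0) (hq : lform v v = r ^ 2 * lform e e) :
    ∃ L S, ∃ r : ℝ, r ≠ 0 ∧ IsLorentz s L S ∧ L *ᵥ v = r • e := by
  have hr : r ≠ 0 := by rintro rfl; simp [hq] at hv
  have h1 : lform (r • e) (r • e) = r ^ 2 * lform e e := by simp [lform]; ring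
  have h2 : lform v (-(r • e)) = -lform v (r • e) := by simp [lform]; ring
  by_cases h : lform v v + lform v (r • e) = 0
  · obtain ⟨L, S, hL, hv'⟩ := exists_isLorentz_of_lform hs (v := v) (t := (-r) • e)
      (by rw [hq]; simp [lform]; ring) (by
        rw [neg_smul, h2, ← eq_neg_of_add_eq_zero_left h, ← two_mul]
        exact mul_ne_zero two_ne_zero hv)
    exact ⟨L, S, -r, neg_ne_zero.2 hr, hL, hv'⟩
  · obtain ⟨L, S, hL, hv'⟩ := exists_isLorentz_of_lform hs (by rw [hq, h1]) h
    exact ⟨L, S, r, hr, hL, hv'⟩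

theorem exists_isLorentz_timelike {s : ℝ} (hs : s = 1 ∨ s = -1) {v : Fin 3 → ℝ}
    (hv : 0 < lform v v) : ∃ L S, ∃ r : ℝ, r ≠ 0 ∧ IsLorentz s L S ∧ L *ᵥ v = r • ![1, 0, 0] :=
  exists_isLorentz_smul hs (r := Real.sqrt (lform v v)) hv.ne'
    (by rw [Real.sq_sqrt hv.le]; simp [lform])

theorem exists_isLorentz_spacelike {s : ℝ} (hs : s = 1 ∨ s = -1) {v e : Fin 3 → ℝ}
    (hv : lform v v < 0) (he : lform e e = -1) :
    ∃ L S, ∃ r : ℝ, r ≠ 0 ∧ IsLorentz s L S ∧ L *ᵥ v = r • e :=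
  exists_isLorentz_smul hs (r := Real.sqrt (-lform v v)) hv.ne
    (by rw [Real.sq_sqrt (by linarith), he]; ring)

/-- A null vector orthogonal to (1, 0, 1) is proportional to it; any other null vector has a
non-null sum with (1, 0, 1), and a half-turn applies. -/
theorem exists_isLorentz_null {s : ℝ} (hs : s = 1 ∨ s = -1) {v : Fin 3 → ℝ} (hv0 : v ≠ 0)
    (hv : lform v v = 0) : ∃ L S, ∃ r : ℝ, r ≠ 0 ∧ IsLorentz s L S ∧ L *ᵥ v = r • ![1, 0, 1] := by
  by_cases h : lform v ![1, 0, 1] = 0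
  · have h02 : v 0 = v 2 := by simp [lform] at h; linarith
    have h1 : v 1 = 0 := by
      simp [lform, h02] at hv; exact hv
    have e : v = v 0 • ![1, 0, 1] := by ext i; fin_cases i <;> simp [h1, h02]
    refine ⟨1, 1, v 0, fun h0 => hv0 (by rw [e, h0, zero_smul]), isLorentz_one s, ?_⟩
    rw [Matrix.one_mulVec]
    exact e
  · obtain ⟨L, S, hL, hv'⟩ := exists_isLorentz_of_lform hs (v := v) (t := ![1, 0, 1])
      (by rw [hv]; simp [lform]) (by rwa [hv, zero_add])
    exact ⟨L, S, 1, one_ne_zero, hL, by rw [hv', one_smul]⟩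

/-! ### Classification of commuting pairs of Killing fields -/

theorem exists_comb_of_eq_comb {M : Type*} [AddCommGroup M] [Module ℝ M] {f b : Fin 2 → M}
    {P : Matrix (Fin 2) (Fin 2) ℝ} (hP : P.det ≠ 0) (h : ∀ k, f k = ∑ i, P k i • b i) :
    ∃ c : Matrix (Fin 2) (Fin 2) ℝ, IsUnit c ∧ ∀ j, ∑ k, c j k • f k = b j := by
  have hu : IsUnit P.det := isUnit_iff_ne_zero.2 hP
  refine ⟨P⁻¹, (Matrix.isUnit_nonsing_inv_iff).2 ((Matrix.isUnit_iff_isUnit_det P).2 hu), fun j => ?_⟩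
  have h1 : ∀ i, ∑ k, P⁻¹ j k * P k i = if j = i then 1 else 0 := fun i => by
    rw [← Matrix.mul_apply, Matrix.nonsing_inv_mul _ hu, Matrix.one_apply]
  simp only [h, Finset.smul_sum, smul_smul]
  rw [Finset.sum_comm]
  simp only [← Finset.sum_smul, h1]
  simp

theorem comb_comb {M : Type*} [AddCommGroup M] [Module ℝ M] {f b : Fin 2 → M}
    {P Q : Matrix (Fin 2) (Fin 2) ℝ} (h : ∀ k, ∑ i, P k i • f i = b k) (j : Fin 2) :
    ∑ k, (Q * P) j k • f k = ∑ k, Q j k • b k := by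
  simp only [← h, Finset.smul_sum, smul_smul, Matrix.mul_apply, Finset.sum_smul]
  exact Finset.sum_comm

/-- The Poincaré transformation with given linear part and translation. -/
def IsLorentz.toPoincare {s : ℝ} {L : Matrix (Fin 3) (Fin 3) ℝ} {S : Mat2} (h : IsLorentz s L S)
    (b : Fin 3 → ℝ) : Poincare s := ⟨L, b, S, h.lorentz, h.det_one, h.unit_S, h.spin⟩

theorem Poincare.mulVec_field {s : ℝ} (g : Poincare s) (θ w x : Fin 3 → ℝ) :
    g.L *ᵥ (lcross θ (g.invAct x) + w) = lcross (g.L *ᵥ θ) (x - g.b) + g.L *ᵥ w := by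
  have hu : IsUnit g.L.det := by rw [g.det_one]; exact isUnit_one
  rw [Matrix.mulVec_add, mulVec_lcross g.lorentz g.det_one, Poincare.invAct, Matrix.mulVec_mulVec,
    Matrix.mul_nonsing_inv _ hu, Matrix.one_mulVec]

/-- A plane of translations is the orthogonal complement of its normal w₀ × w₁. Moving the normal to
a multiple of a standard vector e moves the plane onto the complement of e: timelike, null and
spacelike normals give the three translation rows. -/
theorem exists_poincare_of_translations {s : ℝ} (hs : s = 1 ∨ s = -1) {w : Fin 2 → Fin 3 → ℝ}
    (hw : lcross (w 0) (w 1) ≠ 0) :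
    ∃ (κ : SetKind) (g : Poincare s) (c : Matrix (Fin 2) (Fin 2) ℝ), IsUnit c ∧
      ∀ j x, ∑ k, c j k • (g.L *ᵥ w k) = κ.killing j x := by
  have key : ∀ {L S} (_ : IsLorentz s L S) {e : Fin 3 → ℝ} (_ : e ≠ 0) {r : ℝ} (_ : r ≠ 0)
      (_ : L *ᵥ lcross (w 0) (w 1) = r • e) (κ : SetKind) (b : Fin 2 → Fin 3 → ℝ)
      (_ : ∀ j x, κ.killing j x = b j)
      (_ : ∀ v, lform e v = 0 → ∃ p : Fin 2 → ℝ, v = ∑ i, p i • b i),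
      ∃ (κ : SetKind) (g : Poincare s) (c : Matrix (Fin 2) (Fin 2) ℝ), IsUnit c ∧
      ∀ j x, ∑ k, c j k • (g.L *ᵥ w k) = κ.killing j x := by
    intro L S hL e he r hr hLe κ b hκ hb
    have horth : ∀ k, lform e (L *ᵥ w k) = 0 := by
      intro k
      have h1 : lform (r • e) (L *ᵥ w k) = 0 := by
        rw [← hLe, lform_mulVec hL.lorentz]
        fin_cases k
        exacts [lform_lcross_left _ _, lform_lcross_right _ _]
      have h2 : lform (r • e) (L *ᵥ w k) = r * lform e (L *ᵥ w k) := by simp [lform]; ring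
      exact (mul_eq_zero.1 (h2 ▸ h1)).resolve_left hr
    choose p hp using fun k => hb _ (horth k)
    -- The transformed normal is det(p) times the normal of the standard pair, and it is not zero.
    have hdet : (Matrix.of p).det ≠ 0 := by
      intro h0
      have h1 : L *ᵥ lcross (w 0) (w 1) = (Matrix.of p).det • lcross (b 0) (b 1) := by
        rw [mulVec_lcross hL.lorentz hL.det_one, hp 0, hp 1]
        ext i
        fin_cases i <;> simp [lcross, Fin.sum_univ_two, Matrix.det_fin_two] <;> ring
      rw [h0, zero_smul, hLe] at h1
      exact (smul_ne_zero hr he) h1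
    obtain ⟨c, hc, h⟩ := exists_comb_of_eq_comb (b := b) hdet hp
    exact ⟨κ, hL.toPoincare 0, c, hc, fun j x => by rw [hκ]; exact h j⟩
  rcases lt_trichotomy (lform (lcross (w 0) (w 1)) (lcross (w 0) (w 1))) 0 with h | h | h
  · obtain ⟨L, S, r, hr, hL, hv⟩ := exists_isLorentz_spacelike hs (e := ![0, 0, 1]) h
      (by simp [lform])
    refine key hL (by intro h; simpa using congrFun h 2) hr hv .p0p1
      ![Pi.single 0 1, Pi.single 1 1] (fun j x => by fin_cases j <;> rfl) fun v hv => ?_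
    simp [lform] at hv
    refine ⟨![v 0, v 1], ?_⟩
    ext i; fin_cases i <;> simp [hv]
  · obtain ⟨L, S, r, hr, hL, hv⟩ := exists_isLorentz_null hs hw h
    refine key hL (by intro h; simpa using congrFun h 0) hr hv .p1null
      ![Pi.single 1 1, (1 / 2 : ℝ) • (Pi.single 0 1 + Pi.single 2 1)]
      (fun j x => by fin_cases j <;> rfl) fun v hv => ?_
    simp [lform] at hv
    refine ⟨![v 1, 2 * v 0], ?_⟩
    ext i; fin_cases i <;> simp <;> linarith
  · obtain ⟨L, S, r, hr, hL, hv⟩ := exists_isLorentz_timelike hs h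
    refine key hL (by intro h; simpa using congrFun h 0) hr hv .p1p2
      ![Pi.single 1 1, Pi.single 2 1] (fun j x => by fin_cases j <;> rfl) fun v hv => ?_
    simp [lform] at hv
    refine ⟨![v 1, v 2], ?_⟩
    ext i; fin_cases i <;> simp [hv]

/-- The pair is the translation θ and a field with axis θ. Moving the origin changes w by the image
of θ × ·, which is the orthogonal complement of θ, and subtracting multiples of θ changes it along
θ. For non-null θ this removes w entirely; a null θ lies in its own complement, so one component of
w survives and becomes the parameter a. -/
theorem exists_poincare_of_rotation {s : ℝ} (hs : s = 1 ∨ s = -1) {θ : Fin 3 → ℝ} (hθ : θ ≠ 0)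
    (w : Fin 3 → ℝ) :
    ∃ (κ : SetKind) (g : Poincare s) (Q : Matrix (Fin 2) (Fin 2) ℝ), IsUnit Q ∧
      ∀ j x, Q j 0 • (g.L *ᵥ θ) + Q j 1 • (lcross (g.L *ᵥ θ) (x - g.b) + g.L *ᵥ w) =
        κ.killing j x := by
  have hunit : ∀ {p q y : ℝ}, p ≠ 0 → q ≠ 0 → IsUnit (!![p, 0; y, q] : Matrix (Fin 2) (Fin 2) ℝ) := by
    intro p q y hp hq
    rw [Matrix.isUnit_iff_isUnit_det, Matrix.det_fin_two_of, isUnit_iff_ne_zero]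
    simp [hp, hq]
  rcases lt_trichotomy (lform θ θ) 0 with h | h | h
  · obtain ⟨L, S, r, hr, hL, hv⟩ := exists_isLorentz_spacelike hs (e := ![0, 1, 0]) h
      (by simp [lform])
    set W := L *ᵥ w
    refine ⟨.p1l02, hL.toPoincare ![W 2 / r, 0, W 0 / r], !![1 / r, 0; -W 1 / r ^ 2, 1 / r],
      hunit (by positivity) (by positivity), fun j x => ?_⟩
    change _ • (L *ᵥ θ) + _ • (lcross (L *ᵥ θ) (x - ![W 2 / r, 0, W 0 / r]) + W) = _
    rw [hv]
    ext i
    fin_cases j <;> fin_cases i <;>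
      simp [SetKind.killing, lcross, pVec, lVec, etaDiag, Matrix.vecHead,
        Matrix.vecTail] <;> field_simp <;> ring
  · obtain ⟨L, S, r, hr, hL, hv⟩ := exists_isLorentz_null hs hθ h
    set W := L *ᵥ w
    refine ⟨.nullRot ((W 2 - W 0) / (2 * r)), hL.toPoincare ![0, 0, W 1 / r],
      !![1 / (2 * r), 0; (W 0 + W 2) / (2 * r ^ 2), -1 / r],
      hunit (by positivity) (div_ne_zero (by norm_num) hr), fun j x => ?_⟩
    change _ • (L *ᵥ θ) + _ • (lcross (L *ᵥ θ) (x - ![0, 0, W 1 / r]) + W) = _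
    rw [hv]
    ext i
    fin_cases j <;> fin_cases i <;>
      simp [SetKind.killing, lcross, pVec, lVec, etaDiag, Matrix.vecHead,
        Matrix.vecTail] <;> field_simp <;> ring
  · obtain ⟨L, S, r, hr, hL, hv⟩ := exists_isLorentz_timelike hs h
    set W := L *ᵥ w
    refine ⟨.p0l21, hL.toPoincare ![0, -W 2 / r, W 1 / r], !![1 / r, 0; W 0 / r ^ 2, -1 / r],
      hunit (by positivity) (div_ne_zero (by norm_num) hr), fun j x => ?_⟩
    change _ • (L *ᵥ θ) + _ • (lcross (L *ᵥ θ) (x - ![0, -W 2 / r, W 1 / r]) + W) = _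
    rw [hv]
    ext i
    fin_cases j <;> fin_cases i <;>
      simp [SetKind.killing, lcross, pVec, lVec, etaDiag, Matrix.vecHead,
        Matrix.vecTail] <;> field_simp <;> ring

/-- Since the axes are parallel, some combination has no rotational part. Commutation forces this
translation to be parallel to the axis, independence makes it nonzero, and rescaling makes it equal
to the axis vector. -/
theorem exists_normal_pair {θ w : Fin 2 → Fin 3 → ℝ} (hθ : θ ≠ 0)
    (hpar : lcross (θ 0) (θ 1) = 0) (hcomm : lcross (θ 1) (w 0) = lcross (θ 0) (w 1))
    (hind : ∀ c : Fin 2 → ℝ, ∑ j, c j • θ j = 0 → ∑ j, c j • w j = 0 → c = 0) :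
    ∃ (P : Matrix (Fin 2) (Fin 2) ℝ) (v u : Fin 3 → ℝ), v ≠ 0 ∧ IsUnit P ∧
      ∑ k, P 0 k • θ k = 0 ∧ ∑ k, P 0 k • w k = v ∧ ∑ k, P 1 k • θ k = v ∧
        ∑ k, P 1 k • w k = u := by
  by_cases h0 : θ 0 = 0
  · have h1 : θ 1 ≠ 0 := fun h1 => hθ (by funext k; fin_cases k <;> assumption)
    have hc : lcross (θ 1) (w 0) = 0 := by rw [hcomm, h0]; ext i; fin_cases i <;> simp [lcross]
    obtain ⟨ρ, hρ⟩ := exists_smul_of_lcross_eq_zero h1 hc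
    have hρ0 : ρ ≠ 0 := by
      rintro rfl
      have := hind ![1, 0] (by simp [h0]) (by simp [hρ])
      simpa using congrFun this 0
    refine ⟨!![1 / ρ, 0; 0, 1], θ 1, w 1, h1, ?_, ?_, ?_, ?_, ?_⟩
    · rw [Matrix.isUnit_iff_isUnit_det, Matrix.det_fin_two_of, isUnit_iff_ne_zero]
      simp [hρ0]
    · simp [h0]
    · simp [hρ, smul_smul, hρ0]
    · simp
    · simp
  · obtain ⟨t, ht⟩ := exists_smul_of_lcross_eq_zero h0 hpar
    have hc : lcross (θ 0) (t • w 0 - w 1) = 0 := by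
      rw [lcross_sub_right, lcross_smul_right, ← lcross_smul_left, ← ht, hcomm, sub_self]
    obtain ⟨ρ, hρ⟩ := exists_smul_of_lcross_eq_zero h0 hc
    have hρ0 : ρ ≠ 0 := by
      rintro rfl
      have := hind ![t, -1] (by simp [ht]) (by simpa [sub_eq_add_neg] using hρ)
      simpa using congrFun this 1
    -- From θ₁ = tθ₀ the combination with coefficients (t, -1) is a translation, equal to ρθ₀; the
    -- first row divides it by ρ.
    refine ⟨!![t / ρ, -1 / ρ; 1, 0], θ 0, w 0, h0, ?_, ?_, ?_, ?_, ?_⟩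
    · rw [Matrix.isUnit_iff_isUnit_det, Matrix.det_fin_two_of, isUnit_iff_ne_zero]
      simp [hρ0]
    · simp [ht]
      module
    · have e : θ 0 = (1 / ρ) • (t • w 0 - w 1) := by rw [hρ, smul_smul]; simp [hρ0]
      rw [e]
      simp
      module
    · simp
    · simp

/-- Without rotational parts the pair spans a plane of translations; otherwise the normal form with
a translation along the axis applies. -/
theorem exists_poincare_of_commuting {s : ℝ} (hs : s = 1 ∨ s = -1) {θ w : Fin 2 → Fin 3 → ℝ}
    (hpar : lcross (θ 0) (θ 1) = 0) (hcomm : lcross (θ 1) (w 0) = lcross (θ 0) (w 1))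
    (hind : ∀ c : Fin 2 → ℝ, ∑ j, c j • θ j = 0 → ∑ j, c j • w j = 0 → c = 0) :
    ∃ (κ : SetKind) (g : Poincare s) (c : Matrix (Fin 2) (Fin 2) ℝ), IsUnit c ∧
      ∀ j x, ∑ k, c j k • (g.L *ᵥ (lcross (θ k) (g.invAct x) + w k)) = κ.killing j x := by
  by_cases hθ : θ = 0
  · have hw : lcross (w 0) (w 1) ≠ 0 := by
      intro h
      by_cases h0 : w 0 = 0
      · have := hind ![1, 0] (by simp [hθ]) (by simp [h0])
        simpa using congrFun this 0
      · obtain ⟨t, ht⟩ := exists_smul_of_lcross_eq_zero h0 h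
        have := hind ![t, -1] (by simp [hθ]) (by simp [ht])
        simpa using congrFun this 1
    obtain ⟨κ, g, c, hc, h⟩ := exists_poincare_of_translations hs hw
    refine ⟨κ, g, c, hc, fun j x => ?_⟩
    rw [← h j x]
    refine Finset.sum_congr rfl fun k _ => ?_
    have : lcross (θ k) (g.invAct x) = 0 := by rw [hθ]; ext i; fin_cases i <;> simp [lcross]
    rw [this, zero_add]
  · obtain ⟨P, v, u, hv, hP, h1, h2, h3, h4⟩ := exists_normal_pair hθ hpar hcomm hind
    obtain ⟨κ, g, Q, hQ, h⟩ := exists_poincare_of_rotation hs hv u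
    refine ⟨κ, g, Q * P, hQ.mul hP, fun j x => ?_⟩
    have hcr : ∀ c : Fin 2 → ℝ, ∑ k, c k • lcross (θ k) (g.invAct x) =
        lcross (∑ k, c k • θ k) (g.invAct x) := fun c => by
      simp only [Fin.sum_univ_two, lcross_add_left, lcross_smul_left]
    have hlin : ∀ c : Fin 2 → ℝ, ∑ k, c k • (g.L *ᵥ (lcross (θ k) (g.invAct x) + w k)) =
        g.L *ᵥ (lcross (∑ k, c k • θ k) (g.invAct x) + ∑ k, c k • w k) := fun c => by
      rw [← hcr, ← Finset.sum_add_distrib]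
      simp only [← smul_add, ← Matrix.mulVec_smul, ← Matrix.mulVec_sum]
    rw [comb_comb (b := ![g.L *ᵥ v, lcross (g.L *ᵥ v) (x - g.b) + g.L *ᵥ u]) (fun k => ?_),
      Fin.sum_univ_two, ← h j x]
    · simp
    · rw [hlin]
      fin_cases k
      · simp only [Fin.zero_eta, h1, h2]
        have : lcross 0 (g.invAct x) = 0 := by ext i; fin_cases i <;> simp [lcross]
        rw [this, zero_add]; rfl
      · simp only [Fin.mk_one, h3, h4, g.mulVec_field]
        rfl

/-! ### Killing fields on a connected open set -/

theorem eq_of_pd_eq_zero_of_isPreconnected {E : Type*} [NormedAddCommGroup E] [NormedSpace ℝ E]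
    {U : Set Spacetime} (hU : IsOpen U) (hc : IsPreconnected U) {f : Spacetime → E}
    (hf : DifferentiableOn ℝ f U) (h : ∀ x ∈ U, ∀ ν, pd ν f x = 0) {x y : Spacetime} (hx : x ∈ U)
    (hy : y ∈ U) : f x = f y := by
  refine hU.is_const_of_fderiv_eq_zero hc hf (fun z hz => ?_) hx hy
  ext v
  rw [fderiv_eq_sum_pd]
  simp [h z hz]

theorem pd_lcross (θ : Fin 3 → ℝ) (μ i : Fin 3) (x : Spacetime) :
    pd μ (fun y => lcross θ y i) x = lcross θ (Pi.single μ 1) i := by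
  fin_cases i <;> fin_cases μ <;>
    simp (disch := fun_prop) [lcross, pd_sub, pd_mul, pd_coord, Pi.single_apply]

theorem contDiff_lcross (θ : Fin 3 → ℝ) (i : Fin 3) : ContDiff ℝ ∞ fun y => lcross θ y i := by
  fin_cases i <;> simp [lcross] <;> fun_prop

/-- The gradient is constant on the connected set since the second derivatives vanish, and in
dimension three every matrix antisymmetric with respect to η is a Lorentzian cross product. -/
theorem exists_lcross_of_killing {U : Set Spacetime} (hU : IsOpen U) (hc : IsConnected U)
    {xi : Spacetime → Fin 3 → ℝ} (hxi : ContDiffOn ℝ ∞ xi U) (hK : ∀ x ∈ U, KillingAt xi x) :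
    ∃ θ w : Fin 3 → ℝ, ∀ x ∈ U, xi x = lcross θ x + w := by
  obtain ⟨x₀, hx₀⟩ := hc.nonempty
  have hs : ∀ i, ContDiffOn ℝ ∞ (fun y => xi y i) U := contDiffOn_pi.1 hxi
  have hd : ∀ i, ∀ x ∈ U, DifferentiableAt ℝ (fun y => xi y i) x := fun i x hx =>
    ((hs i).contDiffAt (hU.mem_nhds hx)).differentiableAt (by simp)
  have hconst : ∀ μ i, ∀ x ∈ U, pd μ (fun y => xi y i) x = pd μ (fun y => xi y i) x₀ :=
    fun μ i x hx => eq_of_pd_eq_zero_of_isPreconnected hU hc.isPreconnected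
      ((contDiffOn_pd hU (hs i) μ).differentiableOn (by simp))
      (fun z hz ν => pd_pd_eq_zero_of_killing hU hxi hK hz ν μ i) hx hx₀
  let θ : Fin 3 → ℝ := ![pd 2 (fun y => xi y 1) x₀, pd 2 (fun y => xi y 0) x₀,
    -pd 1 (fun y => xi y 0) x₀]
  have hθ : ∀ μ i, lcross θ (Pi.single μ 1) i = pd μ (fun y => xi y i) x₀ := by
    intro μ i
    have h00 := hK x₀ hx₀ 0 0
    have h11 := hK x₀ hx₀ 1 1
    have h22 := hK x₀ hx₀ 2 2
    have h01 := hK x₀ hx₀ 0 1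
    have h02 := hK x₀ hx₀ 0 2
    have h12 := hK x₀ hx₀ 1 2
    simp only [etaDiag, Matrix.cons_val_zero, Matrix.cons_val_one, Matrix.cons_val] at *
    fin_cases μ <;> fin_cases i <;> simp [lcross, θ] <;> linarith
  refine ⟨θ, xi x₀ - lcross θ x₀, fun x hx => ?_⟩
  have hl : ∀ i (x : Spacetime), DifferentiableAt ℝ (fun y => lcross θ y i) x := fun i x =>
    (contDiff_lcross θ i).differentiable (by simp) x
  ext i
  have h := eq_of_pd_eq_zero_of_isPreconnected hU hc.isPreconnected
    (f := fun y => xi y i - lcross θ y i)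
    (fun z hz => ((hd i z hz).fun_sub (hl i z)).differentiableWithinAt)
    (fun z hz ν => by rw [pd_sub (hd i z hz) (hl i z), pd_lcross, hθ, hconst ν i z hz, sub_self])
    hx hx₀
  simp only [Pi.add_apply, Pi.sub_apply]
  linarith

/-- Differentiation in the coordinate directions gives all the products θ × e_μ, and these determine
θ. -/
theorem eq_zero_of_lcross_add_eq_zero {U : Set Spacetime} (hU : IsOpen U) (hn : U.Nonempty)
    {θ w : Fin 3 → ℝ} (h : ∀ x ∈ U, lcross θ x + w = 0) : θ = 0 ∧ w = 0 := by
  obtain ⟨x₀, hx₀⟩ := hn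
  have hz : ∀ μ i, lcross θ (Pi.single μ 1) i = 0 := by
    intro μ i
    have h1 := pd_congr hU (f := fun y => lcross θ y i) (g := fun _ => -w i)
      (fun y hy => eq_neg_of_add_eq_zero_left (congrFun (h y hy) i)) hx₀ μ
    rwa [pd_lcross, pd_const] at h1
  have hθ : θ = 0 := by
    ext i
    fin_cases i
    · simpa [lcross] using hz 2 1
    · simpa [lcross] using hz 2 0
    · simpa [lcross] using hz 1 0
  refine ⟨hθ, ?_⟩
  have := h x₀ hx₀
  rw [hθ] at this
  ext i
  have hi := congrFun this i
  fin_cases i <;> simpa [lcross] using hi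

/-- Two commuting linearly independent Killing fields on a connected open set are equivalent to a
pair of the table. -/
theorem exists_poincare_of_killing {s : ℝ} (hs : s = 1 ∨ s = -1) {U : Set Spacetime}
    (hU : IsOpen U) (hc : IsConnected U) {xi : Fin 2 → Spacetime → Fin 3 → ℝ}
    (hxi : ∀ k, ContDiffOn ℝ ∞ (xi k) U) (hK : ∀ k, ∀ x ∈ U, KillingAt (xi k) x)
    (hbr : ∀ x ∈ U, ∀ μ, ∑ ν, (xi 0 x ν * pd ν (fun y => xi 1 y μ) x -
      xi 1 x ν * pd ν (fun y => xi 0 y μ) x) = 0)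
    (hind : ∀ c : Fin 2 → ℝ, (∀ x ∈ U, ∑ j, c j • xi j x = 0) → ∀ j, c j = 0) :
    ∃ (κ : SetKind) (g : Poincare s) (c : Matrix (Fin 2) (Fin 2) ℝ), IsUnit c ∧
      ∀ j x, g.invAct x ∈ U → ∑ k, c j k • (g.L *ᵥ xi k (g.invAct x)) = κ.killing j x := by
  choose θ w hθ using fun k => exists_lcross_of_killing hU hc (hxi k) (hK k)
  have hl : ∀ k i (x : Spacetime), DifferentiableAt ℝ (fun y => lcross (θ k) y i) x := fun k i x =>
    (contDiff_lcross (θ k) i).differentiable (by simp) x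
  have hpd : ∀ k, ∀ x ∈ U, ∀ ν μ, pd ν (fun y => xi k y μ) x =
      lcross (θ k) (Pi.single ν 1) μ := by
    intro k x hx ν μ
    rw [pd_congr hU (g := fun y => lcross (θ k) y μ + w k μ) (fun y hy => by rw [hθ k y hy]; rfl)
      hx, pd_add (hl k μ x) (differentiableAt_const _), pd_lcross, pd_const, add_zero]
  have hvec : ∀ k (v : Fin 3 → ℝ) μ, ∑ ν, v ν * lcross (θ k) (Pi.single ν 1) μ =
      lcross (θ k) v μ := by
    intro k v μ
    fin_cases μ <;> simp [Fin.sum_univ_three, lcross] <;> ring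
  -- By the Jacobi identity the bracket is, up to sign, the affine field with axis θ₀ × θ₁ and
  -- translation θ₀ × w₁ - θ₁ × w₀, so both parts vanish separately.
  have hbr' : ∀ x ∈ U, lcross (lcross (θ 0) (θ 1)) x +
      (lcross (θ 0) (w 1) - lcross (θ 1) (w 0)) = 0 := by
    intro x hx
    ext μ
    have h := hbr x hx μ
    simp only [hpd _ x hx, Finset.sum_sub_distrib, hvec, hθ _ x hx] at h
    rw [Pi.zero_apply, ← neg_eq_zero, ← h]
    fin_cases μ <;> simp [lcross] <;> ring
  obtain ⟨h1, h2⟩ := eq_zero_of_lcross_add_eq_zero hU hc.nonempty hbr'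
  obtain ⟨κ, g, c, hcu, h⟩ := exists_poincare_of_commuting hs h1 (sub_eq_zero.1 h2).symm
    fun c hc1 hc2 => funext fun j => hind c (fun x hx => by
      simp only [hθ _ x hx, smul_add, Finset.sum_add_distrib, hc2, add_zero]
      have : ∑ k, c k • lcross (θ k) x = lcross (∑ k, c k • θ k) x := by
        simp only [Fin.sum_univ_two, lcross_add_left, lcross_smul_left]
      rw [this, hc1]
      ext i; fin_cases i <;> simp [lcross]) j
  refine ⟨κ, g, c, hcu, fun j x hx => ?_⟩
  simp only [hθ _ _ hx]
  exact h j x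

/-! ### Poincaré covariance -/

namespace Poincare

variable {s m : ℝ} (g : Poincare s) {A : Spacetime → Fin 3 → ℝ} {U : Set Spacetime}

theorem inv_mul_L : g.L⁻¹ * g.L = 1 := Matrix.nonsing_inv_mul _ (by rw [g.det_one]; exact isUnit_one)

theorem L_mul_inv : g.L * g.L⁻¹ = 1 := Matrix.mul_nonsing_inv _ (by rw [g.det_one]; exact isUnit_one)

theorem inv_mul_S : g.S⁻¹ * g.S = 1 :=
  Matrix.nonsing_inv_mul _ ((Matrix.isUnit_iff_isUnit_det _).1 g.unit_S)

theorem S_mul_inv : g.S * g.S⁻¹ = 1 :=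
  Matrix.mul_nonsing_inv _ ((Matrix.isUnit_iff_isUnit_det _).1 g.unit_S)

@[simp] theorem invAct_act (x : Spacetime) : g.invAct (g.act x) = x := by
  rw [invAct, act, add_sub_cancel_right, Matrix.mulVec_mulVec, g.inv_mul_L, Matrix.one_mulVec]

@[simp] theorem act_invAct (x : Spacetime) : g.act (g.invAct x) = x := by
  rw [invAct, act, Matrix.mulVec_mulVec, g.L_mul_inv, Matrix.one_mulVec, sub_add_cancel]

theorem image_eq_preimage (U : Set Spacetime) : g.act '' U = g.invAct ⁻¹' U :=
  congrFun (Set.image_eq_preimage_of_inverse g.invAct_act g.act_invAct) U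

theorem contDiff_act : ContDiff ℝ ∞ g.act :=
  (Matrix.mulVecLin g.L).toContinuousLinearMap.contDiff.add contDiff_const

theorem contDiff_invAct : ContDiff ℝ ∞ g.invAct :=
  (Matrix.mulVecLin g.L⁻¹).toContinuousLinearMap.contDiff.comp (contDiff_id.sub contDiff_const)

theorem isOpen_image (hU : IsOpen U) : IsOpen (g.act '' U) := by
  rw [image_eq_preimage]
  exact hU.preimage g.contDiff_invAct.continuous

theorem isConnected_image (hU : IsConnected U) : IsConnected (g.act '' U) :=
  hU.image _ g.contDiff_act.continuous.continuousOn

theorem contDiffOn_comp_invAct {E : Type*} [NormedAddCommGroup E] [NormedSpace ℝ E]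
    {f : Spacetime → E} {n : ℕ∞} (hf : ContDiffOn ℝ n f U) :
    ContDiffOn ℝ n (fun x => f (g.invAct x)) (g.act '' U) := by
  refine hf.comp ((g.contDiff_invAct.of_le (coe_le_infty n)).contDiffOn) ?_
  rw [image_eq_preimage]
  exact fun x hx => hx

/-- The transformed spinor field `S⁻¹ ψ(g⁻¹ x)`. -/
def transport (ψ : Spacetime → Spinor) (x : Spacetime) : Spinor := g.S⁻¹ *ᵥ ψ (g.invAct x)

theorem transport_surjective (ψ : Spacetime → Spinor) :
    g.transport (fun x => g.S *ᵥ ψ (g.act x)) = ψ := by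
  funext x
  rw [transport, act_invAct, Matrix.mulVec_mulVec, g.inv_mul_S, Matrix.one_mulVec]

/-- Composition with linear equivalences commutes with `fderiv` even at points of
non-differentiability, where it is zero. Hence no regularity of ψ is required here or in the
intertwining identities for H and X. -/
theorem pd_transport (ψ : Spacetime → Spinor) (x : Spacetime) (ν : Fin 3) :
    pd ν (g.transport ψ) x =
      g.S⁻¹ *ᵥ ∑ α, (g.L⁻¹ α ν : ℂ) • pd α ψ (g.invAct x) := by
  let e : Spinor ≃L[ℝ] Spinor := ((LinearEquiv.ofLinearMap (Matrix.mulVecLin g.S⁻¹)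
    (Matrix.mulVecLin g.S)
    (by rw [← Matrix.mulVecLin_mul, g.inv_mul_S, Matrix.mulVecLin_one])
    (by rw [← Matrix.mulVecLin_mul, g.S_mul_inv, Matrix.mulVecLin_one])).restrictScalars
      ℝ).toContinuousLinearEquiv
  let f : Spacetime ≃L[ℝ] Spacetime := (LinearEquiv.ofLinearMap (Matrix.mulVecLin g.L⁻¹)
    (Matrix.mulVecLin g.L)
    (by rw [← Matrix.mulVecLin_mul, g.inv_mul_L, Matrix.mulVecLin_one])
    (by rw [← Matrix.mulVecLin_mul, g.L_mul_inv, Matrix.mulVecLin_one])).toContinuousLinearEquiv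
  have h1 : g.transport ψ = e ∘ fun y => (ψ ∘ f) (y - g.b) := rfl
  rw [pd, h1, e.comp_fderiv, fderiv_comp_sub, f.comp_right_fderiv]
  change g.S⁻¹ *ᵥ fderiv ℝ ψ (g.invAct x) (g.L⁻¹ *ᵥ Pi.single ν 1) = _
  rw [fderiv_eq_sum_pd]
  simp

theorem mom_transport (ψ : Spacetime → Spinor) (x : Spacetime) (ν : Fin 3) :
    mom (g.potential A) ν (g.transport ψ) x =
      ∑ α, (g.L⁻¹ α ν : ℂ) • (g.S⁻¹ *ᵥ mom A α ψ (g.invAct x)) := by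
  simp only [mom, pd_transport, potential, Matrix.mulVec_sub, Matrix.mulVec_smul, Matrix.mulVec_sum]
  push_cast
  simp only [transport, Finset.smul_sum, Finset.sum_smul, ← Finset.sum_sub_distrib]
  refine Finset.sum_congr rfl fun α _ => ?_
  module

theorem sum_L_mul_inv (α β : Fin 3) :
    ∑ ν, (g.L⁻¹ α ν : ℂ) * (g.L ν β : ℂ) = if α = β then 1 else 0 := by
  have h := congrFun (congrFun g.inv_mul_L α) β
  rw [Matrix.mul_apply, Matrix.one_apply] at h
  rw [← Complex.ofReal_one, ← Complex.ofReal_zero, ← apply_ite Complex.ofReal, ← h]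
  push_cast
  rfl

/-- The defining relation of S involves L, whereas transformed momenta carry L⁻¹; contraction with
L⁻¹ gives the form in which the Dirac operator is covariant. -/
theorem sum_inv_gam (α : Fin 3) :
    (∑ ν, (g.L⁻¹ α ν : ℂ) • gam s ν) * g.S⁻¹ = g.S⁻¹ * gam s α := by
  have h1 : ∑ ν, (g.L⁻¹ α ν : ℂ) • gam s ν = g.S⁻¹ * gam s α * g.S := by
    have : ∑ ν, (g.L⁻¹ α ν : ℂ) • ∑ β, (g.L ν β : ℂ) • gam s β = gam s α := by
      simp only [Finset.smul_sum, smul_smul]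
      rw [Finset.sum_comm]
      simp [← Finset.sum_smul, sum_L_mul_inv]
    rw [← this, Finset.mul_sum, Finset.sum_mul]
    refine Finset.sum_congr rfl fun ν _ => ?_
    rw [Matrix.mul_smul, Matrix.smul_mul, g.spin]
  rw [h1, Matrix.mul_assoc, g.S_mul_inv, Matrix.mul_one]

theorem dirac_transport (ψ : Spacetime → Spinor) :
    dirac s m (g.potential A) (g.transport ψ) = g.transport (dirac s m A ψ) := by
  funext x
  rw [dirac, transport, transport, dirac, Matrix.mulVec_sub, Matrix.mulVec_smul, Matrix.mulVec_sum]
  simp only [mom_transport]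
  congr 1
  simp only [Matrix.mulVec_mulVec, ← sum_inv_gam, Matrix.mulVec_sum, Matrix.mulVec_smul]
  rw [Finset.sum_comm]
  refine Finset.sum_congr rfl fun α _ => ?_
  simp only [Finset.sum_mul, Matrix.sum_mulVec, Matrix.smul_mul, Matrix.smul_mulVec,
    ← Matrix.mulVec_mulVec]

theorem act_transport (X : FirstOrder) (ψ : Spacetime → Spinor) :
    (g.conj X).act (g.potential A) (g.transport ψ) = g.transport (X.act A ψ) := by
  funext x
  simp only [FirstOrder.act, mom_transport, transport, conj, Matrix.mulVec_add, Matrix.mulVec_sum,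
    Matrix.mulVec_smul]
  congr 1
  · simp only [Finset.smul_sum, smul_smul]
    rw [Finset.sum_comm]
    refine Finset.sum_congr rfl fun α _ => ?_
    rw [← Finset.sum_smul]
    congr 1
    have h := congrFun (congrArg (fun M => M *ᵥ X.xi (g.invAct x)) g.inv_mul_L) α
    rw [← Matrix.mulVec_mulVec, Matrix.one_mulVec] at h
    rw [← h]
    simp only [Matrix.mulVec, dotProduct]
    push_cast
    exact Finset.sum_congr rfl fun ν _ => mul_comm _ _
  · simp only [Matrix.mulVec_mulVec, Matrix.mul_assoc, g.S_mul_inv, Matrix.mul_one]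

theorem contDiffOn_untransport {n : ℕ∞} {ψ : Spacetime → Spinor}
    (hψ : ContDiffOn ℝ n ψ (g.act '' U)) :
    ContDiffOn ℝ n (fun x => g.S *ᵥ ψ (g.act x)) U :=
  contDiffOn_mulVec (fun _ _ => contDiffOn_const)
    (hψ.comp (g.contDiff_act.of_le (coe_le_infty n)).contDiffOn fun x hx => ⟨x, hx, rfl⟩)

theorem contDiffOn_conj_apply {M : Spacetime → Mat2}
    (hM : ∀ i j, ContDiffOn ℝ ∞ (fun x => M x i j) U) (i j : Fin 2) :
    ContDiffOn ℝ ∞ (fun x => (g.S⁻¹ * M (g.invAct x) * g.S) i j) (g.act '' U) := by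
  simp only [Matrix.mul_apply]
  exact ContDiffOn.sum fun k _ => (ContDiffOn.sum fun l _ => contDiffOn_const.mul
    (g.contDiffOn_comp_invAct (n := ⊤) (hM l k))).mul contDiffOn_const

theorem contDiffOn_conj_xi {X : FirstOrder} (h : ContDiffOn ℝ ∞ X.xi U) :
    ContDiffOn ℝ ∞ (g.conj X).xi (g.act '' U) :=
  (Matrix.mulVecLin g.L).toContinuousLinearMap.contDiff.comp_contDiffOn
    (g.contDiffOn_comp_invAct (n := ⊤) h)

theorem contDiffOn_potential (h : ContDiffOn ℝ ∞ A U) :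
    ContDiffOn ℝ ∞ (g.potential A) (g.act '' U) :=
  contDiffOn_pi.2 fun _ => ContDiffOn.sum fun α _ => contDiffOn_const.mul
    (contDiffOn_pi.1 (g.contDiffOn_comp_invAct (n := ⊤) h) α)

/-- Every field is a transported one and transport intertwines all the operators, so the commutator
identity carries over; the derivative part of the multiplier transforms as a vector. -/
theorem isSymmetry_conj {X : FirstOrder} (hX : IsSymmetry s m A U X) :
    IsSymmetry s m (g.potential A) (g.act '' U) (g.conj X) := by
  obtain ⟨h1, h2, Psi, Psi0, h3, h4, h5⟩ := hX
  refine ⟨g.contDiffOn_conj_xi h1, g.contDiffOn_conj_apply h2,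
    fun ν x => ∑ α, (g.L ν α : ℂ) • (g.S⁻¹ * Psi α (g.invAct x) * g.S),
    fun x => g.S⁻¹ * Psi0 (g.invAct x) * g.S, ?_, g.contDiffOn_conj_apply h4, ?_⟩
  · intro ν i j
    simp only [Matrix.sum_apply, Matrix.smul_apply, smul_eq_mul]
    exact ContDiffOn.sum fun α _ => contDiffOn_const.mul (g.contDiffOn_conj_apply (h3 α) i j)
  · intro ψ hψ x hx
    have hφ := h5 _ (g.contDiffOn_untransport (n := ⊤) hψ) (g.invAct x)
      (by rwa [image_eq_preimage] at hx)
    rw [← g.transport_surjective ψ]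
    simp only [act_transport, dirac_transport, mom_transport]
    generalize (fun x => g.S *ᵥ ψ (g.act x)) = φ at *
    simp only [transport, ← Matrix.mulVec_sub, hφ, Matrix.mulVec_add, Matrix.mulVec_sum]
    have hc : ∀ (M : Mat2) (v : Spinor),
        (g.S⁻¹ * M * g.S) *ᵥ (g.S⁻¹ *ᵥ v) = g.S⁻¹ *ᵥ (M *ᵥ v) := fun M v => by
      simp only [Matrix.mulVec_mulVec, Matrix.mul_assoc, g.S_mul_inv, Matrix.mul_one]
    rw [hc]
    congr 1
    have hx' : ∀ ν, (∑ α, (g.L ν α : ℂ) • (g.S⁻¹ * Psi α (g.invAct x) * g.S)) *ᵥ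
        (∑ α, (g.L⁻¹ α ν : ℂ) • (g.S⁻¹ *ᵥ mom A α (dirac s m A φ) (g.invAct x))) =
        ∑ α, ∑ β, ((g.L⁻¹ β ν : ℂ) * (g.L ν α : ℂ)) • (g.S⁻¹ *ᵥ (Psi α (g.invAct x) *ᵥ
          mom A β (dirac s m A φ) (g.invAct x))) := fun ν => by
      rw [Matrix.sum_mulVec]
      refine Finset.sum_congr rfl fun α _ => ?_
      rw [Matrix.mulVec_sum]
      refine Finset.sum_congr rfl fun β _ => ?_
      rw [Matrix.mulVec_smul, Matrix.smul_mulVec, hc, smul_smul]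
    simp only [← Matrix.mulVec_sum, hx']
    rw [Finset.sum_comm, Matrix.mulVec_sum]
    refine Finset.sum_congr rfl fun α _ => ?_
    rw [Finset.sum_comm]
    simp only [← Finset.sum_smul, sum_L_mul_inv]
    simp

theorem commute_conj {X Y : FirstOrder}
    (h : ∀ ψ : Spacetime → Spinor, ContDiffOn ℝ ∞ ψ U → ∀ x ∈ U,
      X.act A (Y.act A ψ) x = Y.act A (X.act A ψ) x) (ψ : Spacetime → Spinor)
    (hψ : ContDiffOn ℝ ∞ ψ (g.act '' U)) (x : Spacetime) (hx : x ∈ g.act '' U) :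
    (g.conj X).act (g.potential A) ((g.conj Y).act (g.potential A) ψ) x =
      (g.conj Y).act (g.potential A) ((g.conj X).act (g.potential A) ψ) x := by
  rw [← g.transport_surjective ψ]
  simp only [act_transport]
  rw [transport, transport, h _ (g.contDiffOn_untransport (n := ⊤) hψ) _
    (by rwa [image_eq_preimage] at hx)]

theorem jointSystem_transport {X : Fin 2 → FirstOrder} {μ : Fin 2 → ℂ} {V : Set Spacetime}
    {ψ : Spacetime → Spinor} :
    JointSystem s m (g.potential A) (fun k => g.conj (X k)) μ V (g.transport ψ) ↔
      JointSystem s m A X μ (g.act ⁻¹' V) ψ := by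
  have hinj : ∀ v w : Spinor, g.S⁻¹ *ᵥ v = g.S⁻¹ *ᵥ w ↔ v = w := fun v w => by
    refine ⟨fun h => ?_, fun h => by rw [h]⟩
    have := congrArg (fun v => g.S *ᵥ v) h
    simpa only [Matrix.mulVec_mulVec, g.S_mul_inv, Matrix.one_mulVec] using this
  have hpt : ∀ x, ((∀ j, (g.conj (X j)).act (g.potential A) (g.transport ψ) (g.act x) =
      μ j • g.transport ψ (g.act x)) ∧ dirac s m (g.potential A) (g.transport ψ) (g.act x) = 0) ↔
      (∀ j, (X j).act A ψ x = μ j • ψ x) ∧ dirac s m A ψ x = 0 := by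
    intro x
    simp only [act_transport, dirac_transport]
    have h0 : ∀ v : Spinor, g.S⁻¹ *ᵥ v = 0 ↔ v = 0 := fun v => by
      simpa only [Matrix.mulVec_zero] using hinj v 0
    simp only [transport, invAct_act, ← Matrix.mulVec_smul, hinj, h0]
  constructor
  · intro h x hx
    exact (hpt x).1 (h (g.act x) hx)
  · intro h x hx
    have := (hpt (g.invAct x)).2 (h (g.invAct x) (by rwa [Set.mem_preimage, act_invAct]))
    simpa only [act_invAct] using this

end Poincare

/-! ### Recognising a separable potential -/

namespace SepChart

variable {C : SepChart} {κ : SetKind} {I : Fin 3 → Set ℝ} {x : Spacetime}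

/-- The Poincaré lemma on the region of a coordinate box. -/
theorem IsAdapted.exists_primitive (hC : C.IsAdapted κ) (hI : C.IsBox I)
    {D : Spacetime → Fin 3 → ℝ} (hD : ContDiffOn ℝ ∞ D (C.region I))
    (hcl : ∀ x ∈ C.region I, ∀ i k, fieldStrength D i k x = 0) :
    ∃ f : Spacetime → ℝ, ContDiffOn ℝ ∞ f (C.region I) ∧
      ∀ x ∈ C.region I, ∀ ν, pd ν f x = D x ν := by
  have hV := hC.isOpen_region hI
  have hB := hI.isOpen_box
  have hinv := hC.contDiffOn_inv hI
  have hinvi : ∀ i, ContDiffOn ℝ ∞ (fun u => C.inv u i) (box I) := contDiffOn_pi.1 hinv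
  have hDi : ∀ i, ContDiffOn ℝ ∞ (fun x => D x i) (C.region I) := contDiffOn_pi.1 hD
  have hDc : ∀ i, ContDiffOn ℝ ∞ (fun u => D (C.inv u) i) (box I) := fun i =>
    (hDi i).comp hinv fun u hu => hC.inv_region hI hu
  have hp : ∀ ν i, ContDiffOn ℝ ∞ (pd ν fun u => C.inv u i) (box I) := fun ν i =>
    contDiffOn_pd hB (hinvi i) ν
  have dif : ∀ {g : Spacetime → ℝ}, ContDiffOn ℝ ∞ g (box I) → ∀ u ∈ box I,
      DifferentiableAt ℝ g u := fun hg u hu =>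
    (hg.contDiffAt (hB.mem_nhds hu)).differentiableAt (by simp)
  -- The components of the pulled-back form on the box: the box is convex while the region in
  -- Minkowski space may not be, so the primitive is found there and carried back.
  let E : Fin 3 → Spacetime → ℝ := fun ν u => ∑ i, pd ν (fun v => C.inv v i) u * D (C.inv u) i
  have hE : ∀ ν, ContDiffOn ℝ ∞ (E ν) (box I) := fun ν =>
    ContDiffOn.sum fun i _ => (hp ν i).mul (hDc i)
  have hEcl : ∀ u ∈ box I, ∀ μ ν, pd μ (E ν) u = pd ν (E μ) u := by
    intro u hu μ ν
    have h1 : ∀ μ ν, pd μ (E ν) u = ∑ i, (pd μ (pd ν fun v => C.inv v i) u * D (C.inv u) i +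
        pd ν (fun v => C.inv v i) u * ∑ k, pd μ (fun v => C.inv v k) u *
          pd k (fun y => D y i) (C.inv u)) := by
      intro μ ν
      rw [pd_sum fun i _ => (dif (hp ν i) u hu).fun_mul (dif (hDc i) u hu)]
      refine Finset.sum_congr rfl fun i _ => ?_
      rw [pd_mul (dif (hp ν i) u hu) (dif (hDc i) u hu),
        pd_comp (g := fun y => D y i) (((hDi i).contDiffAt
          (hV.mem_nhds (hC.inv_region hI hu))).differentiableAt (by simp))
          ((hinv.contDiffAt (hB.mem_nhds hu)).differentiableAt (by simp))]
      rfl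
    have h2 : ∀ i, pd μ (pd ν fun v => C.inv v i) u = pd ν (pd μ fun v => C.inv v i) u := fun i =>
      pd_comm (((hinvi i).contDiffAt (hB.mem_nhds hu)).of_le two_le_infty) μ ν
    have h3 : ∀ i k, pd k (fun y => D y i) (C.inv u) = pd i (fun y => D y k) (C.inv u) :=
      fun i k => sub_eq_zero.1 (hcl _ (hC.inv_region hI hu) k i)
    rw [h1, h1]
    simp only [Fin.sum_univ_three, h2, h3 0 1, h3 0 2, h3 1 2]
    ring
  let Ω : Spacetime → Spacetime →L[ℝ] ℝ := fun u =>
    ∑ ν, E ν u • (ContinuousLinearMap.proj ν : Spacetime →L[ℝ] ℝ)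
  have hΩ : ContDiffOn ℝ ∞ Ω (box I) := ContDiffOn.sum fun ν _ => (hE ν).smul contDiffOn_const
  have hsym : ∀ u ∈ box I, ∀ v w, fderiv ℝ Ω u v w = fderiv ℝ Ω u w v := by
    intro u hu v w
    have h1 : ∀ v w : Spacetime, fderiv ℝ Ω u v w = ∑ ν, ∑ μ, v μ * pd μ (E ν) u * w ν := by
      intro v w
      have hΩd : DifferentiableAt ℝ Ω u :=
        (hΩ.contDiffAt (hB.mem_nhds hu)).differentiableAt (by simp)
      have h2 : fderiv ℝ Ω u v w = fderiv ℝ (fun y => Ω y w) u v := by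
        rw [fderiv_clm_apply hΩd (differentiableAt_const w)]
        simp
      have h3 : (fun y => Ω y w) = fun y => ∑ ν, E ν y * w ν := by
        ext y; simp [Ω]
      rw [h2, h3, fderiv_eq_sum_pd, Finset.sum_comm]
      refine Finset.sum_congr rfl fun μ _ => ?_
      rw [pd_sum fun ν _ => (dif (hE ν) u hu).fun_mul (differentiableAt_const _), smul_eq_mul,
        Finset.mul_sum]
      refine Finset.sum_congr rfl fun ν _ => ?_
      rw [pd_mul (dif (hE ν) u hu) (differentiableAt_const _), pd_const]
      ring
    rw [h1, h1, Finset.sum_comm]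
    refine Finset.sum_congr rfl fun ν _ => Finset.sum_congr rfl fun μ _ => ?_
    rw [hEcl u hu]; ring
  obtain ⟨h, hh⟩ := hI.convex_box.exists_forall_hasFDerivAt_of_fderiv_symmetric hB
    (hΩ.differentiableOn (by simp)) hsym
  have hhs : ContDiffOn ℝ ∞ h (box I) := by
    rw [contDiffOn_infty_iff_fderiv_of_isOpen hB]
    exact ⟨fun u hu => (hh u hu).differentiableAt.differentiableWithinAt,
      hΩ.congr fun u hu => (hh u hu).fderiv⟩
  refine ⟨fun x => h (C.coord x), hhs.comp hC.contDiffOn_coord fun x hx => hx.2,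
    fun x hx α => ?_⟩
  have hu : C.coord x ∈ box I := hx.2
  rw [pd_comp (hh _ hu).differentiableAt ((hC.contDiffAt_coord hx.1).differentiableAt (by simp))]
  have h1 : ∀ ν, pd ν h (C.coord x) = E ν (C.coord x) := fun ν => by
    rw [pd_eq_of_hasFDerivAt (hh _ hu)]
    simp [Ω, Pi.single_apply]
  have hJ := mul_eq_one_comm.1 (pd_coord_mul_pd_inv hC.1 hC.2.1 hC.2.2.1 hC.2.2.2.2.1
    hC.2.2.2.2.2.1 hx.1)
  have hJ' : ∀ i, ∑ ν, pd α (fun y => C.coord y ν) x * pd ν (fun v => C.inv v i) (C.coord x) =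
      if α = i then 1 else 0 := fun i => by
    have := congrFun (congrFun hJ α) i
    simpa only [Matrix.mul_apply, Matrix.of_apply, Matrix.one_apply] using this
  simp only [h1, E, smul_eq_mul, Finset.mul_sum, hC.inv_coord hx.1]
  rw [Finset.sum_comm]
  simp only [← mul_assoc, ← Finset.sum_mul, hJ']
  simp

/-- In dimension three a two-form is dual to a vector e, and its contraction with a field is the
cross product with e. If both contractions vanish and e ≠ 0, both coordinate fields are multiples of
e, against their independence. -/
theorem IsAdapted.fieldStrength_eq_zero (hC : C.IsAdapted κ) (hx : x ∈ C.source)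
    {G : Fin 3 → Fin 3 → ℝ} (hG : ∀ α β, G α β = -G β α)
    (h : ∀ j α, ∑ β, G α β * κ.killing j x β = 0) (α β : Fin 3) : G α β = 0 := by
  have h00 : ∀ α, G α α = 0 := fun α => by have := hG α α; linarith
  let e : Fin 3 → ℝ := ![G 1 2, -G 0 2, G 0 1]
  have he : ∀ j, lcross e (κ.killing j x) = 0 := by
    intro j
    have h0 := h j 0
    have h1 := h j 1
    have h2 := h j 2
    simp only [Fin.sum_univ_three, h00, hG 1 0, hG 2 0, hG 2 1] at h0 h1 h2
    ext i
    fin_cases i <;> simp [lcross, e] <;> linarith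
  have he0 : e = 0 := by
    by_contra hne
    choose t ht using fun j => exists_smul_of_lcross_eq_zero hne (he j)
    have hk : ∀ j k, t j * ∑ μ, e μ * pd μ (fun y => C.coord y (C.ign k)) x =
        if C.ign k = C.ign j then 1 else 0 := fun j k => by
      rw [← hC.killing_coord hx, ht j, Finset.mul_sum]
      refine Finset.sum_congr rfl fun μ _ => ?_
      rw [Pi.smul_apply, smul_eq_mul]; ring
    have h1 := hk 0 0
    have h2 := hk 1 1
    have h3 := hk 0 1
    rw [if_pos rfl] at h1 h2
    rw [if_neg hC.ign_ne.symm] at h3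
    rcases mul_eq_zero.1 h3 with h4 | h4
    · rw [h4, zero_mul] at h1; exact zero_ne_one h1
    · rw [h4, mul_zero] at h2; exact zero_ne_one h2
  have e0 : G 1 2 = 0 := congrFun he0 0
  have e1 : -G 0 2 = 0 := congrFun he0 1
  have e2 : G 0 1 = 0 := congrFun he0 2
  have h10 := hG 1 0
  have h20 := hG 2 0
  have h21 := hG 2 1
  fin_cases α <;> fin_cases β <;> simp [h00] <;> linarith

/-- Two functions whose differentials are the contractions of a field strength with the two vector
fields of the row, the contraction with both of them being zero, depend on the separation
coordinate only. -/
theorem IsAdapted.exists_comp_sep (hC : C.IsAdapted κ) (hI : C.IsBox I)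
    {A : Spacetime → Fin 3 → ℝ} {p : Fin 2 → Spacetime → ℝ}
    (hp : ∀ j, ContDiffOn ℝ ∞ (p j) (C.region I))
    (hpd : ∀ j, ∀ x ∈ C.region I, ∀ μ,
      pd μ (p j) x = ∑ ν, fieldStrength A μ ν x * κ.killing j x ν)
    (hF : ∀ x ∈ C.region I,
      ∑ μ, ∑ ν, fieldStrength A μ ν x * κ.killing 0 x μ * κ.killing 1 x ν = 0) (j : Fin 2) :
    ∃ b : ℝ → ℝ, ContDiffOn ℝ ∞ b (I C.sep) ∧
      ∀ x ∈ C.region I, p j x = b (C.coord x C.sep) := by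
  have hV := hC.isOpen_region hI
  have hB := hI.isOpen_box
  -- The derivative of p_j along η_k is F(η_k, η_j): zero by antisymmetry for k = j and by `hF`
  -- otherwise.
  have hFF : ∀ x ∈ C.region I, ∀ k,
      ∑ μ, κ.killing k x μ * ∑ ν, fieldStrength A μ ν x * κ.killing j x ν = 0 := by
    intro x hx k
    have f : ∀ ν μ, fieldStrength A μ ν x = -fieldStrength A ν μ x := fun ν μ => by
      simp [fieldStrength]
    have f0 : ∀ ν, fieldStrength A ν ν x = 0 := fun ν => by simp [fieldStrength]
    have h := hF x hx
    simp only [Fin.sum_univ_three, f0, f 0 1, f 0 2, f 1 2] at h ⊢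
    fin_cases k <;> fin_cases j <;> simp only [Fin.zero_eta, Fin.mk_one] <;> linarith
  let q : Spacetime → ℝ := fun u => p j (C.inv u)
  have hq : ContDiffOn ℝ ∞ q (box I) := (hp j).comp (hC.contDiffOn_inv hI) fun u hu =>
    hC.inv_region hI hu
  have hqpd : ∀ u ∈ box I, ∀ ν ≠ C.sep, pd ν q u = 0 := by
    intro u hu ν hν
    obtain ⟨k, rfl⟩ := hC.exists_ign hν
    have hx := hC.inv_region hI hu
    have hqd : DifferentiableAt ℝ q (C.coord (C.inv u)) := by
      rw [hC.coord_inv hI hu]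
      exact (hq.contDiffAt (hB.mem_nhds hu)).differentiableAt (by simp)
    have h1 : ∀ μ, pd μ (p j) (C.inv u) =
        ∑ ν, pd μ (fun y => C.coord y ν) (C.inv u) • pd ν q u := fun μ => by
      rw [pd_congr hV (f := p j) (g := fun y => q (C.coord y))
        (fun y hy => by simp only [q, hC.inv_coord hy.1]) hx, pd_comp hqd
        ((hC.contDiffAt_coord hx.1).differentiableAt (by simp)), hC.coord_inv hI hu]
    have h2 := hFF _ hx k
    simp only [← hpd j _ hx, h1, smul_eq_mul, Finset.mul_sum, ← mul_assoc] at h2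
    rw [Finset.sum_comm] at h2
    simp only [← Finset.sum_mul, hC.killing_coord hx.1] at h2
    simpa using h2
  obtain ⟨u₀, hu₀⟩ := hI.nonempty_box
  have hmem : ∀ t ∈ I C.sep, Function.update u₀ C.sep t ∈ box I := by
    intro t ht ν
    by_cases h : ν = C.sep
    · subst h; simpa using ht
    · simpa [h] using hu₀ ν
  refine ⟨fun t => q (Function.update u₀ C.sep t), ?_, fun x hx => ?_⟩
  · refine hq.comp (ContDiff.contDiffOn ?_) hmem
    exact contDiff_pi.2 fun ν => by
      by_cases h : ν = C.sep
      · subst h; simpa using contDiff_fun_id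
      · simpa [h] using contDiff_const
  · have h := eq_of_pd_eq_zero hB hI.convex_box (hq.differentiableOn (by simp)) hqpd
      (u := C.coord x) (v := Function.update u₀ C.sep (C.coord x C.sep)) hx.2
      (hmem _ (hx.2 _)) (by simp)
    change p j x = q _
    rw [← h]
    simp only [q, hC.inv_coord hx.1]

/-- A potential with two commuting symmetries belonging to a row of the table is, up to a gauge
transformation, one of the separable potentials. -/
theorem IsAdapted.exists_gauge (hC : C.IsAdapted κ) (hI : C.IsBox I)
    {A : Spacetime → Fin 3 → ℝ} (hA : ContDiffOn ℝ ∞ A (C.region I)) {p : Fin 2 → Spacetime → ℝ}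
    (hp : ∀ j, ContDiffOn ℝ ∞ (p j) (C.region I))
    (hpd : ∀ j, ∀ x ∈ C.region I, ∀ μ,
      pd μ (p j) x = ∑ ν, fieldStrength A μ ν x * κ.killing j x ν)
    (hF : ∀ x ∈ C.region I,
      ∑ μ, ∑ ν, fieldStrength A μ ν x * κ.killing 0 x μ * κ.killing 1 x ν = 0) :
    ∃ (a : Fin 3 → ℝ → ℝ) (f : Spacetime → ℝ),
      (∀ ν, ContDiffOn ℝ ∞ (a ν) (I C.sep)) ∧ ContDiffOn ℝ ∞ f (C.region I) ∧
      (∀ x ∈ C.region I, ∀ ν, A x ν = C.potential a x ν + pd ν f x) ∧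
      ∀ j, ∀ x ∈ C.region I, p j x = a (C.ign j) (C.coord x C.sep) := by
  have hV := hC.isOpen_region hI
  choose b hb hpb using hC.exists_comp_sep hI hp hpd hF
  -- The component along τ is set to zero: a term a(τ) dτ is exact and is absorbed by the gauge
  -- function.
  let a : Fin 3 → ℝ → ℝ := fun ν => if ν = C.ign 0 then b 0 else if ν = C.ign 1 then b 1 else 0
  have haj : ∀ j, a (C.ign j) = b j := by
    intro j
    have := hC.ign_ne.symm
    fin_cases j <;> simp [a, this]
  have ha : ∀ ν, ContDiffOn ℝ ∞ (a ν) (I C.sep) := by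
    intro ν
    simp only [a]
    split_ifs
    exacts [hb 0, hb 1, contDiffOn_const]
  have hP := hC.contDiffOn_potential hI ha
  let D : Spacetime → Fin 3 → ℝ := fun x ν => A x ν - C.potential a x ν
  have hD : ContDiffOn ℝ ∞ D (C.region I) := hA.sub hP
  have hfs : ∀ x ∈ C.region I, ∀ i k, fieldStrength D i k x =
      fieldStrength A i k x - fieldStrength (C.potential a) i k x := by
    intro x hx i k
    have h1 : ∀ k, DifferentiableAt ℝ (fun y => A y k) x := fun k =>
      ((contDiffOn_pi.1 hA k).contDiffAt (hV.mem_nhds hx)).differentiableAt (by simp)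
    have h2 : ∀ k, DifferentiableAt ℝ (fun y => C.potential a y k) x := fun k =>
      ((contDiffOn_pi.1 hP k).contDiffAt (hV.mem_nhds hx)).differentiableAt (by simp)
    simp only [fieldStrength, D]
    rw [pd_sub (h1 k) (h2 k), pd_sub (h1 i) (h2 i)]
    ring
  -- Both field strengths contract with η_j to the gradient of p_j, so their difference is
  -- annihilated by both fields.
  have hcl : ∀ x ∈ C.region I, ∀ i k, fieldStrength D i k x = 0 := by
    intro x hx
    refine hC.fieldStrength_eq_zero hx.1 (G := fun i k => fieldStrength D i k x)
      (fun i k => by simp [fieldStrength]) fun j α => ?_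
    simp only [hfs x hx, sub_mul, Finset.sum_sub_distrib]
    rw [hC.fieldStrength_killing hI ha hx, ← hpd j x hx, sub_eq_zero,
      pd_congr hV (g := fun y => a (C.ign j) (C.coord y C.sep))
        (fun y hy => by rw [hpb j y hy, haj]) hx,
      pd_comp_real (g := a (C.ign j)) (c := fun y => C.coord y C.sep)
        (((ha _).contDiffAt ((hI.1 C.sep).1.mem_nhds (hx.2 C.sep))).differentiableAt (by simp))
        (hC.differentiableAt_coord hx.1 C.sep), smul_eq_mul]
  obtain ⟨f, hf, hfD⟩ := hC.exists_primitive hI hD hcl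
  refine ⟨a, f, ha, hf, fun x hx ν => ?_, fun j x hx => by rw [hpb j x hx, haj]⟩
  rw [hfD x hx]
  simp [D]

end SepChart

/-! ### Invariance of the joint system -/

section JointSystems

variable {s m : ℝ} {A B : Spacetime → Fin 3 → ℝ} {X Y : Fin 2 → FirstOrder} {lam : Fin 2 → ℂ}
  {V : Set Spacetime} {ψ : Spacetime → Spinor}

theorem jointSystem_congr (hxi : ∀ j, ∀ x ∈ V, (X j).xi x = (Y j).xi x)
    (hchi : ∀ j, ∀ x ∈ V, (X j).chi x = (Y j).chi x) :
    JointSystem s m A X lam V ψ ↔ JointSystem s m A Y lam V ψ := by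
  refine forall_congr' fun x => forall_congr' fun hx => ?_
  simp only [FirstOrder.act, hxi _ x hx, hchi _ x hx]

theorem combine_act (c : Matrix (Fin 2) (Fin 2) ℝ) (d : Fin 2 → ℂ) (j : Fin 2) (x : Spacetime) :
    (combine c d X j).act A ψ x = (∑ k, (c j k : ℂ) • (X k).act A ψ x) + d j • ψ x := by
  simp only [FirstOrder.act, combine, Fin.sum_univ_two, Fin.sum_univ_three, Pi.add_apply,
    Pi.smul_apply, smul_eq_mul, Matrix.add_mulVec, Matrix.smul_mulVec, Matrix.one_mulVec]
  push_cast
  module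

/-- The defects X_kψ - μ_kψ are multiplied by the invertible matrix c, while the constants d_j
merely shift the eigenvalues. -/
theorem jointSystem_combine {c : Matrix (Fin 2) (Fin 2) ℝ} (hc : IsUnit c) (d : Fin 2 → ℂ)
    (μ : Fin 2 → ℂ) :
    JointSystem s m A (combine c d X) (fun j => (∑ k, (c j k : ℂ) * μ k) + d j) V ψ ↔
      JointSystem s m A X μ V ψ := by
  have hdet := (Matrix.isUnit_iff_isUnit_det c).1 hc
  have hinv : ∀ i k, ∑ j, ((c⁻¹ i j : ℝ) : ℂ) * (c j k : ℂ) = if i = k then 1 else 0 := by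
    intro i k
    have h := congrFun (congrFun (Matrix.nonsing_inv_mul c hdet) i) k
    rw [Matrix.mul_apply, Matrix.one_apply] at h
    rw [← Complex.ofReal_one, ← Complex.ofReal_zero, ← apply_ite Complex.ofReal, ← h]
    push_cast
    rfl
  refine forall_congr' fun x => forall_congr' fun _ => and_congr_left fun _ => ?_
  have hdiff : ∀ j, (combine c d X j).act A ψ x - ((∑ k, (c j k : ℂ) * μ k) + d j) • ψ x =
      ∑ k, (c j k : ℂ) • ((X k).act A ψ x - μ k • ψ x) := fun j => by
    rw [combine_act]
    simp only [Fin.sum_univ_two]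
    module
  constructor
  · intro h i
    have h0 : ∀ j, ∑ k, (c j k : ℂ) • ((X k).act A ψ x - μ k • ψ x) = 0 := fun j => by
      rw [← hdiff, h j, sub_self]
    have h1 : ∑ j, ((c⁻¹ i j : ℝ) : ℂ) • ∑ k, (c j k : ℂ) • ((X k).act A ψ x - μ k • ψ x) = 0 := by
      simp only [h0, smul_zero, Finset.sum_const_zero]
    simp only [Finset.smul_sum, smul_smul] at h1
    rw [Finset.sum_comm] at h1
    simp only [← Finset.sum_smul, hinv] at h1
    simpa [sub_eq_zero] using h1
  · intro h j
    rw [← sub_eq_zero, hdiff]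
    simp [h]

theorem mom_gauge {f : Spacetime → ℝ} {x : Spacetime} (hf : DifferentiableAt ℝ f x)
    (hψ : DifferentiableAt ℝ ψ x) (hA : ∀ ν, A x ν = B x ν + pd ν f x) (ν : Fin 3) :
    mom B ν (fun y => Complex.exp (Complex.I * f y) • ψ y) x =
      Complex.exp (Complex.I * f x) • mom A ν ψ x := by
  have hfc : DifferentiableAt ℝ (fun y => (f y : ℂ)) x :=
    Complex.ofRealCLM.differentiableAt.comp x hf
  have hIf : DifferentiableAt ℝ (fun y => Complex.I * (f y : ℂ)) x := hfc.const_mul _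
  have hpe : pd ν (fun y => Complex.exp (Complex.I * f y)) x =
      Complex.exp (Complex.I * f x) * (Complex.I * ((pd ν f x : ℝ) : ℂ)) := by
    rw [pd, hIf.hasFDerivAt.cexp.fderiv]
    change Complex.exp (Complex.I * f x) * pd ν (fun y => Complex.I * (f y : ℂ)) x = _
    rw [pd_mul_complex (differentiableAt_const _) hfc, pd_const, pd_ofReal hf]
    ring
  rw [mom_smul hIf.cexp hψ, hpe, mom, mom, hA]
  have hI : Complex.I * (Complex.exp (Complex.I * f x) * (Complex.I * ((pd ν f x : ℝ) : ℂ))) =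
      -(Complex.exp (Complex.I * f x) * ((pd ν f x : ℝ) : ℂ)) := by
    linear_combination Complex.exp (Complex.I * f x) * ((pd ν f x : ℝ) : ℂ) * Complex.I_sq
  rw [hI]
  push_cast
  module

theorem jointSystem_gauge {f : Spacetime → ℝ} (hf : ∀ x ∈ V, DifferentiableAt ℝ f x)
    (hψ : ∀ x ∈ V, DifferentiableAt ℝ ψ x) (hA : ∀ x ∈ V, ∀ ν, A x ν = B x ν + pd ν f x) :
    JointSystem s m B X lam V (fun y => Complex.exp (Complex.I * f y) • ψ y) ↔
      JointSystem s m A X lam V ψ := by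
  refine forall_congr' fun x => forall_congr' fun hx => ?_
  have he := Complex.exp_ne_zero (Complex.I * f x)
  have h1 : ∀ j, (X j).act B (fun y => Complex.exp (Complex.I * f y) • ψ y) x =
      Complex.exp (Complex.I * f x) • (X j).act A ψ x := fun j => by
    simp only [FirstOrder.act, mom_gauge (hf x hx) (hψ x hx) (hA x hx), Matrix.mulVec_smul,
      smul_add, Finset.smul_sum]
    congr 1
    exact Finset.sum_congr rfl fun ν _ => smul_comm _ _ _
  have h2 : dirac s m B (fun y => Complex.exp (Complex.I * f y) • ψ y) x =
      Complex.exp (Complex.I * f x) • dirac s m A ψ x := by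
    simp only [dirac, mom_gauge (hf x hx) (hψ x hx) (hA x hx), Matrix.mulVec_smul, smul_sub,
      Finset.smul_sum]
    rw [smul_comm]
  rw [h2, smul_eq_zero_iff_right he]
  refine and_congr_left fun _ => forall_congr' fun j => ?_
  rw [h1, smul_comm (lam j)]
  exact ⟨fun h => smul_right_injective _ he h, fun h => by rw [h]⟩

end JointSystems

/-! ### Reduction of a complete set -/

/-- A complex function with real differential on a connected open set is real up to a constant. -/
theorem exists_real_of_pd_real {U : Set Spacetime} (hU : IsOpen U) (hc : IsConnected U)
    {Φ : Spacetime → ℂ} (hΦ : ContDiffOn ℝ ∞ Φ U) {r : Fin 3 → Spacetime → ℝ}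
    (hr : ∀ x ∈ U, ∀ μ, pd μ Φ x = (r μ x : ℂ)) :
    ∃ (d : ℂ) (p : Spacetime → ℝ), ContDiffOn ℝ ∞ p U ∧ (∀ x ∈ U, Φ x + d = p x) ∧
      ∀ x ∈ U, ∀ μ, pd μ p x = r μ x := by
  obtain ⟨x₀, hx₀⟩ := hc.nonempty
  have hd : ∀ x ∈ U, DifferentiableAt ℝ Φ x := fun x hx =>
    (hΦ.contDiffAt (hU.mem_nhds hx)).differentiableAt (by simp)
  have hre : ∀ x ∈ U, ∀ μ, pd μ (fun y => (Φ y).re) x = r μ x := fun x hx μ => by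
    have h := (Complex.reCLM.hasFDerivAt (x := Φ x)).comp x (hd x hx).hasFDerivAt
    rw [pd_eq_of_hasFDerivAt (f := fun y => (Φ y).re) h]
    change (pd μ Φ x).re = _
    rw [hr x hx, Complex.ofReal_re]
  have him : ∀ x ∈ U, ∀ μ, pd μ (fun y => (Φ y).im) x = 0 := fun x hx μ => by
    have h := (Complex.imCLM.hasFDerivAt (x := Φ x)).comp x (hd x hx).hasFDerivAt
    rw [pd_eq_of_hasFDerivAt (f := fun y => (Φ y).im) h]
    change (pd μ Φ x).im = _
    rw [hr x hx, Complex.ofReal_im]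
  have hims : ContDiffOn ℝ ∞ (fun y => (Φ y).im) U := Complex.imCLM.contDiff.comp_contDiffOn hΦ
  -- The imaginary part has zero differential, so on the connected set it equals its value at x₀,
  -- which this constant removes.
  refine ⟨-((Φ x₀).im * Complex.I), fun y => (Φ y).re, Complex.reCLM.contDiff.comp_contDiffOn hΦ,
    fun x hx => ?_, hre⟩
  have h := eq_of_pd_eq_zero_of_isPreconnected hU hc.isPreconnected
    (hims.differentiableOn (by simp)) him hx hx₀
  apply Complex.ext
  · simp
  · simp at h ⊢
    linarith

theorem spinCoeff_sum {s : ℝ} {xi : Fin 2 → Spacetime → Fin 3 → ℝ} {x : Spacetime}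
    (h : ∀ k i, DifferentiableAt ℝ (fun y => xi k y i) x) (c : Fin 2 → ℝ) (α : Fin 3) :
    spinCoeff s (fun y => ∑ k, c k • xi k y) α x = ∑ k, c k * spinCoeff s (xi k) α x := by
  have hpd : ∀ μ σ, pd σ (fun y => (∑ k, c k • xi k y) μ) x =
      ∑ k, c k * pd σ (fun y => xi k y μ) x := fun μ σ => by
    have e : (fun y => (∑ k, c k • xi k y) μ) = fun y => ∑ k, c k * xi k y μ := by
      funext y; simp
    rw [e, pd_sum fun k _ => (h k μ).const_mul _]
    exact Finset.sum_congr rfl fun k _ => pd_const_mul _ (h k μ) σ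
  simp only [spinCoeff, hpd]
  simp only [Fin.sum_univ_two, Fin.sum_univ_three]
  ring

theorem spinCoeff_congr {s : ℝ} {U : Set Spacetime} (hU : IsOpen U)
    {xi xi' : Spacetime → Fin 3 → ℝ} (h : ∀ y ∈ U, xi y = xi' y) {x : Spacetime} (hx : x ∈ U)
    (α : Fin 3) : spinCoeff s xi α x = spinCoeff s xi' α x := by
  have hpd : ∀ μ σ, pd σ (fun y => xi y μ) x = pd σ (fun y => xi' y μ) x := fun μ σ =>
    pd_congr hU (fun y hy => by rw [h y hy]) hx σ
  simp only [spinCoeff, hpd]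

/-- A complete set whose combinations have the vector fields of a row of the table: after adding
constants, the combinations have real scalar parts, whose differentials are the contractions of the
field strength with the vector fields. -/
theorem IsSpinSymmetry.exists_scalar_parts {s : ℝ} {A : Spacetime → Fin 3 → ℝ} {U : Set Spacetime}
    (hU : IsOpen U) (hc : IsConnected U) {X : Fin 2 → FirstOrder} {φ : Fin 2 → Spacetime → ℂ}
    (hφ : ∀ k, IsSpinSymmetry s A U (X k) (φ k)) {κ : SetKind} {c : Fin 2 → ℝ} {j : Fin 2}
    (hκ : ∀ x ∈ U, ∑ k, c k • (X k).xi x = κ.killing j x) :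
    ∃ (d : ℂ) (p : Spacetime → ℝ), ContDiffOn ℝ ∞ p U ∧
      (∀ x ∈ U, (∑ k, (c k : ℂ) • (X k).chi x) + d • (1 : Mat2) =
        (p x : ℂ) • (1 : Mat2) + κ.spin s j) ∧
      ∀ x ∈ U, ∀ μ, pd μ p x = ∑ ν, fieldStrength A μ ν x * κ.killing j x ν := by
  have hφd : ∀ k, ∀ x ∈ U, DifferentiableAt ℝ (φ k) x := fun k x hx =>
    ((hφ k).smooth_phi.contDiffAt (hU.mem_nhds hx)).differentiableAt (by simp)
  obtain ⟨d, p, hp, hd, hpd⟩ := exists_real_of_pd_real hU hc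
    (Φ := fun x => ∑ k, (c k : ℂ) * φ k x)
    (ContDiffOn.sum fun k _ => contDiffOn_const.mul (hφ k).smooth_phi)
    (r := fun μ x => ∑ ν, fieldStrength A μ ν x * κ.killing j x ν) (fun x hx μ => by
      rw [pd_sum fun k _ => (hφd k x hx).const_mul _]
      simp only [pd_mul_complex (differentiableAt_const _) (hφd _ x hx), pd_const, zero_mul,
        zero_add, (hφ _).pd_phi x hx, ← hκ x hx]
      push_cast
      simp only [Fin.sum_univ_two, Fin.sum_univ_three, Pi.add_apply, Pi.smul_apply, smul_eq_mul]
      push_cast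
      ring)
  refine ⟨d, p, hp, fun x hx => ?_, hpd⟩
  have hspin : κ.spin s j = ∑ k, (c k : ℂ) • ∑ α, (spinCoeff s (X k).xi α x : ℂ) • gam s α := by
    have h : ∀ α, spinGrad s (κ.grad j) α = ∑ k, c k * spinCoeff s (X k).xi α x := fun α => by
      rw [← κ.spinCoeff_killing s j α x, ← spinCoeff_congr hU hκ hx, spinCoeff_sum fun k i =>
        ((contDiffOn_pi.1 (hφ k).smooth_xi i).contDiffAt (hU.mem_nhds hx)).differentiableAt
          (by simp)]
    simp only [SetKind.spin, h, Fin.sum_univ_two, Fin.sum_univ_three]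
    push_cast
    module
  rw [← hd x hx, hspin]
  simp only [(hφ _).chi_eq x hx, spinMat, Fin.sum_univ_two, Fin.sum_univ_three]
  module

/-- An alternating form takes on the combinations det(c) times its value on the original vectors. -/
theorem contraction_eq_zero {G : Fin 3 → Fin 3 → ℝ} (hG : ∀ μ ν, G μ ν = -G ν μ)
    {v : Fin 2 → Fin 3 → ℝ} (h : ∑ μ, ∑ ν, G μ ν * v 0 μ * v 1 ν = 0)
    (c : Matrix (Fin 2) (Fin 2) ℝ) :
    ∑ μ, ∑ ν, G μ ν * (∑ k, c 0 k • v k) μ * (∑ k, c 1 k • v k) ν = 0 := by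
  have h00 : ∀ μ, G μ μ = 0 := fun μ => by have := hG μ μ; linarith
  simp only [Fin.sum_univ_two, Fin.sum_univ_three, Pi.add_apply, Pi.smul_apply, smul_eq_mul, h00,
    hG 1 0, hG 2 0, hG 2 1] at h ⊢
  linear_combination (c 0 0 * c 1 1 - c 0 1 * c 1 0) * h

/-- Every complete set is equivalent to one of the table, and its joint system separates. -/
theorem IsCompleteSet.exists_reduction {s m : ℝ} (hs : s = 1 ∨ s = -1) (hm : m ≠ 0)
    {U : Set Spacetime} (hU : IsOpen U) (hc : IsConnected U) {A : Spacetime → Fin 3 → ℝ}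
    (hA : ContDiffOn ℝ ∞ A U) {X : Fin 2 → FirstOrder} (hX : IsCompleteSet s m A U X) :
    ∃ (κ : SetKind) (g : Poincare s) (c : Matrix (Fin 2) (Fin 2) ℝ) (d : Fin 2 → ℂ),
      IsUnit c ∧
      (∀ j, ∀ x ∈ g.act '' U,
        (combine c d (fun k => g.conj (X k)) j).xi x = κ.killing j x) ∧
      ∀ C ∈ κ.charts s, ∀ I : Fin 3 → Set ℝ, C.IsBox I → C.region I ⊆ g.act '' U →
        ∃ (a : Fin 3 → ℝ → ℝ) (f : Spacetime → ℝ),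
          (∀ ν, ContDiffOn ℝ ∞ (a ν) (I C.sep)) ∧
          ContDiffOn ℝ ∞ f (C.region I) ∧
          (∀ x ∈ C.region I, ∀ ν, g.potential A x ν = C.potential a x ν + pd ν f x) ∧
          (∀ j, ∀ x ∈ C.region I,
            (combine c d (fun k => g.conj (X k)) j).chi x = (C.operators s κ a j).chi x) ∧
          ∀ (μ : Fin 2 → ℂ) (n : ℕ∞), 1 ≤ n →
          ∀ ψ : Spacetime → Spinor, ContDiffOn ℝ n ψ (g.act ⁻¹' C.region I) →
            (JointSystem s m A X μ (g.act ⁻¹' C.region I) ψ ↔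
              ∃ χ : ℝ → Spinor, ContDiffOn ℝ n χ (I C.sep) ∧
                C.SeparatedODE m a (fun j => (∑ k, (c j k : ℂ) * μ k) + d j) (I C.sep) χ ∧
                ∀ x ∈ g.act ⁻¹' C.region I,
                  ψ x = Complex.exp (-Complex.I * (f (g.act x) : ℂ)) •
                    (g.S *ᵥ C.separated (fun j => (∑ k, (c j k : ℂ) * μ k) + d j) χ
                      (g.act x))) := by
  obtain ⟨hsym, hcomm, hind⟩ := hX
  choose φ₀ hφ₀ using fun j => (hsym j).exists_isSpinSymmetry hs hm hU hA
  obtain ⟨κ, g, c, hcu, hkill⟩ := exists_poincare_of_killing hs hU hc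
    (fun k => (hφ₀ k).smooth_xi) (fun k => (hφ₀ k).killing)
    (fun x hx => ((commute_iff hU hA (hφ₀ 0) (hφ₀ 1) hx).1 fun ψ hψ => hcomm ψ hψ x hx).1) hind
  have hU' := g.isOpen_image hU
  have hc' := g.isConnected_image hc
  have hA' := g.contDiffOn_potential hA
  have hkill' : ∀ j, ∀ x ∈ g.act '' U, ∑ k, c j k • (g.conj (X k)).xi x = κ.killing j x :=
    fun j x hx => hkill j x (by rwa [g.image_eq_preimage] at hx)
  -- The scalar parts are obtained afresh from the determining equations of the transformed
  -- operators, which avoids transforming the field strength.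
  choose φ hφ using fun k => (g.isSymmetry_conj (hsym k)).exists_isSpinSymmetry hs hm hU' hA'
  have hF : ∀ x ∈ g.act '' U, ∑ μ, ∑ ν, fieldStrength (g.potential A) μ ν x *
      κ.killing 0 x μ * κ.killing 1 x ν = 0 := by
    intro x hx
    have h := ((commute_iff hU' hA' (hφ 0) (hφ 1) hx).1
      fun ψ hψ => g.commute_conj hcomm ψ hψ x hx).2.1
    rw [← hkill' 0 x hx, ← hkill' 1 x hx]
    exact contraction_eq_zero (G := fun μ ν => fieldStrength (g.potential A) μ ν x)
      (v := fun k => (g.conj (X k)).xi x) (fun μ ν => by simp [fieldStrength]) h c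
  choose d p hp hchi hpd using fun j =>
    IsSpinSymmetry.exists_scalar_parts hU' hc' hφ (c := c j) (hkill' j)
  refine ⟨κ, g, c, d, hcu, hkill', fun C hC I hI hsub => ?_⟩
  have hCa := SetKind.isAdapted_of_mem_charts s hC
  have hCf := SetKind.isFrame_of_mem_charts hs hC
  have hV := hCa.isOpen_region hI
  obtain ⟨a, f, ha, hf, hAf, hpa⟩ := hCa.exists_gauge hI (hA'.mono hsub)
    (fun j => (hp j).mono hsub) (fun j x hx => hpd j x (hsub hx)) (fun x hx => hF x (hsub hx))
  have hops : ∀ j, ∀ x ∈ C.region I,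
      (combine c d (fun k => g.conj (X k)) j).chi x = (C.operators s κ a j).chi x := by
    intro j x hx
    rw [SepChart.operators_chi, ← hpa j x hx]
    exact hchi j x (hsub hx)
  refine ⟨a, f, ha, hf, hAf, hops, fun μ n hn ψ hψ => ?_⟩
  have hfd : ∀ x ∈ C.region I, DifferentiableAt ℝ f x := fun x hx =>
    (hf.contDiffAt (hV.mem_nhds hx)).differentiableAt (by simp)
  have himg : g.act '' (g.act ⁻¹' C.region I) = C.region I :=
    Set.image_preimage_eq _ fun x => ⟨g.invAct x, g.act_invAct x⟩
  have hT : ContDiffOn ℝ n (g.transport ψ) (C.region I) := by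
    rw [← himg]
    exact contDiffOn_mulVec (fun _ _ => contDiffOn_const) (g.contDiffOn_comp_invAct hψ)
  have hTd : ∀ x ∈ C.region I, DifferentiableAt ℝ (g.transport ψ) x := fun x hx =>
    (hT.contDiffAt (hV.mem_nhds hx)).differentiableAt (coe_ne_zero_of_one_le hn)
  have hG : ContDiffOn ℝ n (fun x => Complex.exp (Complex.I * f x) • g.transport ψ x)
      (C.region I) := by
    have h1 : ContDiffOn ℝ n (fun x => (f x : ℂ)) (C.region I) :=
      Complex.ofRealCLM.contDiff.comp_contDiffOn (hf.of_le (coe_le_infty n))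
    exact (contDiffOn_const.mul h1).cexp.smul hT
  -- Transport by g, recombination, identification of the coefficients and the gauge phase each
  -- preserve the joint system; the separation result of (I) then applies to e^{if} S⁻¹ψ(g⁻¹x).
  rw [← g.jointSystem_transport, ← jointSystem_combine hcu d,
    jointSystem_congr (Y := C.operators s κ a) (fun j x hx => hkill' j x (hsub hx)) hops,
    ← jointSystem_gauge hfd hTd hAf, hCf.jointSystem_iff hCa hI hn hG]
  refine exists_congr fun χ => and_congr_right fun _ => and_congr_right fun _ => ?_
  have hpt : ∀ (x : Spacetime) (w : Spinor),
      Complex.exp (Complex.I * f (g.act x)) • g.transport ψ (g.act x) = w ↔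
      ψ x = Complex.exp (-Complex.I * f (g.act x)) • (g.S *ᵥ w) := by
    intro x w
    rw [Poincare.transport, g.invAct_act]
    have he : Complex.exp (-Complex.I * f (g.act x)) * Complex.exp (Complex.I * f (g.act x)) = 1 := by
      rw [← Complex.exp_add]; simp
    constructor
    · rintro rfl
      rw [Matrix.mulVec_smul, smul_smul, he, one_smul, Matrix.mulVec_mulVec, g.S_mul_inv,
        Matrix.one_mulVec]
    · intro h
      rw [h, Matrix.mulVec_smul, smul_smul, mul_comm, he, one_smul, Matrix.mulVec_mulVec,
        g.inv_mul_S, Matrix.one_mulVec]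
  constructor
  · intro h x hx
    exact (hpt x _).1 (h _ hx)
  · intro h x hx
    have := (hpt (g.invAct x) (C.separated _ χ x)).2 (by
      simpa only [g.act_invAct] using h (g.invAct x) (by rwa [Set.mem_preimage, g.act_invAct]))
    simpa only [g.act_invAct] using this

end DiracSep

end

/-! ### The main theorem. -/

open DiracSep in
theorem theorem5p1 (s m : ℝ) (hs : s = 1 ∨ s = -1) (hm : m ≠ 0) :
    -- every set in the table, with arbitrary functions of one coordinate as potential
    (∀ κ : SetKind,
      Dense (⋃ C ∈ κ.charts s, C.source) ∧
      ∀ C ∈ κ.charts s, C.IsAdapted κ ∧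
        ∀ I : Fin 3 → Set ℝ, C.IsBox I →
        ∀ a : Fin 3 → ℝ → ℝ, (∀ ν, ContDiffOn ℝ ∞ (a ν) (I C.sep)) →
          IsCompleteSet s m (C.potential a) (C.region I) (C.operators s κ a) ∧
          ∀ (lam : Fin 2 → ℂ) (n : ℕ∞), 1 ≤ n →
          ∀ ψ : Spacetime → Spinor, ContDiffOn ℝ n ψ (C.region I) →
            (JointSystem s m (C.potential a) (C.operators s κ a) lam (C.region I) ψ ↔
              ∃ χ : ℝ → Spinor, ContDiffOn ℝ n χ (I C.sep) ∧
                C.SeparatedODE m a lam (I C.sep) χ ∧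
                ∀ x ∈ C.region I, ψ x = C.separated lam χ x)) ∧
    -- every complete set, for any potential, reduces to one in the table and separates
    (∀ U : Set Spacetime, IsOpen U → IsConnected U →
      ∀ A : Spacetime → Fin 3 → ℝ, ContDiffOn ℝ ∞ A U →
      ∀ X : Fin 2 → FirstOrder, IsCompleteSet s m A U X →
        ∃ (κ : SetKind) (g : Poincare s) (c : Matrix (Fin 2) (Fin 2) ℝ) (d : Fin 2 → ℂ),
          IsUnit c ∧
          (∀ j, ∀ x ∈ g.act '' U,
            (combine c d (fun k => g.conj (X k)) j).xi x = κ.killing j x) ∧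
          ∀ C ∈ κ.charts s, ∀ I : Fin 3 → Set ℝ, C.IsBox I → C.region I ⊆ g.act '' U →
            ∃ (a : Fin 3 → ℝ → ℝ) (f : Spacetime → ℝ),
              (∀ ν, ContDiffOn ℝ ∞ (a ν) (I C.sep)) ∧
              ContDiffOn ℝ ∞ f (C.region I) ∧
              (∀ x ∈ C.region I, ∀ ν, g.potential A x ν = C.potential a x ν + pd ν f x) ∧
              (∀ j, ∀ x ∈ C.region I,
                (combine c d (fun k => g.conj (X k)) j).chi x = (C.operators s κ a j).chi x) ∧
              ∀ (μ : Fin 2 → ℂ) (n : ℕ∞), 1 ≤ n →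
              ∀ ψ : Spacetime → Spinor, ContDiffOn ℝ n ψ (g.act ⁻¹' C.region I) →
                (JointSystem s m A X μ (g.act ⁻¹' C.region I) ψ ↔
                  ∃ χ : ℝ → Spinor, ContDiffOn ℝ n χ (I C.sep) ∧
                    C.SeparatedODE m a (fun j => (∑ k, (c j k : ℂ) * μ k) + d j) (I C.sep) χ ∧
                    ∀ x ∈ g.act ⁻¹' C.region I,
                      ψ x = Complex.exp (-Complex.I * (f (g.act x) : ℂ)) •
                        (g.S *ᵥ C.separated (fun j => (∑ k, (c j k : ℂ) * μ k) + d j) χ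
                          (g.act x)))) := by
  refine ⟨fun κ => ⟨κ.dense_sources s, fun C hC => ⟨κ.isAdapted_of_mem_charts s hC,
    fun I hI a ha => ⟨(SetKind.isAdapted_of_mem_charts s hC).isCompleteSet hI ha hs,
      fun lam n hn ψ hψ => (SetKind.isFrame_of_mem_charts hs hC).jointSystem_iff
        (SetKind.isAdapted_of_mem_charts s hC) hI hn hψ⟩⟩⟩,
    fun U hU hc A hA X hX => hX.exists_reduction hs hm hU hc hA⟩
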